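/- For a lattice $x:\mathbb C\to\mathbb C$ put $$\mathbb D_xf(x(s))=\frac{f(x(s+\frac12))-f(x(s-\frac12))}{x(s+\frac12)-x(s-\frac12)},\qquad \mathbb S_xf(x(s))=\frac{f(x(s+\frac12))+f(x(s-\frac12))}{2}.$$ Consider the equation $$\phi(x)\,\mathbb D_x^2y(x)+\psi(x)\,\mathbb S_x\mathbb D_xy(x)+\lambda y(x)=0,\qquad(\ast)$$ where $\phi,\psi\in\mathbb C[x]$ are not both zero, $\deg\phi\le 2$, $\deg\psi\le 1$, and $\lambda\in\mathbb C$ is a constant which may depend on the degree of the solution. The equation is understood at all $s$ at which no denominator in it vanishes. With $(\alpha;q)_k=\prod_{j<k}(1-\alpha q^j)$ and $(\alpha)_k=\prod_{j<k}(\alpha+j)$, let $$p_n(\cos\theta;a,b,c,d\,|\,q)=\frac{(ab,ac,ad;q)_n}{a^n}\;{}_4\phi_3\!\left(\begin{matrix}q^{-n},abcdq^{n-1},ae^{i\theta},ae^{-i\theta}\\ab,ac,ad\end{matrix};q,q\right)\quad(a\ne0),$$ $$W_n(y^2;a,b,c,d)=(a+b)_n(a+c)_n(a+d)_n\;{}_4F_3\!\left(\begin{matrix}-n,n+a+b+c+d-1,a-iy,a+iy\\a+b,a+c,a+d\end{matrix};1\right),$$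 $$S_n(y^2;a,b,c)=(a+b)_n(a+c)_n\;{}_3F_2\!\left(\begin{matrix}-n,a-iy,a+iy\\a+b,a+c\end{matrix};1\right)$$ be the Askey–Wilson, Wilson and continuous dual Hahn polynomials; the prefactors are multiplied into the sums, so that no parameter is excluded by a vanishing denominator. For $t=(t_1,t_2,t_3,t_4)$ in $(\mathbb C\cup\{\infty\})^4$, where $\mathbb C\cup\{\infty\}$ is the Riemann sphere, "a polynomial of degree $n$ of the Askey–Wilson (or Wilson) family with parameters $t$" means a polynomial of degree $n$ which is a coefficientwise limit of constant multiples of the polynomials $p_n$ (or $W_n$) with complex parameters $(a,b,c,d)\to t$. **(1)** Let $x(s)=c_1q^{-s}+c_2q^s+c_3$ with $c_1c_2\ne0$, $q\in\mathbb C\setminus\{0\}$ not a root of unity, and $q^s$ defined by the principal logarithm. Let $w^2=c_1c_2$, and take $p_n$ at the argument $\frac{x-c_3}{2w}$. * For every $(\phi,\psi)$ as above there is $t\in(\mathbb C\cup\{\infty\})^4$ such that, for every $n\ge1$, a polynomial of degree $n$ satisfies $(\ast)$ for some $\lambda$ if and only if it belongs to the Askey–Wilson family with parameters $t$. * Conversely,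 for every $t$ there is such a $(\phi,\psi)$ for which the same equivalence holds for all $n\ge1$. * In both assertions, $\deg\psi=1$ if and only if $0$ and $\infty$ do not both occur in $t$ and, in case $t=(a,b,c,d)$ is finite, $abcd\neq1$. * If $t=(a,b,c,d)$ is finite, $a\neq0$, $n\ge1$ and $p_n(\,\cdot\,;a,b,c,d\,|\,q)$ has degree $n$, then the members of degree $n$ of the family are exactly the nonzero multiples of $p_n\big(\frac{x-c_3}{2w};a,b,c,d\,|\,q\big)$. **(2)** Let $x(s)=c_4s^2+c_5s+c_6$ with $c_4\neq0$, and take $W_n$ and $S_n$ at the argument $-\frac1{c_4}\big(x-c_6+\frac{c_5^2}{4c_4}\big)=-\big(s+\frac{c_5}{2c_4}\big)^2$. * For every $(\phi,\psi)$ as above there is $t\in(\mathbb C\cup\{\infty\})^4$ such that, for every $n\ge1$, a polynomial of degree $n$ satisfies $(\ast)$ for some $\lambda$ if and only if it belongs to the Wilson family with parameters $t$. * Conversely, for every $t$ there is such a $(\phi,\psi)$ for which the same equivalence holds for all $n\ge1$. * In both assertions, $\deg\psi=1$ if and only if at most one entry of $t$ is $\infty$ and, in case $t=(a,b,c,d)$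 is finite, $a+b+c+d\neq0$. * If $t=(a,b,c,d)$ is finite, $n\ge1$ and $W_n(\,\cdot\,;a,b,c,d)$ has degree $n$, then the members of degree $n$ of the family are exactly the nonzero multiples of $W_n(\,\cdot\,;a,b,c,d)$. If $t=(a,b,c,\infty)$ with $a,b,c$ finite and $n\ge1$, they are exactly the nonzero multiples of the continuous dual Hahn polynomial $S_n(\,\cdot\,;a,b,c)$. -/

import Mathlib

open Polynomial Filter Topology Finset

noncomputable section

namespace QuadraticLattice

/-- The `q`-quadratic lattice `x(s) = c₁ q^{-s} + c₂ q^s + c₃`, with `q^s = exp (s log q)`. -/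
def qQuadratic (q c₁ c₂ c₃ : ℂ) (s : ℂ) : ℂ := c₁ * q ^ (-s) + c₂ * q ^ s + c₃

/-- The quadratic lattice `x(s) = c₄ s² + c₅ s + c₆`. -/
def quadratic (c₄ c₅ c₆ : ℂ) (s : ℂ) : ℂ := c₄ * s ^ 2 + c₅ * s + c₆

/-- The divided-difference operator `𝔻ₓ`. A function of `x(s)` is written as a function `F` of `s`,
so `F s = f (x s)`. -/
def divDiff (x F : ℂ → ℂ) (s : ℂ) : ℂ :=
  (F (s + 1 / 2) - F (s - 1 / 2)) / (x (s + 1 / 2) - x (s - 1 / 2))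

/-- The averaging operator `𝕊ₓ`, on functions of `s`. -/
def avg (F : ℂ → ℂ) (s : ℂ) : ℂ := (F (s + 1 / 2) + F (s - 1 / 2)) / 2

/-- The equation `φ(x) 𝔻ₓ² P(x) + ψ(x) 𝕊ₓ 𝔻ₓ P(x) + lam P(x) = 0` on the lattice `x = x(s)`, at
every `s` at which none of the denominators in `𝔻ₓ² P` and `𝕊ₓ 𝔻ₓ P` is zero. -/
def SturmLiouville (x : ℂ → ℂ) (φ ψ : ℂ[X]) (lam : ℂ) (P : ℂ[X]) : Prop :=
  ∀ s : ℂ, x (s + 1) ≠ x s → x s ≠ x (s - 1) → x (s + 1 / 2) ≠ x (s - 1 / 2) →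
    φ.eval (x s) * divDiff x (divDiff x fun z => P.eval (x z)) s
      + ψ.eval (x s) * avg (divDiff x fun z => P.eval (x z)) s
      + lam * P.eval (x s) = 0

/-- The polynomials of degree `n` that solve the equation for some constant `lam`. -/
def solutions (x : ℂ → ℂ) (φ ψ : ℂ[X]) (n : ℕ) : Set ℂ[X] :=
  {P | P.natDegree = n ∧ ∃ lam : ℂ, SturmLiouville x φ ψ lam P}

/-- The coefficients that the equation may have: `deg φ ≤ 2`, `deg ψ ≤ 1`, not both zero. -/
def Coefficients (φ ψ : ℂ[X]) : Prop :=
  φ.natDegree ≤ 2 ∧ ψ.natDegree ≤ 1 ∧ ¬ (φ = 0 ∧ ψ = 0)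

/-- The `q`-shifted factorial `(a; q)_k`. -/
def qPoch (a q : ℂ) (k : ℕ) : ℂ := ∏ j ∈ range k, (1 - a * q ^ j)

/-- The shifted factorial `(a)_k = a (a + 1) ⋯ (a + k - 1)`. -/
def poch (a : ℂ) (k : ℕ) : ℂ := (ascPochhammer ℂ k).eval a

/-- The Askey–Wilson polynomial
`p_n(y; a, b, c, d | q) = a^{-n} (ab, ac, ad; q)_n
  ₄φ₃(q^{-n}, abcd q^{n-1}, a e^{iθ}, a e^{-iθ}; ab, ac, ad; q, q)`, `y = cos θ`, for `a ≠ 0`.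
The factor `(ab; q)_n / (ab; q)_k` is written as `(ab q^k; q)_{n-k}`, so that no denominator
depends on `b`, `c`, `d`, and `(a e^{iθ}, a e^{-iθ}; q)_k` is `∏_{j < k} (1 - 2 a q^j y + a² q^{2j})`. -/
def askeyWilson (q : ℂ) (n : ℕ) (a b c d : ℂ) : ℂ[X] :=
  ∑ k ∈ range (n + 1),
    C (a ^ (-(n : ℤ)) * (qPoch (q ^ (-(n : ℤ))) q k * qPoch (a * b * c * d * q ^ ((n : ℤ) - 1)) q k
        / qPoch q q k) * q ^ k
        * (qPoch (a * b * q ^ k) q (n - k) * qPoch (a * c * q ^ k) q (n - k)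
        * qPoch (a * d * q ^ k) q (n - k)))
      * ∏ j ∈ range k, (1 - C (2 * a * q ^ j) * X + C (a ^ 2 * q ^ (2 * j)))

/-- The Wilson polynomial `W_n(y; a, b, c, d)`, `y = x²`:
`(a+b)_n (a+c)_n (a+d)_n ₄F₃(-n, n+a+b+c+d-1, a-ix, a+ix; a+b, a+c, a+d; 1)`.
The factor `(a+b)_n / (a+b)_k` is written as `(a+b+k)_{n-k}`, and
`(a-ix)_k (a+ix)_k` is `∏_{j < k} ((a+j)² + y)`. -/
def wilson (n : ℕ) (a b c d : ℂ) : ℂ[X] :=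
  ∑ k ∈ range (n + 1),
    C (poch (-n) k * poch (n + a + b + c + d - 1) k / (k.factorial : ℂ)
        * (poch (a + b + k) (n - k) * poch (a + c + k) (n - k) * poch (a + d + k) (n - k)))
      * ∏ j ∈ range k, (C ((a + j) ^ 2) + X)

/-- The continuous dual Hahn polynomial `S_n(y; a, b, c)`, `y = x²`:
`(a+b)_n (a+c)_n ₃F₂(-n, a-ix, a+ix; a+b, a+c; 1)`. -/
def continuousDualHahn (n : ℕ) (a b c : ℂ) : ℂ[X] :=
  ∑ k ∈ range (n + 1),
    C (poch (-n) k / (k.factorial : ℂ) * (poch (a + b + k) (n - k) * poch (a + c + k) (n - k)))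
      * ∏ j ∈ range k, (C ((a + j) ^ 2) + X)

/-- The Askey–Wilson polynomial on the lattice `x(s) = c₁ q^{-s} + c₂ q^s + c₃`: its argument is
`(u^{1/2} q^s + u^{-1/2} q^{-s}) / 2 = (x - c₃) / (2w)`, where `u = c₂ / c₁` and
`w = c₁ u^{1/2}`, a square root of `c₁ c₂`. -/
def askeyWilsonOn (q c₃ w : ℂ) (n : ℕ) (a b c d : ℂ) : ℂ[X] :=
  (askeyWilson q n a b c d).comp (C (1 / (2 * w)) * (X - C c₃))

/-- The argument of the Wilson and continuous dual Hahn polynomials on the lattice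
`x(s) = c₄ s² + c₅ s + c₆`, as a polynomial in `x`:
`-(s + u/2)² = -(x - c₆ + c₅² / (4 c₄)) / c₄`, `u = c₅ / c₄`. -/
def wilsonArg (c₄ c₅ c₆ : ℂ) : ℂ[X] := C (-1 / c₄) * (X - C (c₆ - c₅ ^ 2 / (4 * c₄)))

/-- The Wilson polynomial on the lattice `x(s) = c₄ s² + c₅ s + c₆`. -/
def wilsonOn (c₄ c₅ c₆ : ℂ) (n : ℕ) (a b c d : ℂ) : ℂ[X] :=
  (wilson n a b c d).comp (wilsonArg c₄ c₅ c₆)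

/-- The continuous dual Hahn polynomial on the lattice `x(s) = c₄ s² + c₅ s + c₆`. -/
def continuousDualHahnOn (c₄ c₅ c₆ : ℂ) (n : ℕ) (a b c : ℂ) : ℂ[X] :=
  (continuousDualHahn n a b c).comp (wilsonArg c₄ c₅ c₆)

/-- The nonzero multiples of `Q`. -/
def multiples (Q : ℂ[X]) : Set ℂ[X] := {P | ∃ k : ℂ, k ≠ 0 ∧ P = C k * Q}

/-- The polynomials of degree `n` that are limits, coefficient by coefficient, of multiples of
`p a b c d`, as the parameters `(a, b, c, d) ∈ D` tend to the point `t` of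
`(ℂ ∪ {∞})⁴`, where `ℂ ∪ {∞}` is the Riemann sphere. -/
def limits (p : ℂ → ℂ → ℂ → ℂ → ℂ[X]) (D : Set (Fin 4 → ℂ)) (n : ℕ) (t : Fin 4 → OnePoint ℂ) :
    Set ℂ[X] :=
  {P | P.natDegree = n ∧ ∃ (τ : ℕ → Fin 4 → ℂ) (κ : ℕ → ℂ),
    (∀ j, τ j ∈ D) ∧
    (∀ i, Tendsto (fun j => (τ j i : OnePoint ℂ)) atTop (𝓝 (t i))) ∧
    ∀ m, Tendsto (fun j => κ j * (p (τ j 0) (τ j 1) (τ j 2) (τ j 3)).coeff m) atTop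
      (𝓝 (P.coeff m))}

/-- The Askey–Wilson polynomials of degree `n` with parameters `t` in `ℂ ∪ {∞}`, up to multiples,
on a `q`-quadratic lattice. -/
def askeyWilsonFamily (q c₃ w : ℂ) (n : ℕ) (t : Fin 4 → OnePoint ℂ) : Set ℂ[X] :=
  limits (askeyWilsonOn q c₃ w n) {τ | τ 0 ≠ 0} n t

/-- The Wilson polynomials of degree `n` with parameters `t` in `ℂ ∪ {∞}`, up to multiples,
on a quadratic lattice. -/
def wilsonFamily (c₄ c₅ c₆ : ℂ) (n : ℕ) (t : Fin 4 → OnePoint ℂ) : Set ℂ[X] :=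
  limits (wilsonOn c₄ c₅ c₆ n) Set.univ n t

/-- Not both `0` and `∞` occur among the parameters and, if all are finite, `abcd ≠ 1`. -/
def AWRegular (t : Fin 4 → OnePoint ℂ) : Prop :=
  (∀ i j, t i = ((0 : ℂ) : OnePoint ℂ) → t j ≠ OnePoint.infty) ∧
  ∀ a b c d : ℂ, t = ![(a : OnePoint ℂ), b, c, d] → a * b * c * d ≠ 1

/-- At most one of the parameters is `∞` and, if all are finite, `a + b + c + d ≠ 0`. -/
def WilsonRegular (t : Fin 4 → OnePoint ℂ) : Prop :=
  (∀ i j, t i = OnePoint.infty → t j = OnePoint.infty → i = j) ∧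
  ∀ a b c d : ℂ, t = ![(a : OnePoint ℂ), b, c, d] → a + b + c + d ≠ 0

end QuadraticLattice

end

open Polynomial Filter Topology Finset

noncomputable section

namespace QuadraticLattice


/-! On polynomials the difference part of the equation is the operator `T = φ 𝔻² + ψ 𝕊 𝔻`. It does
not raise degrees, so it is triangular in the monomials: `λ` must be minus a diagonal entry (`eig`),
and for `n ≥ 1` the solutions of degree `n` are the eigenvectors of degree `n`. An affine
substitution brings every lattice to `(z + z⁻¹) / 2` or to `-s²`.

The pair `(φ, ψ)` has five coefficients and corresponds linearly and bijectively to a binary quartic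
form `F`. Over `ℂ` a nonzero form is, up to a constant, a product of four linear factors, that is,
four points of the Riemann sphere: a finite `a` gives `1 + a X`, and `∞` gives `X`
(`exists_eq_sphereForm`). This is where `t` comes from. For finite parameters `T` is the
Askey–Wilson or Wilson difference operator. It is bidiagonal in a basis of shifted factorials
(`op_awBasis_succ`, `op_wilsonBasis_succ`); the resulting two-term recurrence makes `p_n` or `W_n`
an eigenvector, of full degree exactly when the `n`-th eigenvalue differs from all lower ones
(`Scheme.IsFamily`).

It remains to identify eigenvectors of degree `n` with limits of the classical polynomials. Limits
are eigenvectors, because the forms converge after rescaling and the eigenvector equation is closed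
(`IsFamily.limits_subset`). Conversely, if the eigenvalue is simple, the product of `T - μₖ` over `k
< n`, applied to `X ^ n`, is an eigenvector that depends continuously on `F`, and for nearby finite
parameters it is a multiple of the classical polynomial (`IsFamily.eigenvectors_subset_of_simple`).

If the eigenvalue is not simple, there may be no eigenvector of degree `n`. If there is one, the
eigenvectors are up to scale the polynomials `V + c U` with `U` of lower degree
(`eigenvectors_subset_of_plane`), and every `c` has to be reached by a limit. The parameters then
approach `t` along sequences on which two infinitesimals have a prescribed ratio. For finite `t`
with `abcd q^(m+n-1) = 1`, or `a + b + c + d + m + n - 1 = 0`, the classical polynomial splits into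
two parts with scalar factors that vanish independently (`awSum_split`, `wilson_split`). Otherwise
all eigenvalues are zero, which means that `0` and `∞` both occur (Askey–Wilson) or `∞` occurs twice
(Wilson); explicit sequences of parameters settle these cases.

The condition `deg ψ = 1` says that one coefficient, linear in `F`, is nonzero; in terms of `t` this
is the regularity condition. -/

/-! ### Coefficientwise convergence of polynomials -/

/-- Coefficientwise convergence of a sequence of polynomials. -/
def CoeffTendsto (f : ℕ → ℂ[X]) (P : ℂ[X]) : Prop :=
  ∀ m, Tendsto (fun j => (f j).coeff m) atTop (𝓝 (P.coeff m))

namespace CoeffTendsto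

variable {f g : ℕ → ℂ[X]} {P Q : ℂ[X]}

theorem const (P : ℂ[X]) : CoeffTendsto (fun _ => P) P := fun _ => tendsto_const_nhds

theorem add (hf : CoeffTendsto f P) (hg : CoeffTendsto g Q) :
    CoeffTendsto (fun j => f j + g j) (P + Q) := fun m => by
  simpa only [coeff_add] using (hf m).add (hg m)

theorem sub (hf : CoeffTendsto f P) (hg : CoeffTendsto g Q) :
    CoeffTendsto (fun j => f j - g j) (P - Q) := fun m => by
  simpa only [coeff_sub] using (hf m).sub (hg m)

theorem mul (hf : CoeffTendsto f P) (hg : CoeffTendsto g Q) :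
    CoeffTendsto (fun j => f j * g j) (P * Q) := fun m => by
  simp only [coeff_mul]
  exact tendsto_finsetSum _ fun x _ => (hf x.1).mul (hg x.2)

theorem C {u : ℕ → ℂ} {c : ℂ} (hu : Tendsto u atTop (𝓝 c)) :
    CoeffTendsto (fun j => Polynomial.C (u j)) (Polynomial.C c) := fun m => by
  simp only [coeff_C]
  split_ifs
  · exact hu
  · exact tendsto_const_nhds

theorem smul {u : ℕ → ℂ} {c : ℂ} (hu : Tendsto u atTop (𝓝 c)) (hf : CoeffTendsto f P) :
    CoeffTendsto (fun j => u j • f j) (c • P) := fun m => by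
  simpa only [coeff_smul, smul_eq_mul] using hu.mul (hf m)

theorem sum {ι : Type*} (s : Finset ι) {F : ι → ℕ → ℂ[X]} {G : ι → ℂ[X]}
    (h : ∀ i ∈ s, CoeffTendsto (F i) (G i)) :
    CoeffTendsto (fun j => ∑ i ∈ s, F i j) (∑ i ∈ s, G i) := fun m => by
  simp only [finsetSum_coeff]
  exact tendsto_finsetSum _ fun i hi => h i hi m

theorem prod {ι : Type*} (s : Finset ι) {F : ι → ℕ → ℂ[X]} {G : ι → ℂ[X]}
    (h : ∀ i ∈ s, CoeffTendsto (F i) (G i)) :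
    CoeffTendsto (fun j => ∏ i ∈ s, F i j) (∏ i ∈ s, G i) := by
  classical
  induction s using Finset.induction_on with
  | empty => simpa using const 1
  | insert a s ha ih =>
    simp only [Finset.prod_insert ha]
    exact (h a (mem_insert_self _ _)).mul (ih fun i hi => h i (mem_insert_of_mem hi))

theorem congr' (hf : CoeffTendsto f P) (h : ∀ᶠ j in atTop, f j = g j) : CoeffTendsto g P :=
  fun m => (hf m).congr' (h.mono fun j hj => by simp only [hj])

theorem unique (hf : CoeffTendsto f P) (hg : CoeffTendsto f Q) : P = Q :=
  Polynomial.ext fun m => tendsto_nhds_unique (hf m) (hg m)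

theorem natDegree_le {n : ℕ} (hf : CoeffTendsto f P) (hn : ∀ j, (f j).natDegree ≤ n) :
    P.natDegree ≤ n := by
  rw [natDegree_le_iff_coeff_eq_zero]
  intro m hm
  refine tendsto_nhds_unique (hf m) ?_
  simp only [fun j => coeff_eq_zero_of_natDegree_lt ((hn j).trans_lt hm)]
  exact tendsto_const_nhds

end CoeffTendsto

theorem map_eq_sum_coeff {n : ℕ} (A : ℂ[X] →ₗ[ℂ] ℂ[X]) {f : ℂ[X]} (hf : f.natDegree ≤ n) :
    A f = ∑ k ∈ range (n + 1), f.coeff k • A (X ^ k) := by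
  conv_lhs => rw [f.as_sum_range_C_mul_X_pow' (Nat.lt_succ_of_le hf)]
  simp only [map_sum, ← smul_eq_C_mul, map_smul]

/-- A linear map is continuous on the finite-dimensional space of polynomials of degree at most `n`;
a bound on the degrees uniform in `j` is essential. -/
theorem CoeffTendsto.map {n : ℕ} {f : ℕ → ℂ[X]} {P : ℂ[X]} (A : ℂ[X] →ₗ[ℂ] ℂ[X])
    (hf : CoeffTendsto f P) (hn : ∀ j, (f j).natDegree ≤ n) :
    CoeffTendsto (fun j => A (f j)) (A P) := by
  simp only [fun j => map_eq_sum_coeff A (hn j), map_eq_sum_coeff A (hf.natDegree_le hn)]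
  exact CoeffTendsto.sum _ fun k _ => CoeffTendsto.smul (hf k) (CoeffTendsto.const _)

/-! ### Divided-difference and averaging operators on polynomials -/

/-- The constants of a quadratic or `q`-quadratic lattice: the mean of `x(s + 1/2)` and
`x(s - 1/2)` is `α x(s) + β`, and the square of half their difference is `U(x(s))`. -/
structure LatticeData where
  α : ℂ
  β : ℂ
  U : ℂ[X]
  natDegree_U : U.natDegree ≤ 2
  coeff_U : U.coeff 2 = α ^ 2 - 1

namespace LatticeData

variable (L : LatticeData)

/-- The images of `X ^ n` under the divided-difference and the averaging operator. -/
def monomialPair : ℕ → ℂ[X] × ℂ[X]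
  | 0 => (0, 1)
  -- These are the product rules `𝔻(fg) = 𝔻f 𝕊g + 𝕊f 𝔻g` and `𝕊(fg) = U 𝔻f 𝔻g + 𝕊f 𝕊g` for `f = X`,
  -- where `𝔻X = 1` and `𝕊X = α X + β`.
  | n + 1 => ((monomialPair n).2 + (C L.α * X + C L.β) * (monomialPair n).1,
      L.U * (monomialPair n).1 + (C L.α * X + C L.β) * (monomialPair n).2)

/-- The coefficients `(γₙ, αₙ)` of `X ^ (n - 1)` and `X ^ n` in the images of `X ^ n`. -/
def leadPair : ℕ → ℂ × ℂ
  | 0 => (0, 1)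
  | n + 1 => ((leadPair n).2 + L.α * (leadPair n).1,
      (L.α ^ 2 - 1) * (leadPair n).1 + L.α * (leadPair n).2)

/-- The divided-difference operator on polynomials. -/
def dOp : ℂ[X] →ₗ[ℂ] ℂ[X] := (basisMonomials ℂ).constr ℂ fun n => (L.monomialPair n).1

/-- The averaging operator on polynomials. -/
def sOp : ℂ[X] →ₗ[ℂ] ℂ[X] := (basisMonomials ℂ).constr ℂ fun n => (L.monomialPair n).2

theorem dOp_X_pow (n : ℕ) : L.dOp (X ^ n) = (L.monomialPair n).1 := by
  have := (basisMonomials ℂ).constr_basis ℂ (fun n => (L.monomialPair n).1) n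
  simp only [coe_basisMonomials, monomial_one_right_eq_X_pow] at this
  exact this

theorem sOp_X_pow (n : ℕ) : L.sOp (X ^ n) = (L.monomialPair n).2 := by
  have := (basisMonomials ℂ).constr_basis ℂ (fun n => (L.monomialPair n).2) n
  simp only [coe_basisMonomials, monomial_one_right_eq_X_pow] at this
  exact this

/-- The top coefficients inherit the recursion of the pair, since `U` has `α² - 1` at `X²`. For `n =
0` the truncated `n - 1` does no harm, because the first component is zero. -/
theorem monomialPair_degree (n : ℕ) :
    ((L.monomialPair n).1.natDegree ≤ n - 1 ∧
      (L.monomialPair n).1.coeff (n - 1) = (L.leadPair n).1) ∧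
    (L.monomialPair n).2.natDegree ≤ n ∧ (L.monomialPair n).2.coeff n = (L.leadPair n).2 := by
  have hl : (C L.α * X + C L.β).natDegree ≤ 1 := natDegree_linear_le
  have hl1 : (C L.α * X + C L.β).coeff 1 = L.α := by simp
  induction n with
  | zero => simp [monomialPair, leadPair]
  | succ n ih =>
    obtain ⟨⟨h1, h2⟩, h3, h4⟩ := ih
    rcases n with _ | n
    · simp only [monomialPair, leadPair]
      refine ⟨⟨?_, ?_⟩, ?_, ?_⟩
      · simp
      · simp
      · simpa using hl
      · simp
    · simp only [Nat.add_sub_cancel] at h1 h2 ⊢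
      rw [monomialPair, leadPair]
      refine ⟨⟨?_, ?_⟩, ?_, ?_⟩
      · exact natDegree_add_le_of_degree_le h3
          ((natDegree_mul_le_of_le hl h1).trans (by omega))
      · have := coeff_mul_add_eq_of_natDegree_le hl h1
        rw [add_comm 1 n] at this
        rw [coeff_add, h4, this, hl1, h2]
      · exact natDegree_add_le_of_degree_le
          ((natDegree_mul_le_of_le L.natDegree_U h1).trans (by omega))
          ((natDegree_mul_le_of_le hl h3).trans (by omega))
      · rw [coeff_add]
        congr 1
        · rw [show n + 1 + 1 = 2 + n by omega,
            coeff_mul_add_eq_of_natDegree_le L.natDegree_U h1, h2, L.coeff_U]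
        · rw [show n + 1 + 1 = 1 + (n + 1) by omega, coeff_mul_add_eq_of_natDegree_le hl h3, hl1,
            h4]

theorem natDegree_dOp_le {n : ℕ} {f : ℂ[X]} (hf : f.natDegree ≤ n) :
    (L.dOp f).natDegree ≤ n - 1 := by
  rw [map_eq_sum_coeff L.dOp hf]
  refine natDegree_sum_le_of_forall_le _ _ fun k hk => (natDegree_smul_le _ _).trans ?_
  rw [dOp_X_pow]
  have := mem_range.1 hk
  exact (L.monomialPair_degree k).1.1.trans (by omega)

theorem dOp_eq_zero {f : ℂ[X]} (hf : f.natDegree ≤ 0) : L.dOp f = 0 := by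
  rw [map_eq_sum_coeff L.dOp hf]
  rw [sum_range_one, dOp_X_pow, monomialPair, smul_zero]

theorem coeff_dOp {n : ℕ} {f : ℂ[X]} (hf : f.natDegree ≤ n) :
    (L.dOp f).coeff (n - 1) = (L.leadPair n).1 * f.coeff n := by
  rw [map_eq_sum_coeff L.dOp hf, finsetSum_coeff, sum_range_succ, sum_eq_zero, zero_add,
    coeff_smul, dOp_X_pow, (L.monomialPair_degree n).1.2, smul_eq_mul, mul_comm]
  intro k hk
  have hk := mem_range.1 hk
  rw [coeff_smul, dOp_X_pow]
  rcases k with _ | k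
  · simp [monomialPair]
  · have := (L.monomialPair_degree (k + 1)).1.1
    rw [coeff_eq_zero_of_natDegree_lt (p := (L.monomialPair (k + 1)).1) (by omega), smul_zero]

theorem natDegree_sOp_le {n : ℕ} {f : ℂ[X]} (hf : f.natDegree ≤ n) :
    (L.sOp f).natDegree ≤ n := by
  rw [map_eq_sum_coeff L.sOp hf]
  refine natDegree_sum_le_of_forall_le _ _ fun k hk => (natDegree_smul_le _ _).trans ?_
  rw [sOp_X_pow]
  have := mem_range.1 hk
  exact (L.monomialPair_degree k).2.1.trans (by omega)

theorem coeff_sOp {n : ℕ} {f : ℂ[X]} (hf : f.natDegree ≤ n) :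
    (L.sOp f).coeff n = (L.leadPair n).2 * f.coeff n := by
  rw [map_eq_sum_coeff L.sOp hf, finsetSum_coeff, sum_range_succ, sum_eq_zero, zero_add,
    coeff_smul, sOp_X_pow, (L.monomialPair_degree n).2.2, smul_eq_mul, mul_comm]
  intro k hk
  have hk := mem_range.1 hk
  have := (L.monomialPair_degree k).2.1
  rw [coeff_smul, sOp_X_pow, coeff_eq_zero_of_natDegree_lt (p := (L.monomialPair k).2) (by omega),
    smul_zero]

/-- The operators evaluated at `y = x(s)`, where `y₁ = x(s + 1/2)` and `y₂ = x(s - 1/2)`. -/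
theorem eval_dOp_sOp {y y₁ y₂ : ℂ} (h1 : y₁ + y₂ = 2 * (L.α * y + L.β))
    (h2 : (y₁ - y₂) ^ 2 = 4 * L.U.eval y) (f : ℂ[X]) :
    (L.dOp f).eval y * (y₁ - y₂) = f.eval y₁ - f.eval y₂ ∧
      (L.sOp f).eval y = (f.eval y₁ + f.eval y₂) / 2 := by
  have key : ∀ n, (L.monomialPair n).1.eval y * (y₁ - y₂) = y₁ ^ n - y₂ ^ n ∧
      (L.monomialPair n).2.eval y = (y₁ ^ n + y₂ ^ n) / 2 := by
    intro n
    induction n with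
    | zero => simp [monomialPair]
    | succ n ih =>
      obtain ⟨ih1, ih2⟩ := ih
      simp only [monomialPair, eval_add, eval_mul, eval_C, eval_X]
      -- The mean and the squared half difference of `y₁`, `y₂` replace `α y + β` and `U(y)`; the
      -- recursion becomes an identity in `y₁`, `y₂`. The difference stays a factor, so `y₁ = y₂` is
      -- allowed.
      have hm : L.α * y + L.β = (y₁ + y₂) / 2 := by rw [h1]; ring
      have hU : L.U.eval y = (y₁ - y₂) ^ 2 / 4 := by rw [h2]; ring
      rw [hm, hU, ih2]
      constructor
      · rw [add_mul, mul_assoc, ih1]; ring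
      · have : (y₁ - y₂) ^ 2 / 4 * (L.monomialPair n).1.eval y =
            (y₁ - y₂) / 4 * ((L.monomialPair n).1.eval y * (y₁ - y₂)) := by ring
        rw [this, ih1]; ring
  constructor
  · rw [map_eq_sum_coeff L.dOp le_rfl, eval_eq_sum_range (x := y₁), eval_eq_sum_range (x := y₂),
      eval_finsetSum, sum_mul, ← sum_sub_distrib]
    refine sum_congr rfl fun k _ => ?_
    rw [eval_smul, dOp_X_pow, smul_eq_mul, mul_assoc, (key k).1]; ring
  · rw [map_eq_sum_coeff L.sOp le_rfl, eval_eq_sum_range (x := y₁), eval_eq_sum_range (x := y₂),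
      eval_finsetSum, ← sum_add_distrib, sum_div]
    refine sum_congr rfl fun k _ => ?_
    rw [eval_smul, sOp_X_pow, smul_eq_mul, (key k).2]; ring

/-! ### The second-order operator -/

/-- The operator `φ 𝔻² + ψ 𝕊 𝔻`. -/
def slOp (φ ψ : ℂ[X]) : ℂ[X] →ₗ[ℂ] ℂ[X] :=
  LinearMap.mulLeft ℂ φ ∘ₗ L.dOp ∘ₗ L.dOp + LinearMap.mulLeft ℂ ψ ∘ₗ L.sOp ∘ₗ L.dOp

theorem slOp_apply (φ ψ f : ℂ[X]) :
    L.slOp φ ψ f = φ * L.dOp (L.dOp f) + ψ * L.sOp (L.dOp f) := rfl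

theorem slOp_C_mul (c : ℂ) (φ ψ f : ℂ[X]) :
    L.slOp (C c * φ) (C c * ψ) f = c • L.slOp φ ψ f := by
  simp only [slOp_apply, smul_eq_C_mul]; ring

theorem slOp_of_natDegree_eq_zero {φ ψ f : ℂ[X]} (hf : f.natDegree ≤ 0) : L.slOp φ ψ f = 0 := by
  simp [slOp_apply, L.dOp_eq_zero hf]

/-- The case `d = 1` gives the eigenvalues; the case `d = 0` serves the degenerate equations, whose
operator lowers the degree by one. -/
theorem slOp_degree {φ ψ f : ℂ[X]} {d m : ℕ} (hφ : φ.natDegree ≤ d + 1) (hψ : ψ.natDegree ≤ d)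
    (hf : f.natDegree ≤ m + 1) :
    (L.slOp φ ψ f).natDegree ≤ d + m ∧ (L.slOp φ ψ f).coeff (d + m) =
      (L.leadPair (m + 1)).1 * (φ.coeff (d + 1) * (L.leadPair m).1 + ψ.coeff d * (L.leadPair m).2)
        * f.coeff (m + 1) := by
  have h1 : (L.dOp f).natDegree ≤ m := L.natDegree_dOp_le hf
  have c1 : (L.dOp f).coeff m = (L.leadPair (m + 1)).1 * f.coeff (m + 1) := L.coeff_dOp hf
  have h3 := L.natDegree_sOp_le h1
  have c3 := L.coeff_sOp h1
  have hS : (ψ * L.sOp (L.dOp f)).natDegree ≤ d + m := natDegree_mul_le_of_le hψ h3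
  have cS := coeff_mul_add_eq_of_natDegree_le hψ h3
  rw [slOp_apply]
  rcases m with _ | m
  -- For `m = 0` there is no second difference, in agreement with the vanishing first entry of
  -- `leadPair 0`.
  · rw [L.dOp_eq_zero h1, mul_zero, zero_add, cS, c3, c1]
    refine ⟨hS, ?_⟩
    simp [leadPair]
  · have h2 : (L.dOp (L.dOp f)).natDegree ≤ m := L.natDegree_dOp_le h1
    have c2 : (L.dOp (L.dOp f)).coeff m = _ := L.coeff_dOp h1
    have cD := coeff_mul_add_eq_of_natDegree_le hφ h2
    refine ⟨natDegree_add_le_of_degree_le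
      ((natDegree_mul_le_of_le hφ h2).trans (by omega)) hS, ?_⟩
    rw [coeff_add, cS, show d + (m + 1) = d + 1 + m by omega, cD, c2, c3, c1]
    ring

/-- The coefficient of `X ^ n` in the image of `X ^ n` under `φ 𝔻² + ψ 𝕊 𝔻`. -/
def eig (φ ψ : ℂ[X]) (n : ℕ) : ℂ :=
  (L.leadPair n).1 * (φ.coeff 2 * (L.leadPair (n - 1)).1 + ψ.coeff 1 * (L.leadPair (n - 1)).2)

theorem slOp_natDegree_le {φ ψ f : ℂ[X]} {n : ℕ} (hφ : φ.natDegree ≤ 2) (hψ : ψ.natDegree ≤ 1)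
    (hf : f.natDegree ≤ n) : (L.slOp φ ψ f).natDegree ≤ n := by
  rcases n with _ | n
  · simp [L.slOp_of_natDegree_eq_zero hf]
  · rw [add_comm]; exact (L.slOp_degree hφ hψ hf).1

theorem slOp_coeff {φ ψ f : ℂ[X]} {n : ℕ} (hφ : φ.natDegree ≤ 2) (hψ : ψ.natDegree ≤ 1)
    (hf : f.natDegree ≤ n) : (L.slOp φ ψ f).coeff n = L.eig φ ψ n * f.coeff n := by
  rcases n with _ | n
  · simp [L.slOp_of_natDegree_eq_zero hf, eig, leadPair]
  · have := (L.slOp_degree (d := 1) hφ hψ hf).2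
    rw [add_comm 1 n] at this
    rw [this]; rfl

/-- By triangularity the leading coefficient of an eigenvector decides its eigenvalue, so the
eigenvalue is a function of the degree. -/
theorem eq_eig_of_slOp_eq {φ ψ f : ℂ[X]} {μ : ℂ} (hφ : φ.natDegree ≤ 2) (hψ : ψ.natDegree ≤ 1)
    (hf : f ≠ 0) (h : L.slOp φ ψ f = μ • f) : μ = L.eig φ ψ f.natDegree := by
  have := L.slOp_coeff hφ hψ (le_refl f.natDegree)
  rw [h, coeff_smul, smul_eq_mul] at this
  exact mul_right_cancel₀ (leadingCoeff_ne_zero.2 hf) this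

/-- The eigenvectors of degree `n`. -/
def eigenvectors (φ ψ : ℂ[X]) (n : ℕ) : Set ℂ[X] :=
  {Q | Q.natDegree = n ∧ L.slOp φ ψ Q = L.eig φ ψ n • Q}

/-- The condition `1 ≤ n` excludes the zero polynomial, whose `natDegree` is `0` and which would
leave `lam` undetermined. -/
theorem eigenvectors_eq {φ ψ : ℂ[X]} {n : ℕ} (hφ : φ.natDegree ≤ 2) (hψ : ψ.natDegree ≤ 1)
    (hn : 1 ≤ n) : L.eigenvectors φ ψ n =
      {Q | Q.natDegree = n ∧ ∃ lam : ℂ, L.slOp φ ψ Q + C lam * Q = 0} := by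
  ext Q
  refine and_congr_right fun hQ => ⟨fun h => ⟨-L.eig φ ψ n, ?_⟩, fun ⟨lam, h⟩ => ?_⟩
  · rw [h, smul_eq_C_mul, C_neg]; ring
  · have h0 : Q ≠ 0 := by rintro rfl; simp at hQ; omega
    have h' : L.slOp φ ψ Q = (-lam) • Q := by
      rw [smul_eq_C_mul, C_neg]; linear_combination h
    rw [h', L.eq_eig_of_slOp_eq hφ hψ h0 h', hQ]

/-- An eigenvector with a simple eigenvalue is determined by its leading coefficient. -/
theorem eq_zero_of_slOp_eq {φ ψ f : ℂ[X]} {n : ℕ} (hφ : φ.natDegree ≤ 2) (hψ : ψ.natDegree ≤ 1)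
    (hs : ∀ k < n, L.eig φ ψ k ≠ L.eig φ ψ n) (hf : f.natDegree ≤ n) (h0 : f.coeff n = 0)
    (h : L.slOp φ ψ f = L.eig φ ψ n • f) : f = 0 := by
  by_contra hne
  refine hs f.natDegree (lt_of_le_of_ne hf fun h1 => hne ?_) (L.eq_eig_of_slOp_eq hφ hψ hne h).symm
  rwa [← h1, coeff_natDegree, leadingCoeff_eq_zero] at h0

theorem eq_C_mul_of_slOp_eq {φ ψ f g : ℂ[X]} {n : ℕ} (hφ : φ.natDegree ≤ 2) (hψ : ψ.natDegree ≤ 1)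
    (hs : ∀ k < n, L.eig φ ψ k ≠ L.eig φ ψ n) (hf : f.natDegree ≤ n) (hg : g.natDegree ≤ n)
    (hgn : g.coeff n ≠ 0) (h : L.slOp φ ψ f = L.eig φ ψ n • f)
    (h' : L.slOp φ ψ g = L.eig φ ψ n • g) : f = C (f.coeff n / g.coeff n) * g := by
  rw [← sub_eq_zero]
  refine L.eq_zero_of_slOp_eq hφ hψ hs ?_ ?_ ?_
  · exact (natDegree_sub_le_of_le hf ((natDegree_C_mul_le _ _).trans hg)).trans (by simp)
  · rw [coeff_sub, coeff_C_mul, div_mul_cancel₀ _ hgn, sub_self]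
  · rw [← smul_eq_C_mul, map_sub, map_smul, h, h', smul_sub, smul_comm]

theorem tendsto_eig {Φ Ψ : ℕ → ℂ[X]} {φ ψ : ℂ[X]} (hΦ : CoeffTendsto Φ φ) (hΨ : CoeffTendsto Ψ ψ)
    (n : ℕ) : Tendsto (fun j => L.eig (Φ j) (Ψ j) n) atTop (𝓝 (L.eig φ ψ n)) :=
  (((hΦ 2).mul_const _).add ((hΨ 1).mul_const _)).const_mul _

theorem coeffTendsto_slOp {Φ Ψ f : ℕ → ℂ[X]} {φ ψ P : ℂ[X]} {n : ℕ} (hΦ : CoeffTendsto Φ φ)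
    (hΨ : CoeffTendsto Ψ ψ) (hf : CoeffTendsto f P) (hn : ∀ j, (f j).natDegree ≤ n) :
    CoeffTendsto (fun j => L.slOp (Φ j) (Ψ j) (f j)) (L.slOp φ ψ P) := by
  simp only [slOp_apply]
  have hd := hf.map L.dOp hn
  have hdn : ∀ j, (L.dOp (f j)).natDegree ≤ n - 1 := fun j => L.natDegree_dOp_le (hn j)
  exact (hΦ.mul (hd.map L.dOp hdn)).add (hΨ.mul (hd.map L.sOp hdn))

/-- Limits of eigenvectors are eigenvectors. -/
theorem slOp_eq_of_coeffTendsto {Φ Ψ f : ℕ → ℂ[X]} {φ ψ P : ℂ[X]} {n : ℕ}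
    (hΦ : CoeffTendsto Φ φ) (hΨ : CoeffTendsto Ψ ψ) (hf : CoeffTendsto f P)
    (hn : ∀ j, (f j).natDegree ≤ n)
    (h : ∀ᶠ j in atTop, L.slOp (Φ j) (Ψ j) (f j) = L.eig (Φ j) (Ψ j) n • f j) :
    L.slOp φ ψ P = L.eig φ ψ n • P :=
  ((L.coeffTendsto_slOp hΦ hΨ hf hn).congr' h).unique (CoeffTendsto.smul (L.tendsto_eig hΦ hΨ n) hf)

/-- The product of `φ 𝔻² + ψ 𝕊 𝔻 - μₖ` over `k < m`. -/
def annihilator (φ ψ : ℂ[X]) : ℕ → ℂ[X] →ₗ[ℂ] ℂ[X]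
  | 0 => LinearMap.id
  | m + 1 => annihilator φ ψ m ∘ₗ (L.slOp φ ψ - L.eig φ ψ m • LinearMap.id)

theorem annihilator_succ (φ ψ : ℂ[X]) (m : ℕ) (f : ℂ[X]) :
    L.annihilator φ ψ (m + 1) f = L.annihilator φ ψ m (L.slOp φ ψ f - L.eig φ ψ m • f) := rfl

theorem annihilator_comm (φ ψ : ℂ[X]) (m : ℕ) (f : ℂ[X]) :
    L.slOp φ ψ (L.annihilator φ ψ m f) = L.annihilator φ ψ m (L.slOp φ ψ f) := by
  induction m generalizing f with
  | zero => rfl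
  | succ m ih => rw [annihilator_succ, ih, annihilator_succ, map_sub, map_smul]

theorem natDegree_sub_smul_le {φ ψ f : ℂ[X]} {n : ℕ} (c : ℂ) (hφ : φ.natDegree ≤ 2)
    (hψ : ψ.natDegree ≤ 1) (hf : f.natDegree ≤ n) : (L.slOp φ ψ f - c • f).natDegree ≤ n :=
  (natDegree_sub_le_of_le (L.slOp_natDegree_le hφ hψ hf) ((natDegree_smul_le _ _).trans hf)).trans
    (by simp)

/-- This is the Cayley–Hamilton theorem for a triangular operator: each factor `T - μₘ` removes the
top term of a polynomial of degree at most `m`. -/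
theorem annihilator_eq_zero {φ ψ f : ℂ[X]} {m : ℕ} (hφ : φ.natDegree ≤ 2) (hψ : ψ.natDegree ≤ 1)
    (hf : ∀ k, m ≤ k → f.coeff k = 0) : L.annihilator φ ψ m f = 0 := by
  induction m generalizing f with
  | zero =>
    have : f = 0 := Polynomial.ext fun k => hf k (Nat.zero_le k)
    simp [this]
  | succ m ih =>
    have hd : f.natDegree ≤ m := natDegree_le_iff_coeff_eq_zero.2 fun k hk => hf k hk
    rw [annihilator_succ]
    refine ih fun k hk => ?_
    rcases hk.eq_or_lt with rfl | hk
    · rw [coeff_sub, L.slOp_coeff hφ hψ hd, coeff_smul, smul_eq_mul, sub_self]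
    · exact coeff_eq_zero_of_natDegree_lt ((L.natDegree_sub_smul_le _ hφ hψ hd).trans_lt hk)

theorem annihilator_degree {φ ψ f : ℂ[X]} {n : ℕ} (m : ℕ) (hφ : φ.natDegree ≤ 2)
    (hψ : ψ.natDegree ≤ 1) (hf : f.natDegree ≤ n) : (L.annihilator φ ψ m f).natDegree ≤ n ∧
      (L.annihilator φ ψ m f).coeff n =
        (∏ k ∈ range m, (L.eig φ ψ n - L.eig φ ψ k)) * f.coeff n := by
  induction m generalizing f with
  | zero => simpa [annihilator] using hf
  | succ m ih =>
    obtain ⟨h1, h2⟩ := ih (L.natDegree_sub_smul_le (L.eig φ ψ m) hφ hψ hf)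
    refine ⟨h1, ?_⟩
    rw [annihilator_succ, h2, coeff_sub, L.slOp_coeff hφ hψ hf, prod_range_succ, coeff_smul,
      smul_eq_mul]
    ring

/-- The eigenvector of degree `n` that depends continuously on the coefficients. -/
theorem exists_eigenvector_tendsto {Φ Ψ : ℕ → ℂ[X]} {φ ψ : ℂ[X]} {n : ℕ}
    (hΦ : CoeffTendsto Φ φ) (hΨ : CoeffTendsto Ψ ψ) (hφj : ∀ j, (Φ j).natDegree ≤ 2)
    (hψj : ∀ j, (Ψ j).natDegree ≤ 1) (hs : ∀ k < n, L.eig φ ψ k ≠ L.eig φ ψ n) :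
    ∃ (f : ℕ → ℂ[X]) (P : ℂ[X]), CoeffTendsto f P ∧ P ∈ L.eigenvectors φ ψ n ∧
      ∀ j, (f j).natDegree ≤ n ∧ L.slOp (Φ j) (Ψ j) (f j) = L.eig (Φ j) (Ψ j) n • f j := by
  have hφ := hΦ.natDegree_le hφj
  have hψ := hΨ.natDegree_le hψj
  have hX : (X ^ n : ℂ[X]).natDegree ≤ n := natDegree_X_pow_le n
  -- The factor `T - μₙ` commutes past the product and lowers the degree of `X ^ n`; what is left is
  -- killed by the product over `k < n`. No simplicity is needed for this.
  have heig : ∀ {φ ψ : ℂ[X]}, φ.natDegree ≤ 2 → ψ.natDegree ≤ 1 →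
      L.slOp φ ψ (L.annihilator φ ψ n (X ^ n)) = L.eig φ ψ n • L.annihilator φ ψ n (X ^ n) := by
    intro φ ψ hφ hψ
    rw [← sub_eq_zero, L.annihilator_comm, ← map_smul, ← map_sub]
    refine L.annihilator_eq_zero hφ hψ fun k hk => ?_
    rcases hk.eq_or_lt with rfl | hk
    · rw [coeff_sub, L.slOp_coeff hφ hψ hX, coeff_smul, smul_eq_mul, sub_self]
    · exact coeff_eq_zero_of_natDegree_lt ((L.natDegree_sub_smul_le _ hφ hψ hX).trans_lt hk)
  have hlim : ∀ (m : ℕ) {g : ℕ → ℂ[X]} {G : ℂ[X]}, (∀ j, (g j).natDegree ≤ n) →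
      CoeffTendsto g G →
      CoeffTendsto (fun j => L.annihilator (Φ j) (Ψ j) m (g j)) (L.annihilator φ ψ m G) := by
    intro m
    induction m with
    | zero => exact fun _ hg => hg
    | succ m ih =>
      intro g G hg hG
      exact ih (fun j => L.natDegree_sub_smul_le _ (hφj j) (hψj j) (hg j))
        ((L.coeffTendsto_slOp hΦ hΨ hG hg).sub (CoeffTendsto.smul (L.tendsto_eig hΦ hΨ m) hG))
  have hP := L.annihilator_degree n hφ hψ hX
  refine ⟨fun j => L.annihilator (Φ j) (Ψ j) n (X ^ n), L.annihilator φ ψ n (X ^ n),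
    hlim n (fun _ => hX) (CoeffTendsto.const _), ⟨?_, heig hφ hψ⟩,
    fun j => ⟨(L.annihilator_degree n (hφj j) (hψj j) hX).1, heig (hφj j) (hψj j)⟩⟩
  refine natDegree_eq_of_le_of_coeff_ne_zero hP.1 ?_
  rw [hP.2, coeff_X_pow, if_pos rfl, mul_one]
  -- The leading coefficient is the product of the differences `μₙ - μₖ`; only here does simplicity
  -- of the limit eigenvalue enter.
  exact prod_ne_zero_iff.2 fun k hk => sub_ne_zero.2 (hs k (mem_range.1 hk)).symm

end LatticeData


/-! ### Limits of families -/

theorem smul_mem_limits {p : ℂ → ℂ → ℂ → ℂ → ℂ[X]} {D : Set (Fin 4 → ℂ)} {n : ℕ}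
    {t : Fin 4 → OnePoint ℂ} {P : ℂ[X]} (hP : P ∈ limits p D n t) {c : ℂ} (hc : c ≠ 0) :
    c • P ∈ limits p D n t := by
  obtain ⟨h1, τ, κ, h2, h3, h4⟩ := hP
  refine ⟨by rw [natDegree_smul _ hc, h1], τ, fun j => c * κ j, h2, h3, fun m => ?_⟩
  simpa only [coeff_smul, smul_eq_mul, mul_assoc] using (h4 m).const_mul c

theorem mem_limits_of_coeffTendsto {p : ℂ → ℂ → ℂ → ℂ → ℂ[X]} {D : Set (Fin 4 → ℂ)} {n : ℕ}
    {t : Fin 4 → OnePoint ℂ} {P : ℂ[X]} (hn : P.natDegree = n) (τ : ℕ → Fin 4 → ℂ)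
    (hD : ∀ j, τ j ∈ D)
    (ht : ∀ i, Tendsto (fun j => (τ j i : OnePoint ℂ)) atTop (𝓝 (t i))) {f : ℕ → ℂ[X]}
    (hf : CoeffTendsto f P)
    (hmul : ∀ᶠ j in atTop, ∃ k : ℂ, f j = C k * p (τ j 0) (τ j 1) (τ j 2) (τ j 3)) :
    P ∈ limits p D n t := by
  classical
  refine ⟨hn, τ, fun j => if h : ∃ k : ℂ, f j = C k * p (τ j 0) (τ j 1) (τ j 2) (τ j 3)
    then h.choose else 0, hD, ht, fun m => (hf m).congr' (hmul.mono fun j hj => ?_)⟩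
  beta_reduce
  rw [dif_pos hj, ← coeff_C_mul, ← hj.choose_spec]

theorem mem_limits_of_eventually_mem {p : ℂ → ℂ → ℂ → ℂ → ℂ[X]} {D : Set (Fin 4 → ℂ)} {n : ℕ}
    {t : Fin 4 → OnePoint ℂ} {P : ℂ[X]} (hn : P.natDegree = n) (τ : ℕ → Fin 4 → ℂ)
    (hD : ∀ᶠ j in atTop, τ j ∈ D)
    (ht : ∀ i, Tendsto (fun j => (τ j i : OnePoint ℂ)) atTop (𝓝 (t i))) (κ : ℕ → ℂ)
    (hf : CoeffTendsto (fun j => κ j • p (τ j 0) (τ j 1) (τ j 2) (τ j 3)) P) :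
    P ∈ limits p D n t := by
  obtain ⟨N, hN⟩ := eventually_atTop.1 hD
  have hshift : Tendsto (fun j => j + N) atTop atTop := tendsto_add_atTop_nat N
  refine ⟨hn, fun j => τ (j + N), fun j => κ (j + N), fun j => hN _ (Nat.le_add_left N j),
    fun i => (ht i).comp hshift, fun m => ?_⟩
  have := (hf m).comp hshift
  simpa only [Function.comp_def, coeff_smul, smul_eq_mul] using this

namespace LatticeData

variable (L : LatticeData)

/-- If the eigenvectors of lower degree all have degree `m`, the eigenvectors of degree `n` form at
most a plane. -/
theorem eigenvectors_subset_of_plane {φ ψ U V : ℂ[X]} {n m : ℕ} (hn : 1 ≤ n)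
    (hdeg : ∀ f : ℂ[X], f ≠ 0 → f.natDegree < n → L.slOp φ ψ f = L.eig φ ψ n • f →
      f.natDegree = m) (hU0 : U ≠ 0) (hU : U.natDegree = m) (hmn : m < n) {S : Set ℂ[X]}
    (hS : ∀ {P : ℂ[X]} {c : ℂ}, P ∈ S → c ≠ 0 → c • P ∈ S)
    (hSe : S ⊆ L.eigenvectors φ ψ n) (hV : ∀ c : ℂ, V + c • U ∈ S) :
    L.eigenvectors φ ψ n ⊆ S := by
  have hV0 : V ∈ L.eigenvectors φ ψ n := by simpa using hSe (hV 0)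
  -- `U` is the difference of the two eigenvectors `V + U` and `V`, hence satisfies the same
  -- equation.
  have hU1 : L.slOp φ ψ U = L.eig φ ψ n • U := by
    have h1 := (hSe (hV 1)).2
    rw [one_smul, map_add, hV0.2, smul_add] at h1
    exact add_left_cancel h1
  intro Q hQ
  have hVne : V ≠ 0 := by rintro rfl; have := hV0.1; simp at this; omega
  have hQne : Q ≠ 0 := by rintro rfl; have := hQ.1; simp at this; omega
  have hVl : V.coeff n ≠ 0 := by rw [← hV0.1]; exact leadingCoeff_ne_zero.2 hVne
  have hQl : Q.coeff n ≠ 0 := by rw [← hQ.1]; exact leadingCoeff_ne_zero.2 hQne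
  have hUl : U.coeff m ≠ 0 := by rw [← hU]; exact leadingCoeff_ne_zero.2 hU0
  have low : ∀ {f : ℂ[X]} {d : ℕ}, f.natDegree ≤ d → f.coeff d = 0 → f ≠ 0 → f.natDegree < d := by
    intro f d h1 h2 h3
    refine lt_of_le_of_ne h1 fun h => h3 ?_
    rwa [← h, coeff_natDegree, leadingCoeff_eq_zero] at h2
  set k := Q.coeff n / V.coeff n with hk
  have hk0 : k ≠ 0 := div_ne_zero hQl hVl
  -- Removing the top term with `V` leaves degree at most `m`; removing the next one with `U` leaves
  -- a solution of degree below `m`, which must be zero.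
  set Z := Q - k • V with hZ
  have hZe : L.slOp φ ψ Z = L.eig φ ψ n • Z := by
    rw [hZ, map_sub, map_smul, hQ.2, hV0.2, smul_sub, smul_comm]
  have hZn : Z.natDegree ≤ n := (natDegree_sub_le_of_le hQ.1.le
    ((natDegree_smul_le _ _).trans hV0.1.le)).trans (by simp)
  have hZl : Z.coeff n = 0 := by
    rw [hZ, coeff_sub, coeff_smul, smul_eq_mul, hk, div_mul_cancel₀ _ hVl, sub_self]
  have hZm : Z.natDegree ≤ m := by
    by_cases h0 : Z = 0
    · simp [h0]
    · exact (hdeg Z h0 (low hZn hZl h0) hZe).le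
  set c := Z.coeff m / U.coeff m with hc
  have hW : Z - c • U = 0 := by
    by_contra h0
    have h1 : (Z - c • U).natDegree ≤ m := (natDegree_sub_le_of_le hZm
      ((natDegree_smul_le _ _).trans hU.le)).trans (by simp)
    have h2 := low h1 (by
      rw [coeff_sub, coeff_smul, smul_eq_mul, hc, div_mul_cancel₀ _ hUl, sub_self]) h0
    refine h2.ne (hdeg _ h0 (h2.trans hmn) ?_)
    rw [map_sub, map_smul, hZe, hU1, smul_sub _ Z, smul_comm c]
  have : Q = k • (V + (c / k) • U) := by
    rw [smul_add, smul_smul, mul_div_cancel₀ _ hk0, ← sub_eq_zero.1 hW, hZ]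
    abel
  rw [this]
  exact hS (hV _) hk0

/-! ### The equation on a lattice -/

/-- In the application `y₄`, `y₂`, `y`, `y₁`, `y₃` are the values of the lattice at `s - 1`, `s -
1/2`, `s`, `s + 1/2`, `s + 1`. -/
theorem eval_slOp {y y₁ y₂ y₃ y₄ : ℂ} (h : y₁ + y₂ = 2 * (L.α * y + L.β))
    (h' : (y₁ - y₂) ^ 2 = 4 * L.U.eval y) (h₁ : y₃ + y = 2 * (L.α * y₁ + L.β))
    (h₁' : (y₃ - y) ^ 2 = 4 * L.U.eval y₁) (h₂ : y + y₄ = 2 * (L.α * y₂ + L.β))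
    (h₂' : (y - y₄) ^ 2 = 4 * L.U.eval y₂) (hy : y₁ ≠ y₂) (hy₃ : y₃ ≠ y) (hy₄ : y ≠ y₄)
    (φ ψ f : ℂ[X]) :
    (L.slOp φ ψ f).eval y =
      φ.eval y * (((f.eval y₃ - f.eval y) / (y₃ - y) - (f.eval y - f.eval y₄) / (y - y₄))
        / (y₁ - y₂)) +
      ψ.eval y * (((f.eval y₃ - f.eval y) / (y₃ - y) + (f.eval y - f.eval y₄) / (y - y₄)) / 2) := by
  have e1 := (L.eval_dOp_sOp h₁ h₁' f).1
  have e2 := (L.eval_dOp_sOp h₂ h₂' f).1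
  have e3 := L.eval_dOp_sOp h h' (L.dOp f)
  rw [slOp_apply, eval_add, eval_mul, eval_mul, e3.2, ← e1, ← e2,
    mul_div_cancel_right₀ _ (sub_ne_zero.2 hy₃), mul_div_cancel_right₀ _ (sub_ne_zero.2 hy₄),
    ← e3.1, mul_div_cancel_right₀ _ (sub_ne_zero.2 hy)]

/-- At admissible `s` both sides have the same values, and a polynomial that vanishes on the
infinitely many values `x(s)` is zero. -/
theorem sturmLiouville_iff {x : ℂ → ℂ}
    (h : ∀ s, x (s + 1 / 2) + x (s - 1 / 2) = 2 * (L.α * x s + L.β))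
    (h' : ∀ s, (x (s + 1 / 2) - x (s - 1 / 2)) ^ 2 = 4 * L.U.eval (x s))
    (hinf : (x '' {s | x (s + 1) ≠ x s ∧ x s ≠ x (s - 1) ∧ x (s + 1 / 2) ≠ x (s - 1 / 2)}).Infinite)
    (φ ψ : ℂ[X]) (lam : ℂ) (P : ℂ[X]) :
    SturmLiouville x φ ψ lam P ↔ L.slOp φ ψ P + C lam * P = 0 := by
  have key : ∀ s, x (s + 1) ≠ x s → x s ≠ x (s - 1) → x (s + 1 / 2) ≠ x (s - 1 / 2) →
      φ.eval (x s) * divDiff x (divDiff x fun z => P.eval (x z)) s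
      + ψ.eval (x s) * avg (divDiff x fun z => P.eval (x z)) s
      + lam * P.eval (x s) = (L.slOp φ ψ P + C lam * P).eval (x s) := by
    intro s h1 h2 h3
    have a1 : s + 1 / 2 + 1 / 2 = s + 1 := by ring
    have a2 : s + 1 / 2 - 1 / 2 = s := by ring
    have a3 : s - 1 / 2 + 1 / 2 = s := by ring
    have a4 : s - 1 / 2 - 1 / 2 = s - 1 := by ring
    have b1 := h (s + 1 / 2)
    have b2 := h' (s + 1 / 2)
    have b3 := h (s - 1 / 2)
    have b4 := h' (s - 1 / 2)
    rw [a1, a2] at b1 b2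
    rw [a3, a4] at b3 b4
    rw [eval_add, eval_mul, eval_C, L.eval_slOp (h s) (h' s) b1 b2 b3 b4 h3 h1 h2]
    simp only [divDiff, avg, a1, a2, a3, a4]
  constructor
  · intro hS
    refine eq_of_infinite_eval_eq _ _ (hinf.mono ?_)
    rintro _ ⟨s, ⟨h1, h2, h3⟩, rfl⟩
    simp only [Set.mem_ofPred_eq]
    rw [← key s h1 h2 h3, hS s h1 h2 h3, eval_zero]
  · intro h0 s h1 h2 h3
    rw [key s h1 h2 h3, h0, eval_zero]

end LatticeData

/-! ### Affine changes of the lattice -/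

theorem divDiff_affine {x x₀ : ℂ → ℂ} {m e : ℂ} (hx : ∀ s, x s = m * x₀ s + e) (F : ℂ → ℂ) (s : ℂ) :
    divDiff x F s = m⁻¹ * divDiff x₀ F s := by
  rw [divDiff, divDiff, hx, hx, add_sub_add_right_eq_sub, ← mul_sub, div_mul_eq_div_div_swap,
    div_eq_mul_inv _ m, mul_comm]

/-- The affine polynomial `m X + e`. -/
def affine (m e : ℂ) : ℂ[X] := C m * X + C e

theorem eval_affine (m e y : ℂ) : (affine m e).eval y = m * y + e := by simp [affine]

theorem natDegree_affine {m : ℂ} (hm : m ≠ 0) (e : ℂ) : (affine m e).natDegree = 1 :=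
  natDegree_linear hm

theorem affine_comp_inverse {m : ℂ} (hm : m ≠ 0) (e : ℂ) :
    (affine m e).comp (C (1 / m) * (X - C e)) = X ∧
      (C (1 / m) * (X - C e)).comp (affine m e) = X := by
  have h : (C m * C (1 / m) : ℂ[X]) = 1 := by rw [← C_mul, mul_one_div_cancel hm, C_1]
  constructor
  · simp only [affine, add_comp, mul_comp, C_comp, X_comp]
    linear_combination (X - C e) * h
  · simp only [affine, sub_comp, mul_comp, C_comp, X_comp]
    linear_combination X * h

/-- Each divided difference contributes a factor `m⁻¹`, hence `m⁻¹ ^ 2` at `φ` and `m⁻¹` at `ψ`;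
`lam` is unchanged. -/
theorem sturmLiouville_affine {x x₀ : ℂ → ℂ} {m e : ℂ} (hm : m ≠ 0)
    (hx : ∀ s, x s = m * x₀ s + e) (φ ψ : ℂ[X]) (lam : ℂ) (P : ℂ[X]) :
    SturmLiouville x φ ψ lam P ↔ SturmLiouville x₀ (C (m⁻¹ ^ 2) * φ.comp (affine m e))
      (C m⁻¹ * ψ.comp (affine m e)) lam (P.comp (affine m e)) := by
  have hne : ∀ s s', x s ≠ x s' ↔ x₀ s ≠ x₀ s' := fun s s' => by simp [hx, hm]
  have hF : ∀ Q : ℂ[X], ∀ s, Q.eval (x s) = (Q.comp (affine m e)).eval (x₀ s) := fun Q s => by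
    rw [eval_comp, eval_affine, hx]
  have hd : ∀ F, divDiff x F = fun s => m⁻¹ * divDiff x₀ F s := fun F =>
    funext fun s => divDiff_affine hx F s
  have hd2 : ∀ F s, divDiff x₀ (fun s => m⁻¹ * F s) s = m⁻¹ * divDiff x₀ F s := fun F s => by
    simp only [divDiff]; rw [← mul_sub, mul_div_assoc]
  refine forall_congr' fun s => ?_
  rw [hne, hne, hne]
  refine imp_congr_right fun _ => imp_congr_right fun _ => imp_congr_right fun _ => ?_
  simp only [hd, hd2, hF, avg, eval_mul, eval_C]
  rw [← sub_eq_zero, ← sub_eq_zero (b := (0 : ℂ))]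
  ring_nf

theorem comp_affine_comp {m : ℂ} (hm : m ≠ 0) (e : ℂ) (P : ℂ[X]) :
    (P.comp (affine m e)).comp (C (1 / m) * (X - C e)) = P ∧
      (P.comp (C (1 / m) * (X - C e))).comp (affine m e) = P := by
  rw [comp_assoc, comp_assoc, (affine_comp_inverse hm e).1, (affine_comp_inverse hm e).2, comp_X]
  exact ⟨rfl, rfl⟩

theorem natDegree_comp_affine {m : ℂ} (hm : m ≠ 0) (e : ℂ) (P : ℂ[X]) :
    (P.comp (affine m e)).natDegree = P.natDegree := by
  rw [natDegree_comp, natDegree_affine hm, mul_one]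

theorem CoeffTendsto.comp {f : ℕ → ℂ[X]} {P : ℂ[X]} {n : ℕ} (hf : CoeffTendsto f P)
    (hn : ∀ j, (f j).natDegree ≤ n) (Q : ℂ[X]) :
    CoeffTendsto (fun j => (f j).comp Q) (P.comp Q) :=
  hf.map (aeval Q).toLinearMap hn

/-- Substitution of an affine polynomial and of its inverse are linear, preserve degrees and are
continuous in bounded degree. -/
theorem mem_limits_comp {p : ℂ → ℂ → ℂ → ℂ → ℂ[X]} {D : Set (Fin 4 → ℂ)} {n : ℕ}
    {t : Fin 4 → OnePoint ℂ} {m : ℂ} (hm : m ≠ 0) (e : ℂ)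
    (hp : ∀ a b c d, (p a b c d).natDegree ≤ n) (P : ℂ[X]) :
    P ∈ limits (fun a b c d => (p a b c d).comp (C (1 / m) * (X - C e))) D n t ↔
      P.comp (affine m e) ∈ limits p D n t := by
  have hB : (C (1 / m) * (X - C e)).natDegree ≤ 1 :=
    (natDegree_C_mul_le _ _).trans (natDegree_X_sub_C_le e)
  constructor
  · rintro ⟨h1, τ, κ, h2, h3, h4⟩
    refine ⟨by rw [natDegree_comp_affine hm, h1], τ, κ, h2, h3, fun k => ?_⟩
    have h4' : CoeffTendsto (fun j => C (κ j) *
        (p (τ j 0) (τ j 1) (τ j 2) (τ j 3)).comp (C (1 / m) * (X - C e))) P := fun k => by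
      simpa only [coeff_C_mul] using h4 k
    have := h4'.comp (n := n) (fun j => (natDegree_C_mul_le _ _).trans
      (natDegree_comp_le.trans ((Nat.mul_le_mul (hp _ _ _ _) hB).trans (by simp)))) (affine m e) k
    simpa only [mul_comp, C_comp, (comp_affine_comp hm e _).2, coeff_C_mul] using this
  · rintro ⟨h1, τ, κ, h2, h3, h4⟩
    refine ⟨by rwa [natDegree_comp_affine hm] at h1, τ, κ, h2, h3, fun k => ?_⟩
    have h4' : CoeffTendsto (fun j => C (κ j) * p (τ j 0) (τ j 1) (τ j 2) (τ j 3))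
        (P.comp (affine m e)) := fun k => by simpa only [coeff_C_mul] using h4 k
    have := h4'.comp (n := n) (fun j => (natDegree_C_mul_le _ _).trans (hp _ _ _ _))
      (C (1 / m) * (X - C e)) k
    simpa only [mul_comp, C_comp, (comp_affine_comp hm e _).1, coeff_C_mul] using this

theorem mem_multiples_comp {m : ℂ} (hm : m ≠ 0) (e : ℂ) (P Q : ℂ[X]) :
    P ∈ multiples (Q.comp (C (1 / m) * (X - C e))) ↔ P.comp (affine m e) ∈ multiples Q := by
  refine exists_congr fun k => and_congr_right fun _ => ⟨fun h => ?_, fun h => ?_⟩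
  · rw [h, mul_comp, C_comp, (comp_affine_comp hm e Q).2]
  · rw [← (comp_affine_comp hm e P).1, h, mul_comp, C_comp]

theorem coefficients_affine {m : ℂ} (hm : m ≠ 0) (e : ℂ) {φ ψ : ℂ[X]} (u v : ℂ) (hu : u ≠ 0)
    (hv : v ≠ 0) : (Coefficients (C u * φ.comp (affine m e)) (C v * ψ.comp (affine m e)) ↔
      Coefficients φ ψ) ∧ (C v * ψ.comp (affine m e)).natDegree = ψ.natDegree := by
  have h0 : ∀ {c : ℂ} (_ : c ≠ 0) (f : ℂ[X]), C c * f.comp (affine m e) = 0 ↔ f = 0 := by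
    intro c hc f
    rw [mul_eq_zero, C_eq_zero, or_iff_right hc]
    refine ⟨fun h => ?_, fun h => by rw [h, zero_comp]⟩
    rw [← (comp_affine_comp hm e f).1, h, zero_comp]
  simp only [Coefficients, natDegree_C_mul hu, natDegree_C_mul hv, natDegree_comp_affine hm, h0 hu,
    h0 hv, and_self]

/-- The standard form of a lattice carries the correspondence over to the lattice. -/
theorem correspondence_of_standard (L : LatticeData) {x x₀ : ℂ → ℂ} {m e : ℂ} (hm : m ≠ 0)
    (hx : ∀ s, x s = m * x₀ s + e)
    (h : ∀ s, x₀ (s + 1 / 2) + x₀ (s - 1 / 2) = 2 * (L.α * x₀ s + L.β))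
    (h' : ∀ s, (x₀ (s + 1 / 2) - x₀ (s - 1 / 2)) ^ 2 = 4 * L.U.eval (x₀ s))
    (hinf : (x₀ '' {s | x₀ (s + 1) ≠ x₀ s ∧ x₀ s ≠ x₀ (s - 1) ∧
      x₀ (s + 1 / 2) ≠ x₀ (s - 1 / 2)}).Infinite)
    {p : ℕ → ℂ → ℂ → ℂ → ℂ → ℂ[X]} (hp : ∀ n a b c d, (p n a b c d).natDegree ≤ n)
    {D : Set (Fin 4 → ℂ)} {R : (Fin 4 → OnePoint ℂ) → Prop}
    {Φ Ψ : (Fin 4 → OnePoint ℂ) → ℂ[X]} (hΦΨ : ∀ t, Coefficients (Φ t) (Ψ t))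
    (hR : ∀ t, (Ψ t).natDegree = 1 ↔ R t)
    (hsurj : ∀ φ ψ, Coefficients φ ψ → ∃ t, ∃ k : ℂ, k ≠ 0 ∧ φ = C k * Φ t ∧ ψ = C k * Ψ t)
    (heq : ∀ t n, 1 ≤ n → L.eigenvectors (Φ t) (Ψ t) n = limits (p n) D n t) :
    (∀ φ ψ : ℂ[X], Coefficients φ ψ → ∃ t : Fin 4 → OnePoint ℂ, (ψ.natDegree = 1 ↔ R t) ∧
      ∀ n : ℕ, 1 ≤ n → solutions x φ ψ n =
        limits (fun a b c d => (p n a b c d).comp (C (1 / m) * (X - C e))) D n t) ∧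
    (∀ t : Fin 4 → OnePoint ℂ, ∃ φ ψ : ℂ[X], Coefficients φ ψ ∧ (ψ.natDegree = 1 ↔ R t) ∧
      ∀ n : ℕ, 1 ≤ n → solutions x φ ψ n =
        limits (fun a b c d => (p n a b c d).comp (C (1 / m) * (X - C e))) D n t) := by
  -- Multiplying both coefficients by `k` only multiplies `lam` by `k`, so equations matter up to a
  -- constant.
  have main : ∀ (φ ψ : ℂ[X]) (t : Fin 4 → OnePoint ℂ) (k : ℂ), k ≠ 0 →
      C (m⁻¹ ^ 2) * φ.comp (affine m e) = C k * Φ t → C m⁻¹ * ψ.comp (affine m e) = C k * Ψ t →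
      ∀ n : ℕ, 1 ≤ n → solutions x φ ψ n =
        limits (fun a b c d => (p n a b c d).comp (C (1 / m) * (X - C e))) D n t := by
    intro φ ψ t k hk h1 h2 n hn
    ext P
    rw [mem_limits_comp hm e (hp n), ← heq t n hn, L.eigenvectors_eq (hΦΨ t).1 (hΦΨ t).2.1 hn]
    refine and_congr (by rw [natDegree_comp_affine hm]) ?_
    simp only [sturmLiouville_affine hm hx, L.sturmLiouville_iff h h' hinf, h1, h2, L.slOp_C_mul]
    constructor
    · rintro ⟨lam, hl⟩
      refine ⟨k⁻¹ * lam, ?_⟩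
      have : (L.slOp (Φ t) (Ψ t)) (P.comp (affine m e)) + C (k⁻¹ * lam) * P.comp (affine m e) =
          k⁻¹ • (k • (L.slOp (Φ t) (Ψ t)) (P.comp (affine m e)) + C lam * P.comp (affine m e)) := by
        rw [smul_add, smul_smul, inv_mul_cancel₀ hk, one_smul, smul_eq_C_mul, C_mul, mul_assoc]
      rw [this, hl, smul_zero]
    · rintro ⟨lam, hl⟩
      refine ⟨k * lam, ?_⟩
      rw [C_mul, mul_assoc, smul_eq_C_mul, ← mul_add, hl, mul_zero]
  have hm' : m⁻¹ ≠ 0 := inv_ne_zero hm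
  constructor
  · intro φ ψ hc
    obtain ⟨hc1, hc2⟩ := coefficients_affine hm e (φ := φ) (ψ := ψ) (m⁻¹ ^ 2) m⁻¹
      (pow_ne_zero 2 hm') hm'
    obtain ⟨t, k, hk, h1, h2⟩ := hsurj _ _ (hc1.2 hc)
    refine ⟨t, ?_, main φ ψ t k hk h1 h2⟩
    rw [← hR t, ← hc2, h2, natDegree_C_mul hk]
  · intro t
    -- The witnesses are obtained by inverting the substitution of `sturmLiouville_affine`.
    have e1 : C (m⁻¹ ^ 2) * (C (m ^ 2) * (Φ t).comp (C (1 / m) * (X - C e))).comp (affine m e) =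
        Φ t := by
      rw [mul_comp, C_comp, (comp_affine_comp hm e _).2, ← mul_assoc, ← C_mul, ← mul_pow,
        inv_mul_cancel₀ hm, one_pow, C_1, one_mul]
    have e2 : C m⁻¹ * (C m * (Ψ t).comp (C (1 / m) * (X - C e))).comp (affine m e) = Ψ t := by
      rw [mul_comp, C_comp, (comp_affine_comp hm e _).2, ← mul_assoc, ← C_mul,
        inv_mul_cancel₀ hm, C_1, one_mul]
    obtain ⟨hc1, hc2⟩ := coefficients_affine hm e
      (φ := C (m ^ 2) * (Φ t).comp (C (1 / m) * (X - C e)))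
      (ψ := C m * (Ψ t).comp (C (1 / m) * (X - C e))) (m⁻¹ ^ 2) m⁻¹ (pow_ne_zero 2 hm') hm'
    rw [e1, e2] at hc1
    rw [e2] at hc2
    refine ⟨_, _, hc1.1 (hΦΨ t), ?_, main _ _ t 1 one_ne_zero ?_ ?_⟩
    · rw [← hc2, hR]
    · rw [e1, C_1, one_mul]
    · rw [e2, C_1, one_mul]


/-! ### Homogeneous coordinates of the parameters -/

/-- The first homogeneous coordinate of a point of the Riemann sphere: `1` at a finite point, `0`
at `∞`. -/
def uCoord (t : OnePoint ℂ) : ℂ := t.elim 0 fun _ => 1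

/-- The second homogeneous coordinate of a point of the Riemann sphere: `a` at a finite point `a`,
`1` at `∞`. -/
def vCoord (t : OnePoint ℂ) : ℂ := t.elim 1 id

@[simp] theorem uCoord_infty : uCoord OnePoint.infty = 0 := rfl
@[simp] theorem vCoord_infty : vCoord OnePoint.infty = 1 := rfl
@[simp] theorem uCoord_coe (a : ℂ) : uCoord (a : OnePoint ℂ) = 1 := rfl
@[simp] theorem vCoord_coe (a : ℂ) : vCoord (a : OnePoint ℂ) = a := rfl

theorem tendsto_coe_infty_iff {τ : ℕ → ℂ} :
    Tendsto (fun j => (τ j : OnePoint ℂ)) atTop (𝓝 OnePoint.infty) ↔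
      Tendsto τ atTop (Bornology.cobounded ℂ) := by
  rw [Metric.cobounded_eq_cocompact, ← coclosedCompact_eq_cocompact,
    ← OnePoint.comap_coe_nhds_infty, tendsto_comap_iff]
  rfl

theorem tendsto_coe_coe_iff {τ : ℕ → ℂ} {a : ℂ} :
    Tendsto (fun j => (τ j : OnePoint ℂ)) atTop (𝓝 (a : OnePoint ℂ)) ↔
      Tendsto τ atTop (𝓝 a) :=
  (OnePoint.isOpenEmbedding_coe.tendsto_nhds_iff).symm

/-- Convergence on the sphere becomes convergence of homogeneous coordinates `(1, τ)` after scaling: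
by `1` at a finite point, by `τ⁻¹` at `∞`. -/
theorem exists_scale {τ : ℕ → ℂ} {t : OnePoint ℂ}
    (h : Tendsto (fun j => (τ j : OnePoint ℂ)) atTop (𝓝 t)) :
    ∃ ρ : ℕ → ℂ, (∀ᶠ j in atTop, ρ j ≠ 0) ∧ Tendsto ρ atTop (𝓝 (uCoord t)) ∧
      Tendsto (fun j => ρ j * τ j) atTop (𝓝 (vCoord t)) := by
  induction t using OnePoint.rec with
  | infty =>
    rw [tendsto_coe_infty_iff] at h
    have h0 : ∀ᶠ j in atTop, τ j ≠ 0 := h.eventually_ne_cobounded 0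
    refine ⟨fun j => (τ j)⁻¹, h0.mono fun j => inv_ne_zero, tendsto_inv₀_cobounded.comp h, ?_⟩
    exact tendsto_const_nhds.congr' (h0.mono fun j hj => (inv_mul_cancel₀ hj).symm)
  | coe a =>
    rw [tendsto_coe_coe_iff] at h
    exact ⟨fun _ => 1, Eventually.of_forall fun _ => one_ne_zero, tendsto_const_nhds,
      by simpa using h⟩

/-- The approximating parameters are kept away from zero because the Askey–Wilson sum carries the
factor `a^(-n)`. -/
theorem exists_tendsto_ne_zero (t : OnePoint ℂ) :
    ∃ τ : ℕ → ℂ, (∀ j, τ j ≠ 0) ∧ Tendsto (fun j => (τ j : OnePoint ℂ)) atTop (𝓝 t) := by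
  induction t using OnePoint.rec with
  | infty =>
    refine ⟨fun j => (j : ℂ) + 1, fun j => Nat.cast_add_one_ne_zero j, ?_⟩
    rw [tendsto_coe_infty_iff, ← tendsto_norm_atTop_iff_cobounded]
    have : ∀ j : ℕ, ‖(j : ℂ) + 1‖ = (j : ℝ) + 1 := fun j => by
      rw [← Nat.cast_succ, Complex.norm_natCast, Nat.cast_succ]
    simp only [this]
    exact tendsto_atTop_add_const_right _ _ tendsto_natCast_atTop_atTop
  | coe a =>
    by_cases ha : a = 0
    · refine ⟨fun j => 1 / ((j : ℂ) + 1), fun j => one_div_ne_zero (Nat.cast_add_one_ne_zero j), ?_⟩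
      rw [tendsto_coe_coe_iff, ha]
      exact tendsto_one_div_add_atTop_nhds_zero_nat
    · exact ⟨fun _ => a, fun _ => ha, tendsto_const_nhds⟩

/-- The binary form with coordinates `u`, `v`. -/
def form {n : ℕ} (u v : Fin n → ℂ) : ℂ[X] := ∏ i, (C (u i) + C (v i) * X)

/-- The binary form of points of the Riemann sphere. -/
def sphereForm {n : ℕ} (t : Fin n → OnePoint ℂ) : ℂ[X] :=
  form (fun i => uCoord (t i)) fun i => vCoord (t i)

theorem natDegree_form_le {n : ℕ} (u v : Fin n → ℂ) : (form u v).natDegree ≤ n := by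
  refine (natDegree_prod_le _ _).trans ((sum_le_sum fun i _ => ?_).trans
    (b := ∑ _i : Fin n, 1) (by simp))
  rw [add_comm]
  exact natDegree_linear_le

theorem coeff_zero_form {n : ℕ} (u v : Fin n → ℂ) : (form u v).coeff 0 = ∏ i, u i := by
  rw [coeff_zero_eq_eval_zero, form, eval_prod]
  simp

theorem form_scale {n : ℕ} (ρ u v : Fin n → ℂ) :
    form (fun i => ρ i * u i) (fun i => ρ i * v i) = C (∏ i, ρ i) * form u v := by
  rw [form, form, map_prod, ← prod_mul_distrib]
  exact prod_congr rfl fun i _ => by simp only [C_mul]; ring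

theorem form_comp_perm {n : ℕ} (σ : Equiv.Perm (Fin n)) (u v : Fin n → ℂ) :
    form (fun i => u (σ i)) (fun i => v (σ i)) = form u v :=
  Equiv.prod_comp σ fun i => C (u i) + C (v i) * X

theorem sphereForm_comp_perm {n : ℕ} (σ : Equiv.Perm (Fin n)) (t : Fin n → OnePoint ℂ) :
    sphereForm (fun i => t (σ i)) = sphereForm t :=
  form_comp_perm σ (fun i => uCoord (t i)) fun i => vCoord (t i)

theorem sphereForm_coe {n : ℕ} (τ : Fin n → ℂ) :
    sphereForm (fun i => (τ i : OnePoint ℂ)) = form (fun _ => 1) τ := rfl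

theorem coeffTendsto_form {n : ℕ} {U V : ℕ → Fin n → ℂ} {u v : Fin n → ℂ}
    (hu : ∀ i, Tendsto (fun j => U j i) atTop (𝓝 (u i)))
    (hv : ∀ i, Tendsto (fun j => V j i) atTop (𝓝 (v i))) :
    CoeffTendsto (fun j => form (U j) (V j)) (form u v) :=
  CoeffTendsto.prod _ fun i _ => (CoeffTendsto.C (hu i)).add
    ((CoeffTendsto.C (hv i)).mul (CoeffTendsto.const X))

theorem form_four (u v : Fin 4 → ℂ) :
    (form u v).coeff 0 = u 0 * u 1 * u 2 * u 3 ∧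
    (form u v).coeff 1 = v 0 * u 1 * u 2 * u 3 + u 0 * v 1 * u 2 * u 3 + u 0 * u 1 * v 2 * u 3
      + u 0 * u 1 * u 2 * v 3 ∧
    (form u v).coeff 2 = v 0 * v 1 * u 2 * u 3 + v 0 * u 1 * v 2 * u 3 + v 0 * u 1 * u 2 * v 3
      + u 0 * v 1 * v 2 * u 3 + u 0 * v 1 * u 2 * v 3 + u 0 * u 1 * v 2 * v 3 ∧
    (form u v).coeff 3 = u 0 * v 1 * v 2 * v 3 + v 0 * u 1 * v 2 * v 3 + v 0 * v 1 * u 2 * v 3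
      + v 0 * v 1 * v 2 * u 3 ∧
    (form u v).coeff 4 = v 0 * v 1 * v 2 * v 3 := by
  have : form u v = C (u 0 * u 1 * u 2 * u 3) +
      C (v 0 * u 1 * u 2 * u 3 + u 0 * v 1 * u 2 * u 3 + u 0 * u 1 * v 2 * u 3
        + u 0 * u 1 * u 2 * v 3) * X +
      C (v 0 * v 1 * u 2 * u 3 + v 0 * u 1 * v 2 * u 3 + v 0 * u 1 * u 2 * v 3
        + u 0 * v 1 * v 2 * u 3 + u 0 * v 1 * u 2 * v 3 + u 0 * u 1 * v 2 * v 3) * X ^ 2 +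
      C (u 0 * v 1 * v 2 * v 3 + v 0 * u 1 * v 2 * v 3 + v 0 * v 1 * u 2 * v 3
        + v 0 * v 1 * v 2 * u 3) * X ^ 3 + C (v 0 * v 1 * v 2 * v 3) * X ^ 4 := by
    rw [form, Fin.prod_univ_four]
    simp only [C_add, C_mul]
    ring
  rw [this]
  simp only [coeff_add, coeff_C_mul, coeff_X_pow, coeff_C, coeff_X]
  norm_num

theorem factor_ne_zero (t : OnePoint ℂ) : C (uCoord t) + C (vCoord t) * X ≠ 0 := by
  intro h
  induction t using OnePoint.rec with
  | infty => simp at h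
  | coe a => simpa using congrArg (eval 0) h

theorem sphereForm_ne_zero {n : ℕ} (t : Fin n → OnePoint ℂ) : sphereForm t ≠ 0 := by
  rw [sphereForm, form]
  exact prod_ne_zero_iff.2 fun i _ => factor_ne_zero (t i)

/-- Every nonzero binary form is a product of linear factors. -/
theorem exists_eq_sphereForm (n : ℕ) {F : ℂ[X]} (hF : F ≠ 0) (hn : F.natDegree ≤ n) :
    ∃ (t : Fin n → OnePoint ℂ) (k : ℂ), k ≠ 0 ∧ F = C k * sphereForm t := by
  induction n generalizing F with
  | zero =>
    rw [Nat.le_zero, natDegree_eq_zero] at hn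
    obtain ⟨k, rfl⟩ := hn
    exact ⟨Fin.elim0, k, by simpa using hF, by simp [sphereForm, form]⟩
  | succ n ih =>
    have cons : ∀ (s : OnePoint ℂ) (t : Fin n → OnePoint ℂ), sphereForm (Fin.cons s t : Fin (n + 1) →
        OnePoint ℂ) = (C (uCoord s) + C (vCoord s) * X) * sphereForm t := fun s t => by
      simp [sphereForm, form, Fin.prod_univ_succ]
    by_cases h0 : F.natDegree = 0
    · obtain ⟨t, k, hk, h⟩ := ih hF (h0.le.trans (Nat.zero_le n))
      -- A form of too low degree is padded with the parameter `0`, whose linear factor is `1`.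
      exact ⟨Fin.cons ((0 : ℂ) : OnePoint ℂ) t, k, hk, by rw [cons]; simp [h]⟩
    · obtain ⟨r, hr⟩ := IsAlgClosed.exists_root F fun h => h0 (natDegree_eq_of_degree_eq_some h)
      obtain ⟨F', rfl⟩ := dvd_iff_isRoot.2 hr
      have hF' : F' ≠ 0 := right_ne_zero_of_mul hF
      rw [natDegree_mul (X_sub_C_ne_zero r) hF', natDegree_X_sub_C] at hn
      obtain ⟨t, k, hk, rfl⟩ := ih hF' (by omega)
      by_cases hr0 : r = 0
      -- The root `0` gives the factor `X`, which belongs to the parameter `∞`.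
      · refine ⟨Fin.cons OnePoint.infty t, k, hk, ?_⟩
        rw [cons, hr0]
        simp only [uCoord_infty, vCoord_infty, C_0, C_1]
        ring
      -- Here `X - r = -r (1 - r⁻¹ X)`.
      · refine ⟨Fin.cons ((-r⁻¹ : ℂ) : OnePoint ℂ) t, -r * k, mul_ne_zero (neg_ne_zero.2 hr0) hk, ?_⟩
        rw [cons]
        have : (C r * C r⁻¹ : ℂ[X]) = 1 := by rw [← C_mul, mul_inv_cancel₀ hr0, C_1]
        simp only [uCoord_coe, vCoord_coe, C_neg, C_mul, C_1]
        linear_combination -C k * X * sphereForm t * this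

/-- Moves an exceptional pair of parameters to the last two places, so that degenerate cases are
treated in one arrangement only. -/
theorem exists_perm_two_three {i j : Fin 4} (h : i ≠ j) :
    ∃ σ : Equiv.Perm (Fin 4), σ 2 = i ∧ σ 3 = j := by
  refine ⟨Equiv.swap (Equiv.swap 3 j 2) i * Equiv.swap 3 j, ?_, ?_⟩
  · rw [Equiv.Perm.mul_apply, Equiv.swap_apply_left]
  · rw [Equiv.Perm.mul_apply, Equiv.swap_apply_left, Equiv.swap_apply_of_ne_of_ne _ h.symm]
    rw [← Equiv.swap_apply_left 3 j]
    exact fun h' => absurd ((Equiv.swap 3 j).injective ((Equiv.swap_apply_left 3 j).symm ▸ h'))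
      (by decide)

/-- Sequences along which the quotient of two infinitesimals has a prescribed limit. -/
theorem exists_rates {B : ℂ → ℂ} (hB0 : B 0 = 0) (hB : ContinuousAt B 0)
    (hne : ∀ᶠ j : ℕ in atTop, B (1 / ((j : ℂ) + 1)) ≠ 0) (c : ℂ) :
    ∃ ε s : ℕ → ℂ, Tendsto ε atTop (𝓝 0) ∧ Tendsto s atTop (𝓝 0) ∧ (∀ᶠ j in atTop, s j ≠ 0) ∧
      Tendsto (fun j => B (ε j) / s j) atTop (𝓝 c) := by
  have hε : Tendsto (fun j : ℕ => 1 / ((j : ℂ) + 1)) atTop (𝓝 0) :=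
    tendsto_one_div_add_atTop_nhds_zero_nat
  by_cases hc : c = 0
  -- For the limit `0` the numerator is kept identically zero; otherwise the denominator is defined
  -- as the numerator divided by the limit.
  · refine ⟨fun _ => 0, fun j => 1 / ((j : ℂ) + 1), tendsto_const_nhds, hε,
      Eventually.of_forall fun j => one_div_ne_zero (Nat.cast_add_one_ne_zero j), ?_⟩
    simp only [hB0, zero_div, hc]
    exact tendsto_const_nhds
  · have hBε : Tendsto (fun j : ℕ => B (1 / ((j : ℂ) + 1))) atTop (𝓝 0) := by
      have := hB.tendsto.comp hε
      rwa [hB0] at this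
    refine ⟨_, fun j => B (1 / ((j : ℂ) + 1)) / c, hε, ?_, hne.mono fun j hj => div_ne_zero hj hc,
      ?_⟩
    · simpa using hBε.div_const c
    · refine tendsto_const_nhds.congr' (hne.mono fun j hj => ?_)
      beta_reduce
      rw [div_div_cancel₀ hj]

/-! ### Equations parametrized by binary quartic forms -/

/-- A lattice together with equations on it that depend linearly on a binary quartic form. -/
structure Scheme extends LatticeData where
  Φ : ℂ[X] →ₗ[ℂ] ℂ[X]
  Ψ : ℂ[X] →ₗ[ℂ] ℂ[X]
  natDegree_Φ : ∀ F, (Φ F).natDegree ≤ 2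
  natDegree_Ψ : ∀ F, (Ψ F).natDegree ≤ 1

namespace Scheme

variable (L : Scheme)

/-- The operator of a form. -/
def op (F : ℂ[X]) : ℂ[X] →ₗ[ℂ] ℂ[X] := L.slOp (L.Φ F) (L.Ψ F)

/-- The eigenvalue in degree `n` of a form. -/
def ev (F : ℂ[X]) (n : ℕ) : ℂ := L.eig (L.Φ F) (L.Ψ F) n

/-- The eigenvalue in degree `n` occurs in no lower degree. -/
def Simple (F : ℂ[X]) (n : ℕ) : Prop := ∀ k < n, L.ev F k ≠ L.ev F n

theorem op_C_mul (c : ℂ) (F f : ℂ[X]) : L.op (C c * F) f = c • L.op F f := by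
  rw [op, op, ← smul_eq_C_mul, map_smul, map_smul, smul_eq_C_mul, smul_eq_C_mul, L.slOp_C_mul]

theorem ev_C_mul (c : ℂ) (F : ℂ[X]) (n : ℕ) : L.ev (C c * F) n = c * L.ev F n := by
  simp only [ev, LatticeData.eig, ← smul_eq_C_mul, map_smul, coeff_smul, smul_eq_mul]
  ring

variable {L}

theorem tendsto_ev {F : ℕ → ℂ[X]} {G : ℂ[X]} (hF : CoeffTendsto F G) (h4 : ∀ j, (F j).natDegree ≤ 4)
    (n : ℕ) : Tendsto (fun j => L.ev (F j) n) atTop (𝓝 (L.ev G n)) :=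
  L.tendsto_eig (hF.map L.Φ h4) (hF.map L.Ψ h4) n

/-- Simplicity consists of finitely many inequalities between continuous functions of the form, so
it is an open condition. -/
theorem eventually_simple {F : ℕ → ℂ[X]} {G : ℂ[X]} {n : ℕ} (hF : CoeffTendsto F G)
    (h4 : ∀ j, (F j).natDegree ≤ 4) (hs : L.Simple G n) : ∀ᶠ j in atTop, L.Simple (F j) n := by
  have : ∀ k ∈ range n, ∀ᶠ j in atTop, L.ev (F j) k ≠ L.ev (F j) n := fun k hk =>
    (((tendsto_ev hF h4 k).sub (tendsto_ev hF h4 n)).eventually_ne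
      (sub_ne_zero.2 (hs k (mem_range.1 hk)))).mono fun j => sub_ne_zero.1
  filter_upwards [(Finset.eventually_all (range n)).2 this] with j hj k hk
  exact hj k (mem_range.2 hk)

/-- The forms themselves diverge when a parameter tends to `∞`. Scalar multiples of them converge,
and these have the same eigenvectors. -/
theorem eventually_scaled {τ : ℕ → Fin 4 → ℂ} {t : Fin 4 → OnePoint ℂ}
    (ht : ∀ i, Tendsto (fun j => (τ j i : OnePoint ℂ)) atTop (𝓝 (t i))) :
    ∃ ρ : ℕ → ℂ, (∀ᶠ j in atTop, ρ j ≠ 0) ∧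
      CoeffTendsto (fun j => C (ρ j) * form (fun _ => 1) (τ j)) (sphereForm t) := by
  choose ρ h0 h1 h2 using fun i => exists_scale (ht i)
  refine ⟨fun j => ∏ i, ρ i j, ?_, ?_⟩
  · filter_upwards [eventually_all.2 h0] with j hj
    exact prod_ne_zero_iff.2 fun i _ => hj i
  · simp only [fun j => (form_scale (fun i => ρ i j) (fun _ => 1) (τ j)).symm]
    exact coeffTendsto_form (by simpa using h1) h2

theorem natDegree_C_mul_form_le (c : ℂ) (u v : Fin 4 → ℂ) :
    (C c * form u v).natDegree ≤ 4 :=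
  (natDegree_C_mul_le _ _).trans (natDegree_form_le u v)

theorem simple_C_mul {c : ℂ} (hc : c ≠ 0) {F : ℂ[X]} {n : ℕ} :
    L.Simple (C c * F) n ↔ L.Simple F n := by
  simp only [Simple, L.ev_C_mul, ne_eq, mul_right_inj' hc]

/-- A family of polynomials of degree at most `n` that are eigenvectors for finite parameters in
`D`, of degree `n` exactly if the eigenvalue is simple. -/
structure IsFamily (L : Scheme) (p : ℂ → ℂ → ℂ → ℂ → ℂ[X]) (D : Set (Fin 4 → ℂ)) (n : ℕ) : Prop where
  mem_of_ne_zero : ∀ τ : Fin 4 → ℂ, (∀ i, τ i ≠ 0) → τ ∈ D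
  natDegree_le : ∀ a b c d, (p a b c d).natDegree ≤ n
  op_eq : ∀ τ ∈ D, L.op (form (fun _ => 1) τ) (p (τ 0) (τ 1) (τ 2) (τ 3)) =
    L.ev (form (fun _ => 1) τ) n • p (τ 0) (τ 1) (τ 2) (τ 3)
  coeff_ne_zero_iff : ∀ τ ∈ D, (p (τ 0) (τ 1) (τ 2) (τ 3)).coeff n ≠ 0 ↔
    L.Simple (form (fun _ => 1) τ) n

variable {p : ℂ → ℂ → ℂ → ℂ → ℂ[X]} {D : Set (Fin 4 → ℂ)} {n : ℕ}

theorem op_eq_of_scaled {c : ℂ} {F f : ℂ[X]} (h : L.op F f = L.ev F n • f) :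
    L.op (C c * F) f = L.ev (C c * F) n • f := by
  rw [L.op_C_mul, h, L.ev_C_mul, mul_smul]

theorem op_eq_iff_scaled {c : ℂ} (hc : c ≠ 0) {F f : ℂ[X]} :
    L.op (C c * F) f = L.ev (C c * F) n • f ↔ L.op F f = L.ev F n • f := by
  rw [L.op_C_mul, L.ev_C_mul, mul_smul]
  exact (smul_right_injective _ hc).eq_iff

/-- The eigenvector equation is closed: it holds along the sequence for the rescaled forms and
passes to the limit. -/
theorem IsFamily.limits_subset (hp : IsFamily L p D n) (t : Fin 4 → OnePoint ℂ) :
    limits p D n t ⊆ L.eigenvectors (L.Φ (sphereForm t)) (L.Ψ (sphereForm t)) n := by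
  rintro P ⟨h1, τ, κ, h2, h3, h4⟩
  obtain ⟨ρ, -, hρ⟩ := eventually_scaled h3
  have h4' : CoeffTendsto (fun j => C (κ j) * p (τ j 0) (τ j 1) (τ j 2) (τ j 3)) P := fun k => by
    simpa only [coeff_C_mul] using h4 k
  refine ⟨h1, L.slOp_eq_of_coeffTendsto (hρ.map L.Φ fun j => natDegree_C_mul_form_le _ _ _)
    (hρ.map L.Ψ fun j => natDegree_C_mul_form_le _ _ _) h4'
    (fun j => (natDegree_C_mul_le _ _).trans (hp.natDegree_le _ _ _ _))
    (Eventually.of_forall fun j => ?_)⟩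
  have := op_eq_of_scaled (c := ρ j) (hp.op_eq (τ j) (h2 j))
  change L.op (C (ρ j) * form (fun _ => 1) (τ j)) _ = L.ev (C (ρ j) * form (fun _ => 1) (τ j)) n • _
  rw [← smul_eq_C_mul (κ j), map_smul, this, smul_comm]

/-- Limits of eigenvectors along simple eigenvalues belong to the family. -/
theorem IsFamily.mem_limits (hp : IsFamily L p D n) {t : Fin 4 → OnePoint ℂ} {τ : ℕ → Fin 4 → ℂ}
    (hD : ∀ j, τ j ∈ D) (ht : ∀ i, Tendsto (fun j => (τ j i : OnePoint ℂ)) atTop (𝓝 (t i)))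
    (hs : ∀ᶠ j in atTop, L.Simple (form (fun _ => 1) (τ j)) n) {f : ℕ → ℂ[X]} {P : ℂ[X]}
    (hP : P.natDegree = n) (hf : CoeffTendsto f P)
    (hfj : ∀ᶠ j in atTop, (f j).natDegree ≤ n ∧
      L.op (form (fun _ => 1) (τ j)) (f j) = L.ev (form (fun _ => 1) (τ j)) n • f j) :
    P ∈ limits p D n t := by
  refine mem_limits_of_coeffTendsto hP τ hD ht hf ?_
  filter_upwards [hs, hfj] with j hsj hj
  exact ⟨_, L.eq_C_mul_of_slOp_eq (L.natDegree_Φ _) (L.natDegree_Ψ _) hsj hj.1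
    (hp.natDegree_le _ _ _ _) ((hp.coeff_ne_zero_iff _ (hD j)).2 hsj) hj.2 (hp.op_eq _ (hD j))⟩

/-- The parameters of the family may be permuted in limits along simple eigenvalues. -/
theorem IsFamily.mem_limits_perm (hp : IsFamily L p D n) {t : Fin 4 → OnePoint ℂ}
    (σ : Equiv.Perm (Fin 4)) {τ : ℕ → Fin 4 → ℂ} (hD : ∀ᶠ j in atTop, (fun i => τ j (σ.symm i)) ∈ D)
    (ht : ∀ i, Tendsto (fun j => (τ j i : OnePoint ℂ)) atTop (𝓝 (t (σ i))))
    (hs : ∀ᶠ j in atTop, L.Simple (form (fun _ => 1) (τ j)) n) {f : ℕ → ℂ[X]} {P : ℂ[X]}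
    (hP : P.natDegree = n) (hf : CoeffTendsto f P)
    (hfj : ∀ᶠ j in atTop, (f j).natDegree ≤ n ∧
      L.op (form (fun _ => 1) (τ j)) (f j) = L.ev (form (fun _ => 1) (τ j)) n • f j) :
    P ∈ limits p D n t := by
  obtain ⟨N, hN⟩ := eventually_atTop.1 hD
  have hshift : Tendsto (fun j => j + N) atTop atTop := tendsto_add_atTop_nat N
  -- The form is symmetric in the parameters, so simplicity and the eigenvector equation survive the
  -- permutation. Symmetry of `p` itself is never needed.
  have hform : ∀ j, form (fun _ => 1) (fun i => τ (j + N) (σ.symm i)) =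
      form (fun _ => 1) (τ (j + N)) := fun j => form_comp_perm σ.symm (fun _ => 1) (τ (j + N))
  refine hp.mem_limits (τ := fun j i => τ (j + N) (σ.symm i)) (f := fun j => f (j + N))
    (fun j => hN _ (Nat.le_add_left N j))
    (fun i => ?_) ?_ hP (fun m => (hf m).comp hshift) ?_
  · have := (ht (σ.symm i)).comp hshift
    rwa [σ.apply_symm_apply] at this
  · simp only [hform]
    exact hshift.eventually hs
  · simp only [hform]
    exact hshift.eventually hfj

/-- Approximate `t` by nonzero finite parameters. The continuous eigenvector is there a multiple of
`p`, so its limit lies in the family, and by simplicity every other eigenvector of degree `n` is a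
multiple of that limit. -/
theorem IsFamily.eigenvectors_subset_of_simple (hp : IsFamily L p D n) (hn : 1 ≤ n)
    {t : Fin 4 → OnePoint ℂ} (hs : L.Simple (sphereForm t) n) :
    L.eigenvectors (L.Φ (sphereForm t)) (L.Ψ (sphereForm t)) n ⊆ limits p D n t := by
  choose τ h0 ht using fun i => exists_tendsto_ne_zero (t i)
  obtain ⟨ρ, hρ0, hρ⟩ := eventually_scaled (τ := fun j i => τ i j) ht
  have h4 : ∀ j, (C (ρ j) * form (fun _ => 1) fun i => τ i j).natDegree ≤ 4 := fun j =>
    natDegree_C_mul_form_le _ _ _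
  obtain ⟨f, P, hfP, hP, hf⟩ := L.exists_eigenvector_tendsto (hρ.map L.Φ h4) (hρ.map L.Ψ h4)
    (fun j => L.natDegree_Φ _) (fun j => L.natDegree_Ψ _) hs
  have hPl : P ∈ limits p D n t := by
    refine hp.mem_limits (τ := fun j i => τ i j) (fun j => hp.mem_of_ne_zero _ fun i => h0 i j) ht
      ?_ hP.1 hfP ?_
    · filter_upwards [hρ0, eventually_simple hρ h4 hs] with j h1 h2
      exact (simple_C_mul h1).1 h2
    · filter_upwards [hρ0] with j h1
      exact ⟨(hf j).1, (op_eq_iff_scaled h1).1 (hf j).2⟩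
  intro Q hQ
  have hQ0 : Q.coeff n ≠ 0 := by
    rw [← hQ.1, coeff_natDegree, leadingCoeff_ne_zero]
    rintro rfl; have := hQ.1; simp at this; omega
  have hP0 : P.coeff n ≠ 0 := by
    rw [← hP.1, coeff_natDegree, leadingCoeff_ne_zero]
    rintro rfl; have := hP.1; simp at this; omega
  rw [L.eq_C_mul_of_slOp_eq (L.natDegree_Φ _) (L.natDegree_Ψ _) hs hQ.1.le hP.1.le hP0 hQ.2 hP.2,
    ← smul_eq_C_mul]
  exact smul_mem_limits hPl (div_ne_zero hQ0 hP0)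

theorem IsFamily.limits_eq_multiples (hp : IsFamily L p D n) (hn : 1 ≤ n)
    {t : Fin 4 → OnePoint ℂ} (hs : L.Simple (sphereForm t) n) {P : ℂ[X]} (hP : P ∈ limits p D n t) :
    limits p D n t = multiples P := by
  ext Q
  constructor
  · intro hQ
    have hQ' := hp.limits_subset t hQ
    have hP' := hp.limits_subset t hP
    have hQ0 : Q.coeff n ≠ 0 := by
      rw [← hQ'.1, coeff_natDegree, leadingCoeff_ne_zero]
      rintro rfl; have := hQ'.1; simp at this; omega
    have hP0 : P.coeff n ≠ 0 := by
      rw [← hP'.1, coeff_natDegree, leadingCoeff_ne_zero]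
      rintro rfl; have := hP'.1; simp at this; omega
    exact ⟨_, div_ne_zero hQ0 hP0, L.eq_C_mul_of_slOp_eq (L.natDegree_Φ _) (L.natDegree_Ψ _) hs
      hQ'.1.le hP'.1.le hP0 hQ'.2 hP'.2⟩
  · rintro ⟨k, hk, rfl⟩
    rw [← smul_eq_C_mul]
    exact smul_mem_limits hP hk

/-- Full degree forces a simple eigenvalue, and the constant sequence of parameters shows that the
polynomial itself is a limit. -/
theorem IsFamily.limits_coe_eq_multiples (hp : IsFamily L p D n) (hn : 1 ≤ n) {τ : Fin 4 → ℂ}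
    (hτ : τ ∈ D) (hdeg : (p (τ 0) (τ 1) (τ 2) (τ 3)).natDegree = n) :
    limits p D n (fun i => (τ i : OnePoint ℂ)) = multiples (p (τ 0) (τ 1) (τ 2) (τ 3)) := by
  have h0 : p (τ 0) (τ 1) (τ 2) (τ 3) ≠ 0 := fun h0 => by
    rw [h0, natDegree_zero] at hdeg
    omega
  have hs : L.Simple (sphereForm fun i => (τ i : OnePoint ℂ)) n := by
    rw [sphereForm_coe, ← hp.coeff_ne_zero_iff τ hτ]
    have := leadingCoeff_ne_zero.2 h0
    rwa [leadingCoeff, hdeg] at this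
  exact hp.limits_eq_multiples hn hs ⟨hdeg, fun _ => τ, fun _ => 1, fun _ => hτ,
    fun i => tendsto_const_nhds, fun m => by
      simp only [one_mul]
      exact tendsto_const_nhds⟩

end Scheme


/-! ### The scheme of `q`-quadratic lattices -/

/-- The `q`-quadratic lattice in standard form `x = (z + z⁻¹) / 2`, with `q = p²`. -/
def awScheme (p : ℂ) : Scheme where
  α := (p + p⁻¹) / 2
  β := 0
  U := C (((p + p⁻¹) / 2) ^ 2 - 1) * (X ^ 2 - 1)
  natDegree_U := (natDegree_C_mul_le _ _).trans
    ((natDegree_sub_le _ _).trans (by simp))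
  coeff_U := by rw [coeff_C_mul]; simp [coeff_one]
  -- For `F` of degree at most four, `Φ F` at `(z + z⁻¹) / 2` is the part of `F(-z) / z²` symmetric
  -- under `z ↦ z⁻¹`, and `Ψ F` times `(p - p⁻¹)(z - z⁻¹) / 4` is the antisymmetric part.
  Φ := (lcoeff ℂ 0 + lcoeff ℂ 4).smulRight (2 * X ^ 2 - 1) - (lcoeff ℂ 1 + lcoeff ℂ 3).smulRight X
    + (lcoeff ℂ 2).smulRight 1
  Ψ := (2 / (p - p⁻¹)) • (((2 : ℂ) • (lcoeff ℂ 4 - lcoeff ℂ 0)).smulRight X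
    + (lcoeff ℂ 1 - lcoeff ℂ 3).smulRight 1)
  natDegree_Φ F := by
    refine natDegree_add_le_of_degree_le (natDegree_sub_le_of_le (m := 2) (n := 2) ?_ ?_) ?_
    · refine (natDegree_smul_le _ _).trans ?_
      compute_degree
    · exact (natDegree_smul_le _ _).trans (natDegree_X_le.trans (by norm_num))
    · exact (natDegree_smul_le _ _).trans (by simp)
  natDegree_Ψ F := by
    refine (natDegree_smul_le _ _).trans (natDegree_add_le_of_degree_le ?_ ?_)
    · exact (natDegree_smul_le _ _).trans natDegree_X_le
    · exact (natDegree_smul_le _ _).trans (by simp)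

theorem awScheme_Φ (p : ℂ) (F : ℂ[X]) : (awScheme p).Φ F =
    (F.coeff 0 + F.coeff 4) • (2 * X ^ 2 - 1) - (F.coeff 1 + F.coeff 3) • X
      + F.coeff 2 • (1 : ℂ[X]) := rfl

theorem awScheme_Ψ (p : ℂ) (F : ℂ[X]) : (awScheme p).Ψ F = (2 / (p - p⁻¹)) •
    ((2 * (F.coeff 4 - F.coeff 0)) • X + (F.coeff 1 - F.coeff 3) • (1 : ℂ[X])) := rfl

theorem eval_awScheme_Φ (p y : ℂ) (F : ℂ[X]) : ((awScheme p).Φ F).eval y =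
    (F.coeff 0 + F.coeff 4) * (2 * y ^ 2 - 1) - (F.coeff 1 + F.coeff 3) * y + F.coeff 2 := by
  simp [awScheme_Φ]

theorem eval_awScheme_Ψ (p y : ℂ) (F : ℂ[X]) : ((awScheme p).Ψ F).eval y =
    2 / (p - p⁻¹) * (2 * (F.coeff 4 - F.coeff 0) * y + (F.coeff 1 - F.coeff 3)) := by
  simp [awScheme_Ψ]; ring

theorem coeff_awScheme (p : ℂ) (F : ℂ[X]) :
    ((awScheme p).Φ F).coeff 2 = 2 * (F.coeff 0 + F.coeff 4) ∧
    ((awScheme p).Φ F).coeff 1 = -(F.coeff 1 + F.coeff 3) ∧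
    ((awScheme p).Φ F).coeff 0 = F.coeff 2 - (F.coeff 0 + F.coeff 4) ∧
    ((awScheme p).Ψ F).coeff 1 = 2 / (p - p⁻¹) * (2 * (F.coeff 4 - F.coeff 0)) ∧
    ((awScheme p).Ψ F).coeff 0 = 2 / (p - p⁻¹) * (F.coeff 1 - F.coeff 3) := by
  have h2 : (2 : ℂ[X]) = C 2 := rfl
  rw [awScheme_Φ, awScheme_Ψ, h2]
  simp only [coeff_add, coeff_sub, coeff_smul, coeff_C_mul, coeff_X_pow, coeff_X, coeff_one,
    smul_eq_mul]
  refine ⟨?_, ?_, ?_, ?_, ?_⟩ <;> norm_num <;> ring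

section

variable {p q : ℂ}

theorem sub_inv_ne_zero (hp : p ≠ 0) (hpq : p ^ 2 = q) (hq : q ≠ 1) : p - p⁻¹ ≠ 0 := by
  intro h
  apply hq
  rw [← hpq]
  field_simp at h
  linear_combination h

/-- The recursion is the addition theorem for `p ^ n - p⁻¹ ^ n` and `p ^ n + p⁻¹ ^ n`. -/
theorem leadPair_awScheme (hp : p ≠ 0) (h : p - p⁻¹ ≠ 0) (n : ℕ) :
    ((awScheme p).leadPair n).1 = (p ^ n - p⁻¹ ^ n) / (p - p⁻¹) ∧
      ((awScheme p).leadPair n).2 = (p ^ n + p⁻¹ ^ n) / 2 := by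
  have hpp : p * p⁻¹ = 1 := mul_inv_cancel₀ hp
  have hα : (awScheme p).α = (p + p⁻¹) / 2 := rfl
  induction n with
  | zero => simp [LatticeData.leadPair]
  | succ n ih =>
    rw [LatticeData.leadPair, ih.1, ih.2, hα]
    constructor
    · rw [eq_div_iff h, add_mul, mul_assoc ((p + p⁻¹) / 2), div_mul_cancel₀ _ h]; ring
    · have : ((p + p⁻¹) / 2) ^ 2 - 1 = (p - p⁻¹) ^ 2 / 4 := by linear_combination hpp
      rw [this, show (p - p⁻¹) ^ 2 / 4 * ((p ^ n - p⁻¹ ^ n) / (p - p⁻¹)) =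
        (p - p⁻¹) / 4 * ((p ^ n - p⁻¹ ^ n) / (p - p⁻¹) * (p - p⁻¹)) by ring, div_mul_cancel₀ _ h]
      ring

/-- The constant in the eigenvalues. -/
def awConst (p : ℂ) : ℂ := 4 / (p - p⁻¹) ^ 2

/-- Used twice: with the outer coefficients of the form for the eigenvalues, and with `-1/2` times
the coefficients of `X` and `X³` for the subdiagonal term of degenerate equations. -/
theorem lead_bracket (hp : p ≠ 0) (hpq : p ^ 2 = q) (h : p - p⁻¹ ≠ 0) (A B : ℂ) (n : ℕ) :
    ((awScheme p).leadPair (n + 1)).1 * (2 * (A + B) * ((awScheme p).leadPair n).1 +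
      2 / (p - p⁻¹) * (2 * (B - A)) * ((awScheme p).leadPair n).2) =
      awConst p * ((1 - q ^ (n + 1)) * (A - B * q ^ n) / (p * q ^ n)) := by
  have hpp : p * p⁻¹ = 1 := mul_inv_cancel₀ hp
  obtain ⟨h1, -⟩ := leadPair_awScheme hp h (n + 1)
  obtain ⟨h2, h3⟩ := leadPair_awScheme hp h n
  rw [h1, h2, h3, awConst, ← hpq]
  have e : 2 * (A + B) * ((p ^ n - p⁻¹ ^ n) / (p - p⁻¹)) +
      2 / (p - p⁻¹) * (2 * (B - A)) * ((p ^ n + p⁻¹ ^ n) / 2) =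
      4 / (p - p⁻¹) * (B * p ^ n - A * p⁻¹ ^ n) := by ring
  rw [e]
  have e2 : (1 - (p ^ 2) ^ (n + 1)) * (A - B * (p ^ 2) ^ n) / (p * (p ^ 2) ^ n) =
      (p ^ (n + 1) - p⁻¹ ^ (n + 1)) * (B * p ^ n - A * p⁻¹ ^ n) := by
    rw [inv_pow, inv_pow, ← pow_mul, ← pow_mul]
    have hpn := pow_ne_zero n hp
    field_simp
    ring
  rw [e2, div_mul_eq_mul_div, mul_comm (4 / (p - p⁻¹)), mul_div_assoc', mul_div_assoc',
    div_div, ← sq, ← mul_assoc, mul_comm (4 / (p - p⁻¹) ^ 2), mul_div_assoc']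

theorem ev_awScheme_succ (hp : p ≠ 0) (hpq : p ^ 2 = q) (h : p - p⁻¹ ≠ 0) (F : ℂ[X]) (n : ℕ) :
    (awScheme p).ev F (n + 1) =
      awConst p * ((1 - q ^ (n + 1)) * (F.coeff 0 - F.coeff 4 * q ^ n) / (p * q ^ n)) := by
  rw [← lead_bracket hp hpq h, Scheme.ev, LatticeData.eig, (coeff_awScheme p F).1,
    (coeff_awScheme p F).2.2.2.1, Nat.add_sub_cancel]

theorem ev_awScheme (hp : p ≠ 0) (hpq : p ^ 2 = q) (h : p - p⁻¹ ≠ 0) (F : ℂ[X]) (n : ℕ) :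
    (awScheme p).ev F n =
      awConst p / p * ((1 - q ^ n) * (F.coeff 0 * q - F.coeff 4 * q ^ n) / q ^ n) := by
  rcases n with _ | n
  · simp [Scheme.ev, LatticeData.eig, LatticeData.leadPair]
  · have hq : q ≠ 0 := by rw [← hpq]; exact pow_ne_zero 2 hp
    rw [ev_awScheme_succ hp hpq h]
    have := pow_ne_zero n hq
    field_simp
    ring

theorem awConst_ne_zero (h : p - p⁻¹ ≠ 0) : awConst p ≠ 0 :=
  div_ne_zero (by norm_num) (pow_ne_zero 2 h)

theorem pow_injective_of_not_root (hq : q ≠ 0) (hr : ∀ k : ℕ, 1 ≤ k → q ^ k ≠ 1) {k n : ℕ}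
    (h : q ^ k = q ^ n) : k = n := by
  rcases lt_trichotomy k n with hlt | heq | hlt
  · refine absurd ?_ (hr (n - k) (by omega))
    rw [pow_sub₀ q hq hlt.le, ← h, mul_inv_cancel₀ (pow_ne_zero k hq)]
  · exact heq
  · refine absurd ?_ (hr (k - n) (by omega))
    rw [pow_sub₀ q hq hlt.le, h, mul_inv_cancel₀ (pow_ne_zero n hq)]

/-- The difference of the eigenvalues contains the factor `q ^ n - q ^ k`, which is nonzero as `q`
is not a root of unity. The other factor vanishes for at most one `k`, unless both outer
coefficients are zero. -/
theorem ev_awScheme_eq_iff (hp : p ≠ 0) (hpq : p ^ 2 = q) (hr : ∀ k : ℕ, 1 ≤ k → q ^ k ≠ 1)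
    (F : ℂ[X]) {k n : ℕ} (hkn : k ≠ n) :
    (awScheme p).ev F k = (awScheme p).ev F n ↔ F.coeff 0 * q = F.coeff 4 * q ^ (k + n) := by
  have h := sub_inv_ne_zero hp hpq (by simpa using hr 1 le_rfl)
  have hq : q ≠ 0 := by rw [← hpq]; exact pow_ne_zero 2 hp
  have hk := pow_ne_zero k hq
  have hn := pow_ne_zero n hq
  rw [ev_awScheme hp hpq h, ev_awScheme hp hpq h,
    mul_right_inj' (div_ne_zero (awConst_ne_zero h) hp), div_eq_div_iff hk hn, ← sub_eq_zero]
  have hd : q ^ n - q ^ k ≠ 0 := fun h0 =>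
    hkn (pow_injective_of_not_root hq hr (sub_eq_zero.1 h0)).symm
  have e : (1 - q ^ k) * (F.coeff 0 * q - F.coeff 4 * q ^ k) * q ^ n -
      (1 - q ^ n) * (F.coeff 0 * q - F.coeff 4 * q ^ n) * q ^ k =
      (q ^ n - q ^ k) * (F.coeff 0 * q - F.coeff 4 * q ^ (k + n)) := by
    rw [pow_add]; ring
  rw [e, mul_eq_zero, or_iff_right hd, sub_eq_zero]

theorem simple_awScheme_iff (hp : p ≠ 0) (hpq : p ^ 2 = q) (hr : ∀ k : ℕ, 1 ≤ k → q ^ k ≠ 1)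
    (F : ℂ[X]) (n : ℕ) :
    (awScheme p).Simple F n ↔ ∀ k < n, F.coeff 0 * q ≠ F.coeff 4 * q ^ (k + n) :=
  forall₂_congr fun _ hk => (ev_awScheme_eq_iff hp hpq hr F hk.ne).not

/-! ### The Joukowski map -/

/-- The map `z ↦ (z + z⁻¹) / 2`. -/
def joukowski (z : ℂ) : ℂ := (z + z⁻¹) / 2

theorem exists_joukowski_eq (y : ℂ) : ∃ z, z ≠ 0 ∧ joukowski z = y := by
  obtain ⟨r, hr⟩ := IsAlgClosed.exists_pow_nat_eq (y ^ 2 - 1) (n := 2) two_pos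
  have h : (y + r) * (y - r) = 1 := by linear_combination -hr
  have h0 : y + r ≠ 0 := left_ne_zero_of_mul_eq_one h
  refine ⟨y + r, h0, ?_⟩
  rw [joukowski, ← eq_inv_of_mul_eq_one_right h]
  ring

/-- The points at which the equation is not singular. -/
def IsGeneric (q z : ℂ) : Prop := z ≠ 0 ∧ z ^ 2 ≠ 1 ∧ q * z ^ 2 ≠ 1 ∧ z ^ 2 ≠ q

/-- The map is onto `ℂ`, so at most the images of finitely many exceptional `z` are lost. -/
theorem infinite_joukowski_image (q : ℂ) : (joukowski '' {z | IsGeneric q z}).Infinite := by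
  have hfin : ∀ c : ℂ, {z : ℂ | z ^ 2 = c}.Finite := fun c => by
    refine (nthRoots 2 c).toFinset.finite_toSet.subset fun z hz => ?_
    simpa [mem_nthRoots two_pos] using hz
  have hbad := ((hfin 1).union ((hfin q⁻¹).union (hfin q))).image joukowski
  refine hbad.infinite_compl.mono fun y hy => ?_
  obtain ⟨z, hz, rfl⟩ := exists_joukowski_eq y
  refine ⟨z, ⟨hz, fun h => hy ⟨z, Or.inl h, rfl⟩, fun h => hy ⟨z, Or.inr (Or.inl ?_), rfl⟩,
    fun h => hy ⟨z, Or.inr (Or.inr h), rfl⟩⟩, rfl⟩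
  exact eq_inv_of_mul_eq_one_right h

theorem eq_of_eval_joukowski (q : ℂ) {f g : ℂ[X]}
    (h : ∀ z, IsGeneric q z → f.eval (joukowski z) = g.eval (joukowski z)) : f = g := by
  refine eq_of_infinite_eval_eq _ _ ((infinite_joukowski_image q).mono ?_)
  rintro _ ⟨z, hz, rfl⟩
  exact h z hz

theorem joukowski_add (p z : ℂ) :
    joukowski (p * z) + joukowski (p⁻¹ * z) =
      2 * ((awScheme p).α * joukowski z + (awScheme p).β) := by
  have hα : (awScheme p).α = (p + p⁻¹) / 2 := rfl
  have hβ : (awScheme p).β = 0 := rfl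
  rw [hα, hβ, joukowski, joukowski, joukowski, mul_inv, mul_inv, inv_inv]
  ring

theorem joukowski_sub (z : ℂ) :
    joukowski (p * z) - joukowski (p⁻¹ * z) = (p - p⁻¹) * (z - z⁻¹) / 2 := by
  rw [joukowski, joukowski, mul_inv, mul_inv, inv_inv]
  ring

theorem joukowski_sub_sq (hp : p ≠ 0) {z : ℂ} (hz : z ≠ 0) :
    (joukowski (p * z) - joukowski (p⁻¹ * z)) ^ 2 = 4 * (awScheme p).U.eval (joukowski z) := by
  have hU : (awScheme p).U = C (((p + p⁻¹) / 2) ^ 2 - 1) * (X ^ 2 - 1) := rfl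
  have hpp : p * p⁻¹ = 1 := mul_inv_cancel₀ hp
  have hzz : z * z⁻¹ = 1 := mul_inv_cancel₀ hz
  rw [joukowski_sub, hU]
  simp only [joukowski, eval_mul, eval_C, eval_sub, eval_pow, eval_X, eval_one]
  have e1 : ((p + p⁻¹) / 2) ^ 2 - 1 = (p - p⁻¹) ^ 2 / 4 := by linear_combination hpp
  have e2 : ((z + z⁻¹) / 2) ^ 2 - 1 = (z - z⁻¹) ^ 2 / 4 := by linear_combination hzz
  rw [e1, e2]
  ring

/-- The operator of finite parameters as a second-order `q`-difference operator. -/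
theorem eval_op_awScheme (hp : p ≠ 0) (hpq : p ^ 2 = q) (h : p - p⁻¹ ≠ 0) {z : ℂ}
    (hz : IsGeneric q z) (τ : Fin 4 → ℂ) (f : ℂ[X]) :
    ((awScheme p).op (form (fun _ => 1) τ) f).eval (joukowski z) = awConst p *
      ((∏ i, (1 - τ i * z)) / z ^ 2 * (f.eval (joukowski (q * z)) - f.eval (joukowski z)) /
          ((z - z⁻¹) * (p * z - (p * z)⁻¹)) +
        (∏ i, (1 - τ i * z⁻¹)) * z ^ 2 *
          (f.eval (joukowski (q⁻¹ * z)) - f.eval (joukowski z)) /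
          ((z - z⁻¹) * (p⁻¹ * z - (p⁻¹ * z)⁻¹))) := by
  obtain ⟨hz0, hz1, hz2, hz3⟩ := hz
  have hpz : p * z ≠ 0 := mul_ne_zero hp hz0
  have hpz' : p⁻¹ * z ≠ 0 := mul_ne_zero (inv_ne_zero hp) hz0
  have e1 : p * (p * z) = q * z := by rw [← hpq]; ring
  have e2 : p⁻¹ * (p * z) = z := by rw [← mul_assoc, inv_mul_cancel₀ hp, one_mul]
  have e3 : p * (p⁻¹ * z) = z := by rw [← mul_assoc, mul_inv_cancel₀ hp, one_mul]
  have e4 : p⁻¹ * (p⁻¹ * z) = q⁻¹ * z := by rw [← hpq]; ring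
  have a1 := joukowski_add p (p * z)
  have a2 := joukowski_sub_sq hp hpz
  have a3 := joukowski_add p (p⁻¹ * z)
  have a4 := joukowski_sub_sq hp hpz'
  have s0 := joukowski_sub (p := p) z
  have s1 := joukowski_sub (p := p) (p * z)
  have s2 := joukowski_sub (p := p) (p⁻¹ * z)
  rw [e1, e2] at a1 a2 s1
  rw [e3, e4] at a3 a4 s2
  have n0 : z - z⁻¹ ≠ 0 := fun h0 => hz1 (by
    field_simp at h0; linear_combination h0)
  have n1 : p * z - (p * z)⁻¹ ≠ 0 := fun h0 => hz2 (by
    rw [← hpq]; field_simp at h0; linear_combination h0)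
  have n2 : p⁻¹ * z - (p⁻¹ * z)⁻¹ ≠ 0 := fun h0 => hz3 (by
    rw [← hpq]; field_simp at h0; linear_combination h0)
  have m0 : (p - p⁻¹) * (z - z⁻¹) / 2 ≠ 0 := div_ne_zero (mul_ne_zero h n0) two_ne_zero
  have m1 : (p - p⁻¹) * (p * z - (p * z)⁻¹) / 2 ≠ 0 := div_ne_zero (mul_ne_zero h n1) two_ne_zero
  have m2 : (p - p⁻¹) * (p⁻¹ * z - (p⁻¹ * z)⁻¹) / 2 ≠ 0 :=
    div_ne_zero (mul_ne_zero h n2) two_ne_zero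
  rw [Scheme.op, (awScheme p).eval_slOp (joukowski_add p z) (joukowski_sub_sq hp hz0) a1 a2 a3 a4
    (sub_ne_zero.1 (s0 ▸ m0)) (sub_ne_zero.1 (s1 ▸ m1)) (sub_ne_zero.1 (s2 ▸ m2)), s0, s1, s2,
    eval_awScheme_Φ, eval_awScheme_Ψ]
  obtain ⟨f0, f1, f2, f3, f4⟩ := form_four (fun _ => 1) τ
  rw [f0, f1, f2, f3, f4, Fin.prod_univ_four, Fin.prod_univ_four]
  generalize eval (joukowski (q * z)) f - eval (joukowski z) f = A
  rw [← neg_sub (eval (joukowski z) f)]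
  generalize eval (joukowski z) f - eval (joukowski (q⁻¹ * z)) f = B
  -- Collects the forward and the backward difference; their coefficients are `φ ± ψ (z - z⁻¹) / 2`,
  -- where `ψ` stands for `Ψ` without its factor `2 / (p - p⁻¹)`.
  have k1 : ∀ φ ψ : ℂ, φ * ((A / ((p - p⁻¹) * (p * z - (p * z)⁻¹) / 2) -
      B / ((p - p⁻¹) * (p⁻¹ * z - (p⁻¹ * z)⁻¹) / 2)) / ((p - p⁻¹) * (z - z⁻¹) / 2)) +
      2 / (p - p⁻¹) * ψ * ((A / ((p - p⁻¹) * (p * z - (p * z)⁻¹) / 2) +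
      B / ((p - p⁻¹) * (p⁻¹ * z - (p⁻¹ * z)⁻¹) / 2)) / 2) = awConst p *
      ((φ + ψ * (z - z⁻¹) / 2) * A / ((z - z⁻¹) * (p * z - (p * z)⁻¹)) +
        (φ - ψ * (z - z⁻¹) / 2) * (-B) / ((z - z⁻¹) * (p⁻¹ * z - (p⁻¹ * z)⁻¹))) := by
    intro φ ψ
    rw [awConst]
    generalize p * z - (p * z)⁻¹ = d1 at *
    generalize p⁻¹ * z - (p⁻¹ * z)⁻¹ = d2 at *
    generalize z - z⁻¹ = d at *
    generalize p - p⁻¹ = r at *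
    field_simp
    ring
  rw [k1]
  congr 4
  -- The sum of the symmetric and the antisymmetric part is the product over `1 - τᵢ z` divided by
  -- `z²`; their difference is its reflection under `z ↦ z⁻¹`.
  · rw [joukowski]; field_simp; ring
  · rw [joukowski]; field_simp; ring

end


/-! ### Operators that are bidiagonal in a basis -/

section bidiagonal

variable {T : ℂ[X] →ₗ[ℂ] ℂ[X]} {e : ℕ → ℂ[X]} {μ σ : ℕ → ℂ}

/-- Row by row, the eigenvector equation for a combination of the `e k` is a two-term recurrence for
its coefficients. -/
theorem bidiagonal_sum (h0 : T (e 0) = μ 0 • e 0)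
    (h : ∀ k, T (e (k + 1)) = μ (k + 1) • e (k + 1) + σ k • e k) (c : ℕ → ℂ) (n : ℕ) :
    T (∑ k ∈ range (n + 1), c k • e k) - μ n • ∑ k ∈ range (n + 1), c k • e k =
      ∑ k ∈ range n, (c k * (μ k - μ n) + c (k + 1) * σ k) • e k := by
  have h1 : ∀ m, T (∑ k ∈ range (m + 1), c k • e k) =
      ∑ k ∈ range (m + 1), (c k * μ k) • e k + ∑ k ∈ range m, (c (k + 1) * σ k) • e k := by
    intro m
    induction m with
    | zero => simp [h0, smul_smul]
    | succ m ih =>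
      rw [sum_range_succ, map_add, ih, map_smul, h, sum_range_succ _ (m + 1),
        sum_range_succ (fun k => (c (k + 1) * σ k) • e k) m, smul_add, smul_smul, smul_smul]
      abel
  rw [h1, smul_sum, sum_range_succ, sum_range_succ (fun i => μ n • c i • e i), smul_smul,
    mul_comm (c n), add_sub_add_comm]
  simp only [add_smul, mul_sub, sub_smul, sum_add_distrib, sum_sub_distrib, smul_smul, mul_comm]
  abel

theorem exists_sum_eq (he : ∀ k, (e k).natDegree = k) (he0 : ∀ k, e k ≠ 0) (n : ℕ) {f : ℂ[X]}
    (hf : f.natDegree ≤ n) : ∃ c : ℕ → ℂ, f = ∑ k ∈ range (n + 1), c k • e k ∧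
      c n = f.coeff n / (e n).coeff n := by
  have hl : ∀ k, (e k).coeff k ≠ 0 := fun k => by
    conv_lhs => rw [← he k, he k]
    have := leadingCoeff_ne_zero.2 (he0 k)
    rwa [leadingCoeff, he k] at this
  induction n generalizing f with
  | zero =>
    refine ⟨fun _ => f.coeff 0 / (e 0).coeff 0, ?_, rfl⟩
    rw [zero_add, sum_range_one, eq_C_of_natDegree_le_zero (he 0).le,
      eq_C_of_natDegree_le_zero hf, smul_C, coeff_C_zero, coeff_C_zero, smul_eq_mul,
      div_mul_cancel₀ _ (hl 0)]
  | succ n ih =>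
    obtain ⟨c, hc, -⟩ := ih (f := f - (f.coeff (n + 1) / (e (n + 1)).coeff (n + 1)) • e (n + 1)) (by
      refine natDegree_le_iff_coeff_eq_zero.2 fun k hk => ?_
      rcases (Nat.succ_le_of_lt hk).eq_or_lt with rfl | hk
      · rw [coeff_sub, coeff_smul, smul_eq_mul, div_mul_cancel₀ _ (hl _), sub_self]
      · rw [coeff_sub, coeff_smul, coeff_eq_zero_of_natDegree_lt (hf.trans_lt hk),
          coeff_eq_zero_of_natDegree_lt ((he (n + 1)).trans_lt hk), smul_zero, sub_zero])
    refine ⟨fun k => if k = n + 1 then f.coeff (n + 1) / (e (n + 1)).coeff (n + 1) else c k, ?_,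
      if_pos rfl⟩
    rw [sum_range_succ]
    beta_reduce
    rw [if_pos rfl, sum_congr rfl (g := fun k => c k • e k), ← hc, sub_add_cancel]
    intro k hk
    rw [if_neg (mem_range.1 hk).ne]

theorem eq_zero_of_sum_eq_zero (he : ∀ k, (e k).natDegree = k) (he0 : ∀ k, e k ≠ 0) {n : ℕ}
    {d : ℕ → ℂ} (h : ∑ k ∈ range n, d k • e k = 0) : ∀ k < n, d k = 0 := by
  induction n with
  | zero => simp
  | succ n ih =>
    have hn : d n = 0 := by
      have h1 := congrArg (fun f => coeff f n) h
      simp only [coeff_zero, sum_range_succ] at h1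
      rw [coeff_add, finsetSum_coeff, sum_eq_zero, zero_add, coeff_smul, smul_eq_mul] at h1
      · refine (mul_eq_zero.1 h1).resolve_right ?_
        have := leadingCoeff_ne_zero.2 (he0 n)
        rwa [leadingCoeff, he n] at this
      · intro k hk
        rw [coeff_smul, coeff_eq_zero_of_natDegree_lt ((he k).trans_lt (mem_range.1 hk)), smul_zero]
    rw [sum_range_succ, hn, zero_smul, add_zero] at h
    intro k hk
    rcases (Nat.lt_succ_iff.1 hk).eq_or_lt with rfl | hk
    · exact hn
    · exact ih h k hk

/-- If the eigenvalue in degree `n` also occurs in degree `m < n` and not in between, then a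
solution of degree `n` forces an off-diagonal entry to vanish. -/
theorem exists_offDiagonal_eq_zero (h0 : T (e 0) = μ 0 • e 0)
    (h : ∀ k, T (e (k + 1)) = μ (k + 1) • e (k + 1) + σ k • e k)
    (he : ∀ k, (e k).natDegree = k) (he0 : ∀ k, e k ≠ 0) {m n : ℕ} (hmn : m < n) (hμ : μ m = μ n)
    {f : ℂ[X]} (hfn : f.natDegree ≤ n) (hfl : f.coeff n ≠ 0)
    (hf : T f = μ n • f) : ∃ k, m ≤ k ∧ k < n ∧ σ k = 0 := by
  by_contra! hσ
  obtain ⟨c, hc, hcn⟩ := exists_sum_eq he he0 n hfn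
  have hl : (e n).coeff n ≠ 0 := by
    have := leadingCoeff_ne_zero.2 (he0 n)
    rwa [leadingCoeff, he n] at this
  have hz := bidiagonal_sum h0 h c n
  rw [← hc, hf, sub_self] at hz
  have hz' := eq_zero_of_sum_eq_zero he he0 hz.symm
  -- Descending from `c n ≠ 0`: if `c k` were zero, row `k` would give `c (k + 1) * σ k = 0`.
  have key : ∀ j, m + 1 + j ≤ n → c (n - j) ≠ 0 := by
    intro j
    induction j with
    | zero => intro _; rw [Nat.sub_zero, hcn]; exact div_ne_zero hfl hl
    | succ j ih =>
      intro hj h1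
      have h2 := hz' (n - (j + 1)) (by omega)
      rw [h1, zero_mul, zero_add, show n - (j + 1) + 1 = n - j by omega] at h2
      exact mul_ne_zero (ih (by omega)) (hσ _ (by omega) (by omega)) h2
  -- In row `m` the diagonal difference vanishes, so only `c (m + 1) * σ m = 0` is left.
  have h1 := hz' m hmn
  rw [hμ, sub_self, mul_zero, zero_add] at h1
  have h2 := key (n - (m + 1)) (by omega)
  rw [show n - (n - (m + 1)) = m + 1 by omega] at h2
  exact mul_ne_zero h2 (hσ m le_rfl hmn) h1

end bidiagonal

/-! ### The Askey–Wilson polynomials -/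

/-- The product `(a e^{iθ}, a e^{-iθ}; q)_k` as a polynomial in `cos θ`. -/
def awBasis (q a : ℂ) (k : ℕ) : ℂ[X] :=
  ∏ j ∈ range k, (1 - C (2 * a * q ^ j) * X + C (a ^ 2 * q ^ (2 * j)))

/-- The coefficients of the Askey–Wilson polynomials in the basis `awBasis`. -/
def awCoeff (q : ℂ) (n : ℕ) (a b c d : ℂ) (k : ℕ) : ℂ :=
  qPoch (q ^ (-(n : ℤ))) q k * qPoch (a * b * c * d * q ^ ((n : ℤ) - 1)) q k / qPoch q q k * q ^ k *
    (qPoch (a * b * q ^ k) q (n - k) * qPoch (a * c * q ^ k) q (n - k) *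
      qPoch (a * d * q ^ k) q (n - k))

theorem askeyWilson_eq (q : ℂ) (n : ℕ) (a b c d : ℂ) : askeyWilson q n a b c d =
    a ^ (-(n : ℤ)) • ∑ k ∈ range (n + 1), awCoeff q n a b c d k • awBasis q a k := by
  rw [askeyWilson, smul_sum]
  refine sum_congr rfl fun k _ => ?_
  rw [smul_smul, smul_eq_C_mul, awBasis, awCoeff]
  congr 2
  ring

theorem natDegree_awFactor_le (q a : ℂ) (j : ℕ) :
    (1 - C (2 * a * q ^ j) * X + C (a ^ 2 * q ^ (2 * j))).natDegree ≤ 1 := by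
  compute_degree

theorem natDegree_awBasis_le (q a : ℂ) (k : ℕ) : (awBasis q a k).natDegree ≤ k :=
  (natDegree_prod_le _ _).trans ((sum_le_sum fun j _ => natDegree_awFactor_le q a j).trans (by simp))

theorem coeff_awBasis (q a : ℂ) (k : ℕ) :
    (awBasis q a k).coeff k = ∏ j ∈ range k, (-(2 * a * q ^ j)) := by
  have := coeff_prod_of_natDegree_le (range k)
    (fun j => 1 - C (2 * a * q ^ j) * X + C (a ^ 2 * q ^ (2 * j))) 1
    fun j _ => natDegree_awFactor_le q a j
  rw [card_range, mul_one] at this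
  rw [awBasis, this]
  refine prod_congr rfl fun j _ => ?_
  rw [coeff_add, coeff_sub, coeff_C_mul, coeff_X_one, coeff_one, coeff_C]
  simp

section

variable {p q : ℂ}

theorem coeff_awBasis_ne_zero (hq : q ≠ 0) {a : ℂ} (ha : a ≠ 0) (k : ℕ) :
    (awBasis q a k).coeff k ≠ 0 := by
  rw [coeff_awBasis]
  exact prod_ne_zero_iff.2 fun j _ =>
    neg_ne_zero.2 (mul_ne_zero (mul_ne_zero two_ne_zero ha) (pow_ne_zero j hq))

theorem natDegree_awBasis (hq : q ≠ 0) {a : ℂ} (ha : a ≠ 0) (k : ℕ) :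
    (awBasis q a k).natDegree = k :=
  natDegree_eq_of_le_of_coeff_ne_zero (natDegree_awBasis_le q a k) (coeff_awBasis_ne_zero hq ha k)

theorem awBasis_ne_zero (hq : q ≠ 0) {a : ℂ} (ha : a ≠ 0) (k : ℕ) : awBasis q a k ≠ 0 := fun h =>
  coeff_awBasis_ne_zero hq ha k (by rw [h, coeff_zero])

theorem eval_awBasis (q a : ℂ) (k : ℕ) {z : ℂ} (hz : z ≠ 0) :
    (awBasis q a k).eval (joukowski z) = qPoch (a * z) q k * qPoch (a * z⁻¹) q k := by
  rw [awBasis, eval_prod, qPoch, qPoch, ← prod_mul_distrib]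
  refine prod_congr rfl fun j _ => ?_
  simp only [eval_add, eval_sub, eval_one, eval_mul, eval_C, eval_X, joukowski]
  field_simp
  ring

theorem qPoch_succ (x q : ℂ) (k : ℕ) : qPoch x q (k + 1) = qPoch x q k * (1 - x * q ^ k) :=
  prod_range_succ _ _

theorem qPoch_succ' (x q : ℂ) (k : ℕ) : qPoch x q (k + 1) = (1 - x) * qPoch (x * q) q k := by
  rw [qPoch, prod_range_succ', pow_zero, mul_one, mul_comm, qPoch]
  congr 1
  exact prod_congr rfl fun j _ => by rw [pow_succ]; ring

/-- The operator of finite parameters is bidiagonal in `awBasis q (τ 0)`. -/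
def awOffDiagonal (p q : ℂ) (τ : Fin 4 → ℂ) (k : ℕ) : ℂ :=
  -(awConst p * (1 - q ^ (k + 1)) / (p * q ^ k) * ((1 - τ 0 * τ 1 * q ^ k) *
    (1 - τ 0 * τ 2 * q ^ k) * (1 - τ 0 * τ 3 * q ^ k)))

theorem op_awBasis_zero (p q : ℂ) (τ : Fin 4 → ℂ) :
    (awScheme p).op (form (fun _ => 1) τ) (awBasis q (τ 0) 0) =
      (awScheme p).ev (form (fun _ => 1) τ) 0 • awBasis q (τ 0) 0 := by
  have : (awBasis q (τ 0) 0).natDegree ≤ 0 := natDegree_awBasis_le q _ 0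
  rw [Scheme.op, LatticeData.slOp_of_natDegree_eq_zero _ this, Scheme.ev, LatticeData.eig]
  simp [LatticeData.leadPair]

/-- The shifts `z ↦ q^(±1) z` change the basis product only in its end factors. The remaining middle
part is common to all terms, and a Laurent polynomial identity is left. -/
theorem op_awBasis_succ (hp : p ≠ 0) (hpq : p ^ 2 = q) (h : p - p⁻¹ ≠ 0) (τ : Fin 4 → ℂ)
    (k : ℕ) : (awScheme p).op (form (fun _ => 1) τ) (awBasis q (τ 0) (k + 1)) =
      (awScheme p).ev (form (fun _ => 1) τ) (k + 1) • awBasis q (τ 0) (k + 1) +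
        awOffDiagonal p q τ k • awBasis q (τ 0) k := by
  have hq : q ≠ 0 := by rw [← hpq]; exact pow_ne_zero 2 hp
  refine eq_of_eval_joukowski q fun z hz => ?_
  have hz0 := hz.1
  rw [eval_op_awScheme hp hpq h hz, eval_add, eval_smul, eval_smul, eval_awBasis _ _ _ hz0,
    eval_awBasis _ _ _ (mul_ne_zero hq hz0), eval_awBasis _ _ _ (mul_ne_zero (inv_ne_zero hq) hz0),
    eval_awBasis _ _ _ hz0, ev_awScheme_succ hp hpq h]
  obtain ⟨f0, -, -, -, f4⟩ := form_four (fun _ => 1) τ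
  rw [f0, f4, awOffDiagonal, Fin.prod_univ_four, Fin.prod_univ_four]
  -- The factor `1 - τ 0 z` of the operator completes the shifted product, which is what lets the
  -- unshifted product be factored out; likewise for the backward shift.
  have s1 : (1 - τ 0 * z) * qPoch (τ 0 * (q * z)) q k =
      qPoch (τ 0 * z) q k * (1 - τ 0 * z * q ^ k) := by
    rw [show τ 0 * (q * z) = τ 0 * z * q by ring, ← qPoch_succ', qPoch_succ]
  have s2 : (1 - τ 0 * z⁻¹) * qPoch (τ 0 * (q⁻¹ * z)⁻¹) q k =
      qPoch (τ 0 * z⁻¹) q k * (1 - τ 0 * z⁻¹ * q ^ k) := by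
    rw [show τ 0 * (q⁻¹ * z)⁻¹ = τ 0 * z⁻¹ * q by rw [mul_inv, inv_inv]; ring, ← qPoch_succ',
      qPoch_succ]
  have s3 : qPoch (τ 0 * (q * z)⁻¹) q (k + 1) = (1 - τ 0 * (q * z)⁻¹) * qPoch (τ 0 * z⁻¹) q k := by
    rw [qPoch_succ', show τ 0 * (q * z)⁻¹ * q = τ 0 * z⁻¹ by field_simp]
  have s4 : qPoch (τ 0 * (q⁻¹ * z)) q (k + 1) = (1 - τ 0 * (q⁻¹ * z)) * qPoch (τ 0 * z) q k := by
    rw [qPoch_succ', show τ 0 * (q⁻¹ * z) * q = τ 0 * z by field_simp]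
  rw [s3, s4, qPoch_succ (τ 0 * (q * z)), qPoch_succ (τ 0 * (q⁻¹ * z)⁻¹), qPoch_succ (τ 0 * z),
    qPoch_succ (τ 0 * z⁻¹)]
  obtain ⟨-, hz1, hz2, hz3⟩ := hz
  have n0 : z ^ 2 - 1 ≠ 0 := sub_ne_zero.2 hz1
  have n1 : q * z ^ 2 - 1 ≠ 0 := sub_ne_zero.2 hz2
  have n2 : z ^ 2 - q ≠ 0 := sub_ne_zero.2 hz3
  have r0 : z - z⁻¹ = (z ^ 2 - 1) / z := by field_simp
  have r1 : p * z - (p * z)⁻¹ = (q * z ^ 2 - 1) / (p * z) := by rw [← hpq]; field_simp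
  have r2 : p⁻¹ * z - (p⁻¹ * z)⁻¹ = (z ^ 2 - q) / (p * z) := by rw [← hpq]; field_simp
  rw [r0, r1, r2]
  generalize hA : qPoch (τ 0 * z) q k = A at *
  generalize hB : qPoch (τ 0 * z⁻¹) q k = B at *
  generalize hR : qPoch (τ 0 * (q * z)) q k = R at *
  generalize hR' : qPoch (τ 0 * (q⁻¹ * z)⁻¹) q k = R' at *
  generalize awConst p = κ at *
  have hqk : q ^ k ≠ 0 := pow_ne_zero k hq
  have hqk1 : q ^ (k + 1) = q ^ k * q := pow_succ _ _
  rw [hqk1]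
  generalize q ^ k = K at *
  generalize τ 0 = a at *
  generalize τ 1 = b at *
  generalize τ 2 = c at *
  generalize τ 3 = d at *
  -- One of the two singular denominators cancels against the difference of the basis products.
  have c1 : (z - (q * z)⁻¹) / ((z ^ 2 - 1) / z * ((q * z ^ 2 - 1) / (p * z))) =
      z / (p * (z ^ 2 - 1)) := by
    have : z - (q * z)⁻¹ = (q * z ^ 2 - 1) / (q * z) := by field_simp
    rw [this, ← hpq]
    rw [← hpq] at n1
    field_simp
  have c2 : (z⁻¹ - q⁻¹ * z) / ((z ^ 2 - 1) / z * ((z ^ 2 - q) / (p * z))) =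
      -(z / (p * (z ^ 2 - 1))) := by
    have : z⁻¹ - q⁻¹ * z = -(z ^ 2 - q) / (q * z) := by field_simp; ring
    rw [this, ← hpq]
    rw [← hpq] at n2
    field_simp
  have t1 : (1 - a * z) * (1 - b * z) * (1 - c * z) * (1 - d * z) / z ^ 2 *
      (R * (1 - a * (q * z) * K) * ((1 - a * (q * z)⁻¹) * B) -
        A * (1 - a * z * K) * (B * (1 - a * z⁻¹ * K))) =
      A * (1 - a * z * K) * B * (1 - b * z) * (1 - c * z) * (1 - d * z) / z ^ 2 *
        (a * (1 - K * q)) * (z - (q * z)⁻¹) := by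
    rw [← s1]
    field_simp
    ring
  have t2 : (1 - a * z⁻¹) * (1 - b * z⁻¹) * (1 - c * z⁻¹) * (1 - d * z⁻¹) * z ^ 2 *
      ((1 - a * (q⁻¹ * z)) * A * (R' * (1 - a * (q⁻¹ * z)⁻¹ * K)) -
        A * (1 - a * z * K) * (B * (1 - a * z⁻¹ * K))) =
      B * (1 - a * z⁻¹ * K) * A * (1 - b * z⁻¹) * (1 - c * z⁻¹) * (1 - d * z⁻¹) * z ^ 2 *
        (a * (1 - K * q)) * (z⁻¹ - q⁻¹ * z) := by
    rw [← s2]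
    field_simp
    ring
  -- With `K = q ^ k`, this identity separates the eigenvalue, which carries `1 - abcd K`, from the
  -- off-diagonal entry.
  have core : a * K * ((1 - a * z * K) * (1 - b * z) * (1 - c * z) * (1 - d * z) / z ^ 2 -
      (1 - a * z⁻¹ * K) * (1 - b * z⁻¹) * (1 - c * z⁻¹) * (1 - d * z⁻¹) * z ^ 2) *
        (z / (z ^ 2 - 1)) =
      (1 - a * b * c * d * K) * (1 - a * z * K) * (1 - a * z⁻¹ * K) -
        (1 - a * b * K) * (1 - a * c * K) * (1 - a * d * K) := by
    field_simp
    ring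
  rw [t1, t2, mul_div_assoc _ (z - (q * z)⁻¹), mul_div_assoc _ (z⁻¹ - q⁻¹ * z), c1, c2]
  have e : κ * ((1 - K * q) * (1 * 1 * 1 * 1 - a * b * c * d * K) / (p * K)) *
      (A * (1 - a * z * K) * (B * (1 - a * z⁻¹ * K))) +
      -(κ * (1 - K * q) / (p * K) * ((1 - a * b * K) * (1 - a * c * K) * (1 - a * d * K))) *
        (A * B) = κ * A * B * (1 - K * q) / (p * K) *
      ((1 - a * b * c * d * K) * (1 - a * z * K) * (1 - a * z⁻¹ * K) -
        (1 - a * b * K) * (1 - a * c * K) * (1 - a * d * K)) := by ring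
  rw [smul_eq_mul, smul_eq_mul, e, ← core]
  clear core e t1 t2 c1 c2
  generalize (1 - b * z) = b1, (1 - c * z) = c1, (1 - d * z) = d1, (1 - b * z⁻¹) = b2,
    (1 - c * z⁻¹) = c2, (1 - d * z⁻¹) = d2, (1 - a * z * K) = a1, (1 - a * z⁻¹ * K) = a2,
    z ^ 2 - 1 = w at *
  field_simp
  ring

end


/-! ### The Askey–Wilson polynomials as eigenvectors -/

section

variable {p q : ℂ}

theorem qPoch_ne_zero_iff {x q : ℂ} {k : ℕ} : qPoch x q k ≠ 0 ↔ ∀ j < k, x * q ^ j ≠ 1 := by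
  rw [qPoch, prod_ne_zero_iff]
  refine forall_congr' fun j => ?_
  rw [mem_range, sub_ne_zero, ne_comm]

theorem qPoch_add (x q : ℂ) (i j : ℕ) :
    qPoch x q (i + j) = qPoch x q i * qPoch (x * q ^ i) q j := by
  rw [qPoch, prod_range_add, qPoch, qPoch]
  congr 1
  exact prod_congr rfl fun k _ => by rw [pow_add, mul_assoc]

theorem qPoch_self_ne_zero (hr : ∀ k : ℕ, 1 ≤ k → q ^ k ≠ 1) (k : ℕ) : qPoch q q k ≠ 0 :=
  qPoch_ne_zero_iff.2 fun j _ => by rw [← pow_succ']; exact hr _ (by omega)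

theorem qPoch_neg_ne_zero (hq : q ≠ 0) (hr : ∀ k : ℕ, 1 ≤ k → q ^ k ≠ 1) {k n : ℕ} (hk : k ≤ n) :
    qPoch (q ^ (-(n : ℤ))) q k ≠ 0 :=
  qPoch_ne_zero_iff.2 fun j hj h => by
    rw [zpow_neg, zpow_natCast, inv_mul_eq_one₀ (pow_ne_zero n hq)] at h
    have := pow_injective_of_not_root hq hr h
    omega

theorem tendsto_qPoch {x : ℕ → ℂ} {ξ : ℂ} (hx : Tendsto x atTop (𝓝 ξ)) (q : ℂ) (k : ℕ) :
    Tendsto (fun j => qPoch (x j) q k) atTop (𝓝 (qPoch ξ q k)) :=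
  tendsto_finsetProd _ fun _ _ => tendsto_const_nhds.sub (hx.mul_const _)

theorem coeffTendsto_awBasis {a : ℕ → ℂ} {α : ℂ} (ha : Tendsto a atTop (𝓝 α)) (q : ℂ) (k : ℕ) :
    CoeffTendsto (fun j => awBasis q (a j) k) (awBasis q α k) :=
  CoeffTendsto.prod _ fun _ _ => ((CoeffTendsto.const 1).sub
    ((CoeffTendsto.C ((ha.const_mul 2).mul_const _)).mul (CoeffTendsto.const X))).add
    (CoeffTendsto.C ((ha.pow 2).mul_const _))

/-- Consecutive coefficients of the hypergeometric sum differ by one factor of each shifted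
factorial, and these factors are exactly the eigenvalue difference and the off-diagonal entry. -/
theorem awCoeff_recurrence (hp : p ≠ 0) (hpq : p ^ 2 = q) (hr : ∀ k : ℕ, 1 ≤ k → q ^ k ≠ 1)
    (τ : Fin 4 → ℂ) {k n : ℕ} (hk : k < n) :
    awCoeff q n (τ 0) (τ 1) (τ 2) (τ 3) k * ((awScheme p).ev (form (fun _ => 1) τ) k -
      (awScheme p).ev (form (fun _ => 1) τ) n) +
      awCoeff q n (τ 0) (τ 1) (τ 2) (τ 3) (k + 1) * awOffDiagonal p q τ k = 0 := by
  have h := sub_inv_ne_zero hp hpq (by simpa using hr 1 le_rfl)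
  have hq : q ≠ 0 := by rw [← hpq]; exact pow_ne_zero 2 hp
  obtain ⟨f0, -, -, -, f4⟩ := form_four (fun _ => 1) τ
  have hx : ∀ x : ℂ, qPoch (x * q ^ k) q (n - k) =
      (1 - x * q ^ k) * qPoch (x * q ^ (k + 1)) q (n - (k + 1)) := fun x => by
    rw [show n - k = n - (k + 1) + 1 by omega, qPoch_succ', pow_succ, mul_assoc]
  have hqq := qPoch_self_ne_zero hr k
  have hqk : 1 - q * q ^ k ≠ 0 := by
    rw [← pow_succ']; exact sub_ne_zero.2 (hr _ (by omega)).symm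
  have hk0 := pow_ne_zero k hq
  have hn0 := pow_ne_zero n hq
  rw [ev_awScheme hp hpq h, ev_awScheme hp hpq h, f0, f4, awOffDiagonal, awCoeff, awCoeff, hx, hx,
    hx, qPoch_succ, qPoch_succ, qPoch_succ, zpow_neg, zpow_natCast, zpow_sub_one₀ hq, zpow_natCast,
    pow_succ' q k]
  generalize qPoch (τ 0 * τ 1 * (q * q ^ k)) q (n - (k + 1)) = B1
  generalize qPoch (τ 0 * τ 2 * (q * q ^ k)) q (n - (k + 1)) = B2
  generalize qPoch (τ 0 * τ 3 * (q * q ^ k)) q (n - (k + 1)) = B3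
  generalize qPoch q q k = E1 at *
  generalize qPoch (q ^ n)⁻¹ q k = E2
  generalize qPoch (τ 0 * τ 1 * τ 2 * τ 3 * (q ^ n * q⁻¹)) q k = E3
  generalize awConst p = κ
  generalize q ^ k = K at *
  generalize q ^ n = N at *
  generalize 1 - q * K = W at *
  field_simp
  ring

theorem op_awSum (hp : p ≠ 0) (hpq : p ^ 2 = q) (hr : ∀ k : ℕ, 1 ≤ k → q ^ k ≠ 1)
    (τ : Fin 4 → ℂ) (n : ℕ) :
    (awScheme p).op (form (fun _ => 1) τ)
        (∑ k ∈ range (n + 1), awCoeff q n (τ 0) (τ 1) (τ 2) (τ 3) k • awBasis q (τ 0) k) =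
      (awScheme p).ev (form (fun _ => 1) τ) n •
        ∑ k ∈ range (n + 1), awCoeff q n (τ 0) (τ 1) (τ 2) (τ 3) k • awBasis q (τ 0) k := by
  have h := sub_inv_ne_zero hp hpq (by simpa using hr 1 le_rfl)
  rw [← sub_eq_zero, bidiagonal_sum (op_awBasis_zero p q τ) (op_awBasis_succ hp hpq h τ)]
  refine sum_eq_zero fun k hk => ?_
  rw [awCoeff_recurrence hp hpq hr τ (mem_range.1 hk), zero_smul]

theorem natDegree_sum_smul_le {e : ℕ → ℂ[X]} (he : ∀ k, (e k).natDegree ≤ k) (c : ℕ → ℂ) (n : ℕ) :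
    (∑ k ∈ range (n + 1), c k • e k).natDegree ≤ n :=
  natDegree_sum_le_of_forall_le _ _ fun k hk => (natDegree_smul_le _ _).trans
    ((he k).trans (Nat.lt_succ_iff.1 (mem_range.1 hk)))

theorem coeff_sum_smul {e : ℕ → ℂ[X]} (he : ∀ k, (e k).natDegree ≤ k) (c : ℕ → ℂ) {n : ℕ}
    {s : Finset ℕ} (hs : ∀ k ∈ s, k < n) :
    (∑ k ∈ s, c k • e k).coeff n = 0 := by
  rw [finsetSum_coeff]
  refine sum_eq_zero fun k hk => ?_
  rw [coeff_smul, coeff_eq_zero_of_natDegree_lt ((he k).trans_lt (hs k hk)), smul_zero]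

/-- For `k = n` only `(abcd q^(n-1); q)_n` can vanish, and its zeros are the coincidences of the
`n`-th eigenvalue with a lower one. -/
theorem awCoeff_self_ne_zero_iff (hq : q ≠ 0) (hr : ∀ k : ℕ, 1 ≤ k → q ^ k ≠ 1) (a b c d : ℂ)
    (n : ℕ) : awCoeff q n a b c d n ≠ 0 ↔ ∀ k < n, q ≠ a * b * c * d * q ^ (k + n) := by
  have h1 := qPoch_neg_ne_zero hq hr (le_refl n)
  have h2 := qPoch_self_ne_zero hr n
  have h3 : ∀ x : ℂ, qPoch x q 0 = 1 := fun x => rfl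
  rw [awCoeff, Nat.sub_self, h3, h3, h3, one_mul, one_mul, mul_one, mul_ne_zero_iff,
    and_iff_left (pow_ne_zero n hq), div_ne_zero_iff, and_iff_left h2, mul_ne_zero_iff,
    and_iff_right h1, qPoch_ne_zero_iff]
  refine forall₂_congr fun k _ => not_congr ?_
  rw [zpow_sub_one₀ hq, zpow_natCast, pow_add, ← mul_left_inj' hq, one_mul, eq_comm]
  rw [show a * b * c * d * (q ^ n * q⁻¹) * q ^ k * q = a * b * c * d * (q ^ k * q ^ n) by
    field_simp]

theorem isFamily_askeyWilson (hp : p ≠ 0) (hpq : p ^ 2 = q) (hr : ∀ k : ℕ, 1 ≤ k → q ^ k ≠ 1)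
    (n : ℕ) : Scheme.IsFamily (awScheme p) (askeyWilson q n) {τ | τ 0 ≠ 0} n where
  mem_of_ne_zero τ h := h 0
  natDegree_le a b c d := by
    rw [askeyWilson_eq]
    exact (natDegree_smul_le _ _).trans (natDegree_sum_smul_le (natDegree_awBasis_le q a) _ n)
  op_eq τ _ := by rw [askeyWilson_eq, map_smul, op_awSum hp hpq hr, smul_comm]
  coeff_ne_zero_iff τ hτ := by
    have hq : q ≠ 0 := by rw [← hpq]; exact pow_ne_zero 2 hp
    obtain ⟨f0, -, -, -, f4⟩ := form_four (fun _ => 1) τ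
    rw [askeyWilson_eq, sum_range_succ, coeff_smul, coeff_add,
      coeff_sum_smul (natDegree_awBasis_le q (τ 0)) _ fun k hk => mem_range.1 hk, zero_add,
      coeff_smul, smul_eq_mul, smul_eq_mul, mul_ne_zero_iff, mul_ne_zero_iff,
      and_iff_right (zpow_ne_zero _ hτ), and_iff_left (coeff_awBasis_ne_zero hq hτ n),
      awCoeff_self_ne_zero_iff hq hr, simple_awScheme_iff hp hpq hr, f0, f4]
    simp only [one_mul]

/-! ### Parameters with a coincidence of two eigenvalues -/

/-- The product of the factors that vanish at a coincidence with a solution. -/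
def awResonance (q : ℂ) (m n : ℕ) (x₁ x₂ x₃ : ℂ) : ℂ :=
  qPoch (x₁ * q ^ m) q (n - m) * qPoch (x₂ * q ^ m) q (n - m) * qPoch (x₃ * q ^ m) q (n - m)

/-- The part of the Askey–Wilson polynomial of degree at most `m`, without the resonant factor. -/
def awLow (q : ℂ) (m n : ℕ) (a A x₁ x₂ x₃ : ℂ) : ℂ[X] :=
  ∑ k ∈ range (m + 1), (qPoch (q ^ (-(n : ℤ))) q k * qPoch A q k / qPoch q q k * q ^ k *
    (qPoch (x₁ * q ^ k) q (m - k) * qPoch (x₂ * q ^ k) q (m - k) * qPoch (x₃ * q ^ k) q (m - k))) •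
      awBasis q a k

/-- The part of the Askey–Wilson polynomial of degree above `m`, without the factor `1 - A q ^ m`. -/
def awHigh (q : ℂ) (m n : ℕ) (a A x₁ x₂ x₃ : ℂ) : ℂ[X] :=
  ∑ k ∈ Ico (m + 1) (n + 1), (qPoch (q ^ (-(n : ℤ))) q k *
    (qPoch A q m * qPoch (A * q ^ (m + 1)) q (k - (m + 1))) / qPoch q q k * q ^ k *
    (qPoch (x₁ * q ^ k) q (n - k) * qPoch (x₂ * q ^ k) q (n - k) * qPoch (x₃ * q ^ k) q (n - k))) •
      awBasis q a k

/-- For `k ≤ m` every `(x q^k; q)_(n-k)` contains `(x q^m; q)_(n-m)`; for `k > m` the factor `(A;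
q)_k` contains `1 - A q^m`. When both scalars vanish, perturbations recombine the two parts in any
ratio. -/
theorem awSum_split (q : ℂ) {m n : ℕ} (hmn : m < n) (a b c d : ℂ) :
    ∑ k ∈ range (n + 1), awCoeff q n a b c d k • awBasis q a k =
      awResonance q m n (a * b) (a * c) (a * d) •
        awLow q m n a (a * b * c * d * q ^ ((n : ℤ) - 1)) (a * b) (a * c) (a * d) +
      (1 - a * b * c * d * q ^ ((n : ℤ) - 1) * q ^ m) •
        awHigh q m n a (a * b * c * d * q ^ ((n : ℤ) - 1)) (a * b) (a * c) (a * d) := by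
  rw [← sum_range_add_sum_Ico _ (show m + 1 ≤ n + 1 by omega), awLow, awHigh, smul_sum, smul_sum]
  congr 1
  · refine sum_congr rfl fun k hk => ?_
    have hk := mem_range.1 hk
    have hx : ∀ x : ℂ, qPoch (x * q ^ k) q (n - k) =
        qPoch (x * q ^ k) q (m - k) * qPoch (x * q ^ m) q (n - m) := fun x => by
      rw [show n - k = (m - k) + (n - m) by omega, qPoch_add, mul_assoc x, ← pow_add,
        show k + (m - k) = m by omega]
    rw [smul_smul, awCoeff, hx, hx, hx, awResonance]
    congr 1
    ring
  · refine sum_congr rfl fun k hk => ?_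
    have hk := mem_Ico.1 hk
    have hA : ∀ A : ℂ, qPoch A q k =
        qPoch A q m * (1 - A * q ^ m) * qPoch (A * q ^ (m + 1)) q (k - (m + 1)) := fun A => by
      rw [← qPoch_succ, ← qPoch_add, show m + 1 + (k - (m + 1)) = k by omega]
    rw [smul_smul, awCoeff, hA (a * b * c * d * q ^ ((n : ℤ) - 1))]
    congr 1
    ring

section tendsto

variable {a A x₁ x₂ x₃ : ℕ → ℂ} {a' A' x₁' x₂' x₃' : ℂ}

theorem coeffTendsto_awLow (ha : Tendsto a atTop (𝓝 a')) (hA : Tendsto A atTop (𝓝 A'))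
    (h₁ : Tendsto x₁ atTop (𝓝 x₁')) (h₂ : Tendsto x₂ atTop (𝓝 x₂'))
    (h₃ : Tendsto x₃ atTop (𝓝 x₃')) (q : ℂ) (m n : ℕ) :
    CoeffTendsto (fun j => awLow q m n (a j) (A j) (x₁ j) (x₂ j) (x₃ j))
      (awLow q m n a' A' x₁' x₂' x₃') :=
  CoeffTendsto.sum _ fun k _ => CoeffTendsto.smul
    (((((tendsto_qPoch hA q k).const_mul _).div_const _).mul_const _).mul
      (((tendsto_qPoch (h₁.mul_const _) q _).mul (tendsto_qPoch (h₂.mul_const _) q _)).mul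
        (tendsto_qPoch (h₃.mul_const _) q _))) (coeffTendsto_awBasis ha q k)

theorem coeffTendsto_awHigh (ha : Tendsto a atTop (𝓝 a')) (hA : Tendsto A atTop (𝓝 A'))
    (h₁ : Tendsto x₁ atTop (𝓝 x₁')) (h₂ : Tendsto x₂ atTop (𝓝 x₂'))
    (h₃ : Tendsto x₃ atTop (𝓝 x₃')) (q : ℂ) (m n : ℕ) :
    CoeffTendsto (fun j => awHigh q m n (a j) (A j) (x₁ j) (x₂ j) (x₃ j))
      (awHigh q m n a' A' x₁' x₂' x₃') :=
  CoeffTendsto.sum _ fun k _ => CoeffTendsto.smul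
    ((((((tendsto_qPoch hA q _).mul (tendsto_qPoch (hA.mul_const _) q _)).const_mul
      _).div_const _).mul_const _).mul
      (((tendsto_qPoch (h₁.mul_const _) q _).mul (tendsto_qPoch (h₂.mul_const _) q _)).mul
        (tendsto_qPoch (h₃.mul_const _) q _))) (coeffTendsto_awBasis ha q k)

end tendsto

/-- Since `A q ^ m = 1` and `q` is not a root of unity, `A q ^ j = 1` holds for no `j < m`, so the
top coefficient survives. -/
theorem natDegree_awLow (hq : q ≠ 0) (hr : ∀ k : ℕ, 1 ≤ k → q ^ k ≠ 1) {m n : ℕ} (hmn : m < n)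
    {a A : ℂ} (ha : a ≠ 0) (hA : A * q ^ m = 1) (x₁ x₂ x₃ : ℂ) :
    (awLow q m n a A x₁ x₂ x₃).natDegree = m ∧ awLow q m n a A x₁ x₂ x₃ ≠ 0 := by
  have hc : (awLow q m n a A x₁ x₂ x₃).coeff m ≠ 0 := by
    rw [awLow, sum_range_succ, coeff_add,
      coeff_sum_smul (natDegree_awBasis_le q a) _ fun k hk => mem_range.1 hk, zero_add, coeff_smul,
      smul_eq_mul, Nat.sub_self]
    refine mul_ne_zero (mul_ne_zero (mul_ne_zero (div_ne_zero (mul_ne_zero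
      (qPoch_neg_ne_zero hq hr hmn.le) (qPoch_ne_zero_iff.2 fun j hj h => ?_))
      (qPoch_self_ne_zero hr m)) (pow_ne_zero m hq)) (by simp [qPoch]))
      (coeff_awBasis_ne_zero hq ha m)
    have := pow_injective_of_not_root hq hr
      (mul_left_cancel₀ (left_ne_zero_of_mul_eq_one hA) (h.trans hA.symm))
    omega
  exact ⟨natDegree_eq_of_le_of_coeff_ne_zero
    (natDegree_sum_smul_le (natDegree_awBasis_le q a) _ m) hc, fun h => hc (by rw [h, coeff_zero])⟩

/-- Once the vanishing factor is removed, `A q ^ (m + 1) = q`, so the rest of `(A; q)_n` is a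
nonzero `(A; q)_m` times a nonzero `(q; q)_(n-m-1)`. -/
theorem coeff_awHigh (hq : q ≠ 0) (hr : ∀ k : ℕ, 1 ≤ k → q ^ k ≠ 1) {m n : ℕ} (hmn : m < n)
    {a A : ℂ} (ha : a ≠ 0) (hA : A * q ^ m = 1) (x₁ x₂ x₃ : ℂ) :
    (awHigh q m n a A x₁ x₂ x₃).natDegree ≤ n ∧ (awHigh q m n a A x₁ x₂ x₃).coeff n ≠ 0 := by
  constructor
  · exact natDegree_sum_le_of_forall_le _ _ fun k hk => (natDegree_smul_le _ _).trans
      ((natDegree_awBasis_le q a k).trans (Nat.lt_succ_iff.1 (mem_Ico.1 hk).2))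
  · rw [awHigh, sum_Ico_succ_top (by omega), coeff_add,
      coeff_sum_smul (natDegree_awBasis_le q a) _ fun k hk => (mem_Ico.1 hk).2, zero_add,
      coeff_smul, smul_eq_mul, Nat.sub_self]
    refine mul_ne_zero (mul_ne_zero (mul_ne_zero (div_ne_zero (mul_ne_zero
      (qPoch_neg_ne_zero hq hr le_rfl) (mul_ne_zero (qPoch_ne_zero_iff.2 fun j hj h => ?_)
      (qPoch_ne_zero_iff.2 fun j hj => ?_)))
      (qPoch_self_ne_zero hr n)) (pow_ne_zero n hq)) (by simp [qPoch]))
      (coeff_awBasis_ne_zero hq ha n)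
    · have := pow_injective_of_not_root hq hr
        (mul_left_cancel₀ (left_ne_zero_of_mul_eq_one hA) (h.trans hA.symm))
      omega
    · rw [pow_succ, ← mul_assoc, hA, one_mul, ← pow_succ']
      exact hr _ (by omega)

theorem continuous_awResonance (q : ℂ) (m n : ℕ) (x₁ x₂ x₃ : ℂ) :
    Continuous fun ε => awResonance q m n (x₁ * (1 + ε)) (x₂ * (1 + ε)) (x₃ * (1 + ε)) := by
  simp only [awResonance, qPoch]
  fun_prop

/-- A factor that vanishes at `x` is nonzero for every nonzero perturbation; the others stay nonzero
near `x`. -/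
theorem eventually_qPoch_ne_zero (q x : ℂ) (k : ℕ) :
    ∀ᶠ j : ℕ in atTop, qPoch (x * (1 + 1 / ((j : ℂ) + 1))) q k ≠ 0 := by
  simp only [qPoch_ne_zero_iff]
  have h1 : Tendsto (fun j : ℕ => 1 / ((j : ℂ) + 1)) atTop (𝓝 0) :=
    tendsto_one_div_add_atTop_nhds_zero_nat
  have : ∀ l ∈ range k, ∀ᶠ j : ℕ in atTop, x * (1 + 1 / ((j : ℂ) + 1)) * q ^ l ≠ 1 := by
    intro l _
    by_cases h : x * q ^ l = 1
    · refine Eventually.of_forall fun j hj => ?_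
      have h2 : x * q ^ l * (1 + 1 / ((j : ℂ) + 1)) = 1 := by linear_combination hj
      rw [h, one_mul, add_eq_left] at h2
      exact one_div_ne_zero (Nat.cast_add_one_ne_zero j) h2
    · have h2 := ((h1.const_add 1).const_mul x).mul_const (q ^ l)
      rw [add_zero, mul_one] at h2
      exact h2.eventually_ne h
  filter_upwards [(Finset.eventually_all (range k)).2 this] with j hj l hl
  exact hj l (mem_range.2 hl)

/-- Both scalars in `awSum_split` vanish at the given parameters; moving them independently, with
quotient tending to `γ`, produces every combination of the two parts. -/
theorem awHigh_add_mem_limits (hq : q ≠ 0) (hr : ∀ k : ℕ, 1 ≤ k → q ^ k ≠ 1) {m n : ℕ}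
    (hmn : m < n) {a b c d : ℂ} (ha : a ≠ 0)
    (hA : a * b * c * d * q ^ ((n : ℤ) - 1) * q ^ m = 1)
    (hres : awResonance q m n (a * b) (a * c) (a * d) = 0) (γ : ℂ) :
    awHigh q m n a (a * b * c * d * q ^ ((n : ℤ) - 1)) (a * b) (a * c) (a * d) +
      γ • awLow q m n a (a * b * c * d * q ^ ((n : ℤ) - 1)) (a * b) (a * c) (a * d) ∈
      limits (askeyWilson q n) {τ | τ 0 ≠ 0} n ![(a : OnePoint ℂ), b, c, d] := by
  obtain ⟨ε, s, hε, hs, hs0, hlim⟩ := exists_rates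
    (B := fun ε => awResonance q m n (a * b * (1 + ε)) (a * c * (1 + ε)) (a * d * (1 + ε)))
    (by simpa using hres) (continuous_awResonance q m n _ _ _).continuousAt (by
      filter_upwards [eventually_qPoch_ne_zero q (a * b * q ^ m) (n - m),
        eventually_qPoch_ne_zero q (a * c * q ^ m) (n - m),
        eventually_qPoch_ne_zero q (a * d * q ^ m) (n - m)] with j h1 h2 h3
      refine mul_ne_zero (mul_ne_zero ?_ ?_) ?_
      · rwa [mul_right_comm]
      · rwa [mul_right_comm]
      · rwa [mul_right_comm]) γ
  -- The first parameter is multiplied by `r`, the others by `(1 + ε) / r`. Then `ab`, `ac`, `ad`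
  -- are multiplied by `1 + ε` and `abcd` by `(1 + ε)³ / r²`, which this square root makes equal to
  -- `1 - s`.
  set r : ℕ → ℂ := fun j => ((1 + ε j) ^ 3 / (1 - s j)) ^ (((2 : ℕ) : ℂ)⁻¹) with hrdef
  have hε1 : Tendsto (fun j => 1 + ε j) atTop (𝓝 1) := by simpa using hε.const_add 1
  have hs1 : Tendsto (fun j => 1 - s j) atTop (𝓝 1) := by simpa using hs.const_sub 1
  have hr1 : Tendsto r atTop (𝓝 1) := by
    have h1 : Tendsto (fun j => (1 + ε j) ^ 3 / (1 - s j)) atTop (𝓝 1) := by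
      have h := (hε1.pow 3).div hs1 one_ne_zero
      rw [one_pow, div_one] at h
      exact h
    have h2 := (continuousAt_cpow_const (b := (((2 : ℕ) : ℂ)⁻¹)) Complex.one_mem_slitPlane).tendsto.comp
      h1
    rwa [Complex.one_cpow] at h2
  have hrsq : ∀ j, r j ^ 2 = (1 + ε j) ^ 3 / (1 - s j) := fun j =>
    Complex.cpow_nat_inv_pow _ two_ne_zero
  have hr0 : ∀ᶠ j in atTop, r j ≠ 0 := hr1.eventually_ne one_ne_zero
  have hs10 : ∀ᶠ j in atTop, 1 - s j ≠ 0 := hs1.eventually_ne one_ne_zero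
  have hε10 : ∀ᶠ j in atTop, 1 + ε j ≠ 0 := hε1.eventually_ne one_ne_zero
  set τ : ℕ → Fin 4 → ℂ := fun j => ![a * r j, b * (1 + ε j) / r j, c * (1 + ε j) / r j,
    d * (1 + ε j) / r j] with hτ
  have hfin : ∀ x : ℂ, Tendsto (fun j => x * (1 + ε j) / r j) atTop (𝓝 x) := fun x => by
    have h := (hε1.const_mul x).div hr1 one_ne_zero
    rw [mul_one, div_one] at h
    exact h
  have hfin' : ∀ x : ℂ, Tendsto (fun j => x * (1 + ε j)) atTop (𝓝 x) := fun x => by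
    simpa using hε1.const_mul x
  have hfina : Tendsto (fun j => a * r j) atTop (𝓝 a) := by simpa using hr1.const_mul a
  set A := a * b * c * d * q ^ ((n : ℤ) - 1) with hAdef
  have hA' : Tendsto (fun j => A * (1 - s j)) atTop (𝓝 A) := by simpa using hs1.const_mul A
  refine mem_limits_of_eventually_mem ?_ τ ?_ ?_ (fun j => (s j)⁻¹ * (a * r j) ^ n) ?_
  · obtain ⟨h1, h2⟩ := coeff_awHigh hq hr hmn ha hA (a * b) (a * c) (a * d)
    obtain ⟨h3, -⟩ := natDegree_awLow hq hr hmn ha hA (a * b) (a * c) (a * d)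
    refine natDegree_eq_of_le_of_coeff_ne_zero (natDegree_add_le_of_degree_le h1
      ((natDegree_smul_le _ _).trans (h3.le.trans hmn.le))) ?_
    rwa [coeff_add, coeff_smul, coeff_eq_zero_of_natDegree_lt (h3.trans_lt hmn), smul_zero,
      add_zero]
  · filter_upwards [hr0] with j hj
    exact mul_ne_zero ha hj
  · intro i
    fin_cases i
    · exact tendsto_coe_coe_iff.2 hfina
    · exact tendsto_coe_coe_iff.2 (hfin b)
    · exact tendsto_coe_coe_iff.2 (hfin c)
    · exact tendsto_coe_coe_iff.2 (hfin d)
  · have key := (coeffTendsto_awHigh hfina hA' (hfin' (a * b)) (hfin' (a * c)) (hfin' (a * d))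
      q m n).add (CoeffTendsto.smul hlim
      (coeffTendsto_awLow hfina hA' (hfin' (a * b)) (hfin' (a * c)) (hfin' (a * d)) q m n))
    refine key.congr' ?_
    filter_upwards [hr0, hs0, hs10, hε10] with j hrj hsj hsj' hεj
    have e0 : τ j 0 = a * r j := rfl
    have e1 : τ j 0 * τ j 1 = a * b * (1 + ε j) := by
      change a * r j * (b * (1 + ε j) / r j) = _
      field_simp
    have e2 : τ j 0 * τ j 2 = a * c * (1 + ε j) := by
      change a * r j * (c * (1 + ε j) / r j) = _
      field_simp
    have e3 : τ j 0 * τ j 3 = a * d * (1 + ε j) := by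
      change a * r j * (d * (1 + ε j) / r j) = _
      field_simp
    have e4 : τ j 0 * τ j 1 * τ j 2 * τ j 3 * q ^ ((n : ℤ) - 1) = A * (1 - s j) := by
      have : τ j 0 * τ j 1 * τ j 2 * τ j 3 = a * b * c * d * ((1 + ε j) ^ 3 / r j ^ 2) := by
        change a * r j * (b * (1 + ε j) / r j) * (c * (1 + ε j) / r j) * (d * (1 + ε j) / r j) = _
        field_simp
      rw [this, hrsq, hAdef]
      field_simp
    -- The scalar of the upper part is exactly `s`; division by `s` leaves the lower part with a
    -- factor that tends to `γ`.
    have e5 : 1 - A * (1 - s j) * q ^ m = s j := by linear_combination (s j - 1) * hA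
    rw [askeyWilson_eq, awSum_split q hmn, e4, e1, e2, e3, e5, e0, smul_smul, zpow_neg, zpow_natCast,
      mul_assoc (s j)⁻¹, mul_inv_cancel₀ (pow_ne_zero n (mul_ne_zero ha hrj)), mul_one, smul_add, smul_smul,
      smul_smul, inv_mul_cancel₀ hsj, one_smul, add_comm, div_eq_inv_mul]

/-- A zero off-diagonal entry in some row `k` with `m ≤ k < n` is a zero of one of the three shifted
factorials in `awResonance`. -/
theorem exists_awResonance_eq_zero (hp : p ≠ 0) (hpq : p ^ 2 = q)
    (hr : ∀ k : ℕ, 1 ≤ k → q ^ k ≠ 1) {m n : ℕ} (hmn : m < n) {τ : Fin 4 → ℂ} (hτ : τ 0 ≠ 0)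
    (hev : (awScheme p).ev (form (fun _ => 1) τ) m = (awScheme p).ev (form (fun _ => 1) τ) n)
    {f : ℂ[X]} (hf : f.natDegree = n) (hf0 : f ≠ 0)
    (h : (awScheme p).op (form (fun _ => 1) τ) f = (awScheme p).ev (form (fun _ => 1) τ) n • f) :
    awResonance q m n (τ 0 * τ 1) (τ 0 * τ 2) (τ 0 * τ 3) = 0 := by
  have hpp := sub_inv_ne_zero hp hpq (by simpa using hr 1 le_rfl)
  have hq : q ≠ 0 := by rw [← hpq]; exact pow_ne_zero 2 hp
  have hfl : f.coeff n ≠ 0 := by rw [← hf]; exact leadingCoeff_ne_zero.2 hf0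
  obtain ⟨k, hk1, hk2, hk3⟩ := exists_offDiagonal_eq_zero (op_awBasis_zero p q τ)
    (op_awBasis_succ hp hpq hpp τ) (natDegree_awBasis hq hτ) (awBasis_ne_zero hq hτ) hmn hev
    hf.le hfl h
  have hpos : awConst p * (1 - q ^ (k + 1)) / (p * q ^ k) ≠ 0 :=
    div_ne_zero (mul_ne_zero (awConst_ne_zero hpp) (sub_ne_zero.2 (hr _ (by omega)).symm))
      (mul_ne_zero hp (pow_ne_zero k hq))
  rw [awOffDiagonal, neg_eq_zero, mul_eq_zero, or_iff_right hpos, mul_eq_zero, mul_eq_zero] at hk3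
  have hz : ∀ x : ℂ, 1 - x * q ^ k = 0 → qPoch (x * q ^ m) q (n - m) = 0 := fun x hx => by
    by_contra h0
    refine qPoch_ne_zero_iff.1 h0 (k - m) (by omega) ?_
    rw [mul_assoc, ← pow_add, show m + (k - m) = k by omega]
    exact (sub_eq_zero.1 hx).symm
  rw [awResonance]
  rcases hk3 with (h1 | h1) | h1 <;> simp [hz _ h1]

end


/-- The first-order coefficient is itself an eigenvector of degree at most one. -/
theorem LatticeData.slOp_self (L : LatticeData) {φ ψ : ℂ[X]} (hψ : ψ.natDegree ≤ 1) :
    L.slOp φ ψ ψ = L.eig φ ψ 1 • ψ := by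
  have h1 : L.dOp ψ = C (ψ.coeff 1) := by
    have hd : (L.dOp ψ).natDegree ≤ 0 := L.natDegree_dOp_le hψ
    have hc : (L.dOp ψ).coeff 0 = _ := L.coeff_dOp hψ
    rw [eq_C_of_natDegree_le_zero hd, hc]
    simp [leadPair]
  have h2 : L.sOp (C (ψ.coeff 1)) = C (ψ.coeff 1) := by
    have hd := L.natDegree_sOp_le (f := C (ψ.coeff 1)) (natDegree_C _).le
    have hc := L.coeff_sOp (f := C (ψ.coeff 1)) (natDegree_C _).le
    rw [eq_C_of_natDegree_le_zero hd, hc]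
    simp [leadPair]
  rw [slOp_apply, h1, h2, L.dOp_eq_zero (natDegree_C _).le, smul_eq_C_mul, eig]
  simp [leadPair, mul_comm]

theorem eq_coe_of_uCoord_ne_zero {t : OnePoint ℂ} (h : uCoord t ≠ 0) : ∃ a : ℂ, t = a := by
  induction t using OnePoint.rec with
  | infty => exact absurd rfl h
  | coe a => exact ⟨a, rfl⟩

theorem eq_infty_of_uCoord_eq_zero {t : OnePoint ℂ} (h : uCoord t = 0) : t = OnePoint.infty := by
  induction t using OnePoint.rec with
  | infty => rfl
  | coe a => simp at h

theorem eq_zero_of_vCoord_eq_zero {t : OnePoint ℂ} (h : vCoord t = 0) : t = ((0 : ℂ) : OnePoint ℂ) := by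
  induction t using OnePoint.rec with
  | infty => simp at h
  | coe a => rw [vCoord_coe] at h; rw [h]

/-! ### Askey–Wilson parameters among which both `0` and `∞` occur -/

section

variable {p q : ℂ}

theorem leadPair_awScheme_ne_zero (hp : p ≠ 0) (hpq : p ^ 2 = q) (hr : ∀ k : ℕ, 1 ≤ k → q ^ k ≠ 1)
    {n : ℕ} (hn : 1 ≤ n) : ((awScheme p).leadPair n).1 ≠ 0 := by
  have h := sub_inv_ne_zero hp hpq (by simpa using hr 1 le_rfl)
  rw [(leadPair_awScheme hp h n).1]
  refine div_ne_zero (fun h0 => hr n hn ?_) h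
  rw [← hpq, ← pow_mul, mul_comm, pow_mul, sq]
  nth_rewrite 2 [sub_eq_zero.1 h0]
  rw [inv_pow, mul_inv_cancel₀ (pow_ne_zero n hp)]

/-- Without outer coefficients, `Φ` has degree at most one and `Ψ` is constant, so the operator
lowers degrees, and its next diagonal decides which degrees its kernel can have. -/
theorem coeff_op_awScheme (hp : p ≠ 0) (hpq : p ^ 2 = q) (h : p - p⁻¹ ≠ 0) {F f : ℂ[X]} {m : ℕ}
    (h0 : F.coeff 0 = 0) (h4 : F.coeff 4 = 0) (hf : f.natDegree ≤ m + 1) :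
    ((awScheme p).op F f).coeff m = awConst p * ((1 - q ^ (m + 1)) *
      (-(F.coeff 1) / 2 - -(F.coeff 3) / 2 * q ^ m) / (p * q ^ m)) * f.coeff (m + 1) := by
  obtain ⟨c2, c1, -, d1, d0⟩ := coeff_awScheme p F
  rw [h0, h4, add_zero, mul_zero] at c2
  rw [h0, h4, sub_zero, mul_zero, mul_zero] at d1
  have hΦ : ((awScheme p).Φ F).natDegree ≤ 0 + 1 := by
    refine natDegree_le_iff_coeff_eq_zero.2 fun k hk => ?_
    rcases (Nat.succ_le_of_lt hk).eq_or_lt with rfl | hk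
    · exact c2
    · exact coeff_eq_zero_of_natDegree_lt (((awScheme p).natDegree_Φ F).trans_lt hk)
  have hΨ : ((awScheme p).Ψ F).natDegree ≤ 0 := by
    refine natDegree_le_iff_coeff_eq_zero.2 fun k hk => ?_
    rcases (Nat.succ_le_of_lt hk).eq_or_lt with rfl | hk
    · exact d1
    · exact coeff_eq_zero_of_natDegree_lt (((awScheme p).natDegree_Ψ F).trans_lt hk)
  have := ((awScheme p).slOp_degree hΦ hΨ hf).2
  rw [zero_add, zero_add, c1, d0] at this
  rw [Scheme.op, this, ← lead_bracket hp hpq h]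
  ring

theorem ev_awScheme_eq_zero (hp : p ≠ 0) (hpq : p ^ 2 = q) (h : p - p⁻¹ ≠ 0) {F : ℂ[X]}
    (h0 : F.coeff 0 = 0) (h4 : F.coeff 4 = 0) (n : ℕ) : (awScheme p).ev F n = 0 := by
  rw [ev_awScheme hp hpq h, h0, h4]
  ring

theorem coeff_one_eq_of_eigenvector (hp : p ≠ 0) (hpq : p ^ 2 = q)
    (hr : ∀ k : ℕ, 1 ≤ k → q ^ k ≠ 1) {F f : ℂ[X]} {m : ℕ}
    (h0 : F.coeff 0 = 0) (h4 : F.coeff 4 = 0) (hf : f.natDegree = m + 1)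
    (hop : (awScheme p).op F f = 0) : F.coeff 1 = F.coeff 3 * q ^ m := by
  have h := sub_inv_ne_zero hp hpq (by simpa using hr 1 le_rfl)
  have hq : q ≠ 0 := by rw [← hpq]; exact pow_ne_zero 2 hp
  have hc := coeff_op_awScheme hp hpq h h0 h4 hf.le
  have hl : f.coeff (m + 1) ≠ 0 := by
    rw [← hf, coeff_natDegree, leadingCoeff_ne_zero]
    rintro rfl
    simp at hf
  rw [hop, coeff_zero, eq_comm, mul_eq_zero, or_iff_left hl, mul_eq_zero,
    or_iff_right (awConst_ne_zero h), div_eq_zero_iff,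
    or_iff_left (mul_ne_zero hp (pow_ne_zero m hq)), mul_eq_zero,
    or_iff_right (sub_ne_zero.2 (hr (m + 1) (by omega)).symm)] at hc
  linear_combination -2 * hc

/-- Each of the `k` factors takes one `y`, so that an unbounded `x` is compensated. -/
theorem tendsto_qPoch_scaled {x y : ℕ → ℂ} {ξ : ℂ} (hxy : Tendsto (fun j => x j * y j) atTop (𝓝 ξ))
    (hy : Tendsto y atTop (𝓝 0)) (q : ℂ) (k : ℕ) :
    Tendsto (fun j => qPoch (x j) q k * y j ^ k) atTop (𝓝 (∏ i ∈ range k, (0 - ξ * q ^ i))) := by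
  have h : ∀ j, qPoch (x j) q k * y j ^ k = ∏ i ∈ range k, (y j - x j * y j * q ^ i) := fun j => by
    rw [qPoch, ← card_range k, ← prod_const, card_range, ← prod_mul_distrib]
    exact prod_congr rfl fun i _ => by ring
  simp only [h]
  exact tendsto_finsetProd _ fun i _ => hy.sub (hxy.mul_const _)

/-- Parameters `a, b, 0, ∞` with `a b q ^ (n - 1) = 1`. -/
theorem awBasis_add_mem_limits (hp : p ≠ 0) (hpq : p ^ 2 = q) (hr : ∀ k : ℕ, 1 ≤ k → q ^ k ≠ 1)
    {m : ℕ} {a b : ℂ} (hab : a * b * q ^ m = 1) {t : Fin 4 → OnePoint ℂ}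
    {σ : Equiv.Perm (Fin 4)}
    (ht : ∀ i, t (σ i) = ![(a : OnePoint ℂ), b, (0 : ℂ), OnePoint.infty] i) :
    ∃ ρ : ℂ, ρ ≠ 0 ∧ ∀ γ : ℂ, ρ • awBasis q a (m + 1) + γ • (1 : ℂ[X]) ∈
      limits (askeyWilson q (m + 1)) {τ | τ 0 ≠ 0} (m + 1) t := by
  have hq : q ≠ 0 := by rw [← hpq]; exact pow_ne_zero 2 hp
  have ha : a ≠ 0 := by rintro rfl; simp at hab
  have hb : b ≠ 0 := by rintro rfl; simp at hab
  set n := m + 1 with hn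
  -- The coefficient of the constant basis element will tend to `g * Θ`; hence `g = γ / Θ` below.
  set Θ : ℂ := qPoch (a * b) q m * ∏ i ∈ range n, (0 - a * q ^ i) with hΘ
  have hΘ0 : Θ ≠ 0 := by
    refine mul_ne_zero (qPoch_ne_zero_iff.2 fun j hj h => ?_) (prod_ne_zero_iff.2 fun i _ => ?_)
    · have := pow_injective_of_not_root hq hr
        (mul_left_cancel₀ (left_ne_zero_of_mul_eq_one hab) (h.trans hab.symm))
      omega
    · rw [zero_sub]; exact neg_ne_zero.2 (mul_ne_zero ha (pow_ne_zero i hq))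
  set ρ : ℂ := qPoch (q ^ (-(n : ℤ))) q n * (∏ i ∈ range n, (0 - 1 * q ^ i)) / qPoch q q n * q ^ n
    with hρ
  have hρ0 : ρ ≠ 0 := by
    refine mul_ne_zero (div_ne_zero (mul_ne_zero (qPoch_neg_ne_zero hq hr le_rfl)
      (prod_ne_zero_iff.2 fun i _ => ?_)) (qPoch_self_ne_zero hr n)) (pow_ne_zero n hq)
    rw [zero_sub, one_mul]; exact neg_ne_zero.2 (pow_ne_zero i hq)
  refine ⟨ρ, hρ0, fun γ => ?_⟩
  set g : ℂ := γ / Θ with hg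
  set N : ℕ → ℂ := fun j => (j : ℂ) + 1 with hN
  set w : ℕ → ℂ := fun j => 1 / ((j : ℂ) + 1) with hw
  have hN0 : ∀ j, N j ≠ 0 := fun j => Nat.cast_add_one_ne_zero j
  have hNw : ∀ j, N j * w j = 1 := fun j => mul_one_div_cancel (hN0 j)
  have hw0 : ∀ j, w j ≠ 0 := fun j => right_ne_zero_of_mul_eq_one (hNw j)
  have hwt : Tendsto w atTop (𝓝 0) := tendsto_one_div_add_atTop_nhds_zero_nat
  have hgt : Tendsto (fun j => 1 - g * w j ^ n) atTop (𝓝 1) := by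
    have := ((hwt.pow n).const_mul g).const_sub 1
    rwa [zero_pow (by omega), mul_zero, sub_zero] at this
  have hbt : Tendsto (fun j => b * (1 - g * w j ^ n)) atTop (𝓝 b) := by
    simpa using hgt.const_mul b
  -- With `w = 1 / N`, both `abcd` and `d = N²` are unbounded, of orders `N` and `N²`, while `1 - ab
  -- q^(n-1)` has order `w ^ n`. After multiplication by `w ^ n` the coefficient `k < n` has order
  -- `w ^ k`, so only `k = 0` and `k = n` survive.
  set τ : ℕ → Fin 4 → ℂ := fun j => ![a, b * (1 - g * w j ^ n), w j, N j ^ 2] with hτ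
  have hA : ∀ j, a * (b * (1 - g * w j ^ n)) * w j * N j ^ 2 * q ^ ((n : ℤ) - 1) =
      N j * (1 - g * w j ^ n) := fun j => by
    have e : (n : ℤ) - 1 = (m : ℕ) := by omega
    rw [e, zpow_natCast]
    linear_combination (N j * w j) * N j * (1 - g * w j ^ n) * hab + N j * (1 - g * w j ^ n) * hNw j
  have hAt : Tendsto (fun j => N j * (1 - g * w j ^ n) * w j) atTop (𝓝 1) :=
    hgt.congr fun j => by linear_combination (-(1 - g * w j ^ n)) * hNw j
  have hop : ∀ j, (awScheme p).op (form (fun _ => 1) (τ j)) (∑ k ∈ range (n + 1),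
      awCoeff q n a (b * (1 - g * w j ^ n)) (w j) (N j ^ 2) k • awBasis q a k) = _ := fun j =>
    op_awSum hp hpq hr (τ j) n
  refine (isFamily_askeyWilson hp hpq hr n).mem_limits_perm σ (τ := τ)
    (f := fun j => w j ^ n • ∑ k ∈ range (n + 1),
      awCoeff q n a (b * (1 - g * w j ^ n)) (w j) (N j ^ 2) k • awBasis q a k) ?_ ?_ ?_ ?_ ?_ ?_
  · suffices ∀ᶠ j in atTop, ∀ i, τ j i ≠ 0 from this.mono fun j h => h (σ.symm 0)
    filter_upwards [hgt.eventually_ne one_ne_zero] with j hj i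
    fin_cases i
    · exact ha
    · exact mul_ne_zero hb hj
    · exact hw0 j
    · exact pow_ne_zero 2 (hN0 j)
  · intro i
    rw [ht]
    fin_cases i
    · exact tendsto_const_nhds
    · exact tendsto_coe_coe_iff.2 hbt
    · exact tendsto_coe_coe_iff.2 hwt
    · refine tendsto_coe_infty_iff.2 ?_
      have h2 : Tendsto (fun j => w j ^ 2) atTop (𝓝[≠] 0) :=
        tendsto_nhdsWithin_iff.2 ⟨by simpa using hwt.pow 2,
          Eventually.of_forall fun j => pow_ne_zero 2 (hw0 j)⟩
      refine (tendsto_inv₀_nhdsNE_zero.comp h2).congr fun j => ?_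
      change (w j ^ 2)⁻¹ = N j ^ 2
      rw [inv_eq_iff_eq_inv, ← inv_pow, eq_inv_of_mul_eq_one_right (hNw j)]
  -- A coincidence would bound `abcd`, which grows like `N`.
  · have hs : ∀ k ∈ range n, ∀ᶠ j in atTop, q ≠ N j * (1 - g * w j ^ n) * q * q ^ k := by
      intro k _
      have h1 := ((hAt.mul_const (q * q ^ k)).sub (hwt.const_mul q)).eventually_ne
        (show 1 * (q * q ^ k) - q * 0 ≠ 0 by
          rw [mul_zero, sub_zero, one_mul]; exact mul_ne_zero hq (pow_ne_zero k hq))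
      filter_upwards [h1] with j hj h
      apply hj
      linear_combination -w j * h
    filter_upwards [(Finset.eventually_all (range n)).2 hs] with j hj
    refine (simple_awScheme_iff hp hpq hr _ n).2 fun k hk => ?_
    obtain ⟨f0, -, -, -, f4⟩ := form_four (fun _ => 1) (τ j)
    rw [f0, f4]
    have h1 := hj k (mem_range.2 hk)
    have h2 : τ j 0 * τ j 1 * τ j 2 * τ j 3 * q ^ (k + n) =
        N j * (1 - g * w j ^ n) * q * q ^ k := by
      rw [← hA j, zpow_sub_one₀ hq, zpow_natCast, pow_add]
      change a * (b * (1 - g * w j ^ n)) * w j * N j ^ 2 * (q ^ k * q ^ n) = _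
      field_simp
    rw [h2]
    simpa using h1
  · have h1 : (γ • (1 : ℂ[X])).natDegree ≤ 0 := (natDegree_smul_le _ _).trans (by simp)
    refine natDegree_eq_of_le_of_coeff_ne_zero (natDegree_add_le_of_degree_le
      ((natDegree_smul_le _ _).trans (natDegree_awBasis_le q a n)) (h1.trans (by omega))) ?_
    rw [coeff_add, coeff_smul, coeff_eq_zero_of_natDegree_lt (h1.trans_lt (by omega)), add_zero]
    exact mul_ne_zero hρ0 (coeff_awBasis_ne_zero hq ha n)
  · have hlimit : ρ • awBasis q a n + γ • (1 : ℂ[X]) = ∑ k ∈ range (n + 1),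
        (if k = n then ρ else if k = 0 then γ else 0) • awBasis q a k := by
      rw [sum_range_succ, if_pos rfl, add_comm, sum_eq_single_of_mem 0 (mem_range.2 (by omega))]
      · rw [if_neg (by omega), if_pos rfl, show awBasis q a 0 = 1 by simp [awBasis]]
      · intro k hk hk0
        rw [if_neg (mem_range.1 hk).ne, if_neg hk0, zero_smul]
    rw [hlimit]
    simp only [smul_sum, smul_smul]
    refine CoeffTendsto.sum _ fun k hk => CoeffTendsto.smul ?_ (CoeffTendsto.const _)
    have hk := mem_range.1 hk
    by_cases hkn : k = n
    · rw [hkn, if_pos rfl]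
      have h1 := (((tendsto_qPoch_scaled hAt hwt q n).const_mul (qPoch (q ^ (-(n : ℤ))) q n)).div_const
        (qPoch q q n)).mul_const (q ^ n)
      refine h1.congr fun j => ?_
      have h3 : ∀ x : ℂ, qPoch x q 0 = 1 := fun x => rfl
      rw [awCoeff, hA, Nat.sub_self, h3, h3, h3]
      ring
    · rw [if_neg hkn]
      have hkm : k ≤ m := by omega
      have hwd : Tendsto (fun j => a * N j ^ 2 * q ^ k * w j ^ 2) atTop (𝓝 (a * q ^ k)) :=
        tendsto_const_nhds.congr fun j => by
          linear_combination (-a * q ^ k * (N j * w j + 1)) * hNw j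
      have hw2 : Tendsto (fun j => w j ^ 2) atTop (𝓝 0) := by simpa using hwt.pow 2
      have key := ((((((tendsto_qPoch_scaled hAt hwt q k).const_mul
        (qPoch (q ^ (-(n : ℤ))) q k / qPoch q q k * q ^ k)).mul
        (tendsto_qPoch ((hbt.const_mul a).mul_const (q ^ k)) q (m - k))).mul_const g).mul
        (tendsto_qPoch ((hwt.const_mul a).mul_const (q ^ k)) q (n - k))).mul
        (tendsto_qPoch_scaled hwd hw2 q (n - k))).mul (hwt.pow k)
      have hlim : qPoch (q ^ (-(n : ℤ))) q k / qPoch q q k * q ^ k *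
          (∏ i ∈ range k, (0 - 1 * q ^ i)) * qPoch (a * b * q ^ k) q (m - k) * g *
          qPoch (a * 0 * q ^ k) q (n - k) * (∏ i ∈ range (n - k), (0 - a * q ^ k * q ^ i)) * 0 ^ k =
          if k = 0 then γ else 0 := by
        split_ifs with h0
        · subst h0
          have h3 : ∀ x : ℂ, qPoch x q 0 = 1 := fun x => rfl
          have h4 : ∀ l, qPoch 0 q l = 1 := fun l => prod_eq_one fun _ _ => by ring
          simp only [h3, pow_zero, mul_one, range_zero, prod_empty, Nat.sub_zero, mul_zero, h4,
            div_one, one_mul]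
          rw [hg, mul_right_comm, ← hΘ, mul_div_cancel₀ _ hΘ0]
        · rw [zero_pow h0, mul_zero]
      rw [hlim] at key
      refine key.congr fun j => ?_
      -- The last factor is the one that vanishes in the limit; it equals `g * w ^ n` because `a b q
      -- ^ m = 1`.
      have e1 : qPoch (a * (b * (1 - g * w j ^ n)) * q ^ k) q (n - k) =
          qPoch (a * (b * (1 - g * w j ^ n)) * q ^ k) q (m - k) * (g * w j ^ n) := by
        rw [show n - k = m - k + 1 by omega, qPoch_succ, mul_assoc _ (q ^ k), ← pow_add,
          show k + (m - k) = m by omega]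
        congr 1
        linear_combination (g * w j ^ n - 1) * hab
      have e2 : w j ^ n * w j ^ n = w j ^ k * (w j ^ 2) ^ (n - k) * w j ^ k := by
        rw [← pow_mul, ← pow_add, ← pow_add, ← pow_add]
        congr 1
        omega
      rw [awCoeff, hA, e1]
      linear_combination (-(qPoch (q ^ (-(n : ℤ))) q k / qPoch q q k * q ^ k *
        qPoch (N j * (1 - g * w j ^ n)) q k * qPoch (a * (b * (1 - g * w j ^ n)) * q ^ k) q (m - k) *
        g * qPoch (a * w j * q ^ k) q (n - k) * qPoch (a * N j ^ 2 * q ^ k) q (n - k))) * e2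
  · refine Eventually.of_forall fun j => ⟨(natDegree_smul_le _ _).trans
      (natDegree_sum_smul_le (natDegree_awBasis_le q a) _ n), ?_⟩
    rw [map_smul, hop, smul_comm]
    rfl

/-- Parameters `0, ∞, 0, ∞` in degree one. -/
theorem mem_limits_awScheme_one (hp : p ≠ 0) (hpq : p ^ 2 = q) (hr : ∀ k : ℕ, 1 ≤ k → q ^ k ≠ 1)
    {t : Fin 4 → OnePoint ℂ} {σ : Equiv.Perm (Fin 4)}
    (ht : ∀ i, t (σ i) = ![((0 : ℂ) : OnePoint ℂ), OnePoint.infty, (0 : ℂ), OnePoint.infty] i)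
    {Q : ℂ[X]} (hQ : Q.natDegree = 1) :
    Q ∈ limits (askeyWilson q 1) {τ | τ 0 ≠ 0} 1 t := by
  have hq : q ≠ 0 := by rw [← hpq]; exact pow_ne_zero 2 hp
  have hpp := sub_inv_ne_zero hp hpq (by simpa using hr 1 le_rfl)
  have hQ1 : Q.coeff 1 ≠ 0 := by
    rw [← hQ, coeff_natDegree, leadingCoeff_ne_zero]
    rintro rfl
    simp at hQ
  -- Chosen so that `Q` is a multiple of `-2 X + s`.
  set s : ℂ := -2 * Q.coeff 0 / Q.coeff 1 with hs
  set N : ℕ → ℂ := fun j => (j : ℂ) + 1 with hN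
  set w : ℕ → ℂ := fun j => 1 / ((j : ℂ) + 1) with hw
  have hN0 : ∀ j, N j ≠ 0 := fun j => Nat.cast_add_one_ne_zero j
  have hNw : ∀ j, N j * w j = 1 := fun j => mul_one_div_cancel (hN0 j)
  have hw0 : ∀ j, w j ≠ 0 := fun j => right_ne_zero_of_mul_eq_one (hNw j)
  have hwt : Tendsto w atTop (𝓝 0) := tendsto_one_div_add_atTop_nhds_zero_nat
  have hNt : Tendsto N atTop (Bornology.cobounded ℂ) := by
    have h2 : Tendsto w atTop (𝓝[≠] 0) :=
      tendsto_nhdsWithin_iff.2 ⟨hwt, Eventually.of_forall hw0⟩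
    refine (tendsto_inv₀_nhdsNE_zero.comp h2).congr fun j => ?_
    exact (eq_inv_of_mul_eq_one_left (hNw j)).symm
  have hNs : Tendsto (fun j => -N j + s) atTop (Bornology.cobounded ℂ) := by
    rw [← tendsto_norm_atTop_iff_cobounded] at hNt ⊢
    refine tendsto_atTop_mono (fun j => ?_) (tendsto_atTop_add_const_right _ (-‖s‖) hNt)
    have := norm_sub_norm_le (N j) s
    rw [neg_add_eq_sub, norm_sub_rev]
    linarith
  -- The two large parameters have sum `s`, and the cubes `w³` are small enough to make the third
  -- and fourth symmetric functions vanish in the limit. Thus `Ψ`, an eigenvector by `slOp_self`,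
  -- tends to a multiple of `-2 X + s`.
  set τ : ℕ → Fin 4 → ℂ := fun j => ![w j ^ 3, N j, w j ^ 3, -N j + s] with hτ
  have hw3 : Tendsto (fun j => w j ^ 3) atTop (𝓝 0) := by simpa using hwt.pow 3
  have c0 : ∀ j, (form (fun _ => 1) (τ j)).coeff 0 = 1 := fun j => by
    rw [(form_four _ _).1]; norm_num
  have c1 : ∀ j, (form (fun _ => 1) (τ j)).coeff 1 = 2 * w j ^ 3 + s := fun j => by
    rw [(form_four _ _).2.1]
    change w j ^ 3 * 1 * 1 * 1 + 1 * N j * 1 * 1 + 1 * 1 * w j ^ 3 * 1 + 1 * 1 * 1 * (-N j + s) = _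
    ring
  have c3 : ∀ j, (form (fun _ => 1) (τ j)).coeff 3 = 2 * (-w j + s * w j ^ 2) + s * w j ^ 6 :=
    fun j => by
      rw [(form_four _ _).2.2.2.1]
      change 1 * N j * w j ^ 3 * (-N j + s) + w j ^ 3 * 1 * w j ^ 3 * (-N j + s) +
        w j ^ 3 * N j * 1 * (-N j + s) + w j ^ 3 * N j * w j ^ 3 * 1 = _
      linear_combination (2 * w j ^ 2 * s - 2 * w j * (N j * w j + 1)) * hNw j
  have c4 : ∀ j, (form (fun _ => 1) (τ j)).coeff 4 = w j ^ 3 * (-w j + s * w j ^ 2) := fun j => by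
    rw [(form_four _ _).2.2.2.2]
    change w j ^ 3 * N j * w j ^ 3 * (-N j + s) = _
    linear_combination (w j ^ 5 * s - w j ^ 4 * (N j * w j + 1)) * hNw j
  have hcont : ∀ {g : ℂ → ℂ}, Continuous g → Tendsto (fun j => g (w j)) atTop (𝓝 (g 0)) :=
    fun hg => (hg.tendsto 0).comp hwt
  have l4 : Tendsto (fun j => (form (fun _ => 1) (τ j)).coeff 4) atTop (𝓝 0) := by
    simp only [c4]
    have := hcont (g := fun x => x ^ 3 * (-x + s * x ^ 2)) (by fun_prop)
    simpa using this
  have l13 : Tendsto (fun j => (form (fun _ => 1) (τ j)).coeff 1 -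
      (form (fun _ => 1) (τ j)).coeff 3) atTop (𝓝 s) := by
    simp only [c1, c3]
    have := hcont (g := fun x => 2 * x ^ 3 + s - (2 * (-x + s * x ^ 2) + s * x ^ 6)) (by fun_prop)
    simpa using this
  refine (isFamily_askeyWilson hp hpq hr 1).mem_limits_perm σ (τ := τ)
    (f := fun j => (-(Q.coeff 1) / 2 * ((p - p⁻¹) / 2)) •
      (awScheme p).Ψ (form (fun _ => 1) (τ j))) ?_ ?_ ?_ hQ ?_ ?_
  · suffices ∀ᶠ j in atTop, ∀ i, τ j i ≠ 0 from this.mono fun j h => h (σ.symm 0)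
    filter_upwards [hNs.eventually_ne_cobounded 0] with j hj i
    fin_cases i
    · exact pow_ne_zero 3 (hw0 j)
    · exact hN0 j
    · exact pow_ne_zero 3 (hw0 j)
    · exact hj
  · intro i
    rw [ht]
    fin_cases i
    · exact tendsto_coe_coe_iff.2 hw3
    · exact tendsto_coe_infty_iff.2 hNt
    · exact tendsto_coe_coe_iff.2 hw3
    · exact tendsto_coe_infty_iff.2 hNs
  · filter_upwards [l4.eventually_ne zero_ne_one] with j hj
    refine (simple_awScheme_iff hp hpq hr _ 1).2 fun k hk h => hj ?_
    have hk0 : k = 0 := by omega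
    rw [hk0, zero_add, pow_one, c0] at h
    exact (mul_right_cancel₀ hq h).symm
  · have hQe : Q = (-(Q.coeff 1) / 2 * ((p - p⁻¹) / 2)) • (2 / (p - p⁻¹)) •
        ((2 * (0 - 1 : ℂ)) • (X : ℂ[X]) + s • (1 : ℂ[X])) := by
      conv_lhs => rw [eq_X_add_C_of_natDegree_le_one hQ.le]
      rw [smul_smul, show -(Q.coeff 1) / 2 * ((p - p⁻¹) / 2) * (2 / (p - p⁻¹)) = -(Q.coeff 1) / 2 by
        generalize p - p⁻¹ = r at hpp
        field_simp, smul_add, smul_smul, smul_smul, smul_eq_C_mul, smul_eq_C_mul, mul_one]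
      congr 2
      · congr 1; ring
      · rw [hs]; field_simp
    simp only [awScheme_Ψ, c0]
    have key := CoeffTendsto.smul
      (tendsto_const_nhds (x := -(Q.coeff 1) / 2 * ((p - p⁻¹) / 2)) (f := atTop (α := ℕ)))
      (CoeffTendsto.smul (tendsto_const_nhds (x := 2 / (p - p⁻¹)))
      (CoeffTendsto.add (CoeffTendsto.smul ((l4.sub_const 1).const_mul 2) (CoeffTendsto.const X))
        (CoeffTendsto.smul l13 (CoeffTendsto.const 1))))
    rwa [← hQe] at key
  · refine Eventually.of_forall fun j => ⟨(natDegree_smul_le _ _).trans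
      ((awScheme p).natDegree_Ψ _), ?_⟩
    rw [map_smul, Scheme.op, LatticeData.slOp_self _ ((awScheme p).natDegree_Ψ _), smul_comm]
    rfl

end


/-! ### From standard lattices to general lattices -/

/-- Equations up to a constant are nonzero binary quartic forms up to a constant, and these are
quadruples of points of the sphere. -/
theorem Scheme.correspondence (L : Scheme) {x x₀ : ℂ → ℂ} {m e : ℂ} (hm : m ≠ 0)
    (hx : ∀ s, x s = m * x₀ s + e)
    (h : ∀ s, x₀ (s + 1 / 2) + x₀ (s - 1 / 2) = 2 * (L.α * x₀ s + L.β))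
    (h' : ∀ s, (x₀ (s + 1 / 2) - x₀ (s - 1 / 2)) ^ 2 = 4 * L.U.eval (x₀ s))
    (hinf : (x₀ '' {s | x₀ (s + 1) ≠ x₀ s ∧ x₀ s ≠ x₀ (s - 1) ∧
      x₀ (s + 1 / 2) ≠ x₀ (s - 1 / 2)}).Infinite)
    (hinj : ∀ F : ℂ[X], F.natDegree ≤ 4 → L.Φ F = 0 → L.Ψ F = 0 → F = 0)
    (hsurj : ∀ φ ψ : ℂ[X], φ.natDegree ≤ 2 → ψ.natDegree ≤ 1 →
      ∃ F : ℂ[X], F.natDegree ≤ 4 ∧ L.Φ F = φ ∧ L.Ψ F = ψ)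
    {p : ℕ → ℂ → ℂ → ℂ → ℂ → ℂ[X]} (hp : ∀ n a b c d, (p n a b c d).natDegree ≤ n)
    {D : Set (Fin 4 → ℂ)} {R : (Fin 4 → OnePoint ℂ) → Prop}
    (hR : ∀ t, (L.Ψ (sphereForm t)).coeff 1 ≠ 0 ↔ R t)
    (heq : ∀ t n, 1 ≤ n →
      L.eigenvectors (L.Φ (sphereForm t)) (L.Ψ (sphereForm t)) n ⊆ limits (p n) D n t)
    (hfam : ∀ n, L.IsFamily (p n) D n) :
    (∀ φ ψ : ℂ[X], Coefficients φ ψ → ∃ t : Fin 4 → OnePoint ℂ, (ψ.natDegree = 1 ↔ R t) ∧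
      ∀ n : ℕ, 1 ≤ n → solutions x φ ψ n =
        limits (fun a b c d => (p n a b c d).comp (C (1 / m) * (X - C e))) D n t) ∧
    (∀ t : Fin 4 → OnePoint ℂ, ∃ φ ψ : ℂ[X], Coefficients φ ψ ∧ (ψ.natDegree = 1 ↔ R t) ∧
      ∀ n : ℕ, 1 ≤ n → solutions x φ ψ n =
        limits (fun a b c d => (p n a b c d).comp (C (1 / m) * (X - C e))) D n t) := by
  refine correspondence_of_standard L.toLatticeData hm hx h h' hinf hp
    (Φ := fun t => L.Φ (sphereForm t)) (Ψ := fun t => L.Ψ (sphereForm t))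
    (fun t => ⟨L.natDegree_Φ _, L.natDegree_Ψ _, fun h0 =>
      sphereForm_ne_zero t (hinj _ (natDegree_form_le _ _) h0.1 h0.2)⟩) (fun t => ?_) ?_
    (fun t n hn => (heq t n hn).antisymm ((hfam n).limits_subset t))
  · rw [← hR]
    refine ⟨fun h1 => ?_, natDegree_eq_of_le_of_coeff_ne_zero (L.natDegree_Ψ _)⟩
    rw [← h1, coeff_natDegree, leadingCoeff_ne_zero]
    intro h0
    rw [h0, natDegree_zero] at h1
    exact zero_ne_one h1
  · rintro φ ψ ⟨h1, h2, h3⟩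
    obtain ⟨F, hF, rfl, rfl⟩ := hsurj φ ψ h1 h2
    have hF0 : F ≠ 0 := by
      rintro rfl
      exact h3 ⟨map_zero _, map_zero _⟩
    obtain ⟨t, k, hk, rfl⟩ := exists_eq_sphereForm 4 hF0 hF
    refine ⟨t, k, hk, ?_, ?_⟩ <;> rw [← smul_eq_C_mul, map_smul, smul_eq_C_mul]

theorem limits_comp_eq_multiples_comp {p : ℂ → ℂ → ℂ → ℂ → ℂ[X]} {D : Set (Fin 4 → ℂ)} {n : ℕ}
    {t : Fin 4 → OnePoint ℂ} {m : ℂ} (hm : m ≠ 0) (e : ℂ)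
    (hp : ∀ a b c d, (p a b c d).natDegree ≤ n) {Q : ℂ[X]} (h : limits p D n t = multiples Q) :
    limits (fun a b c d => (p a b c d).comp (C (1 / m) * (X - C e))) D n t =
      multiples (Q.comp (C (1 / m) * (X - C e))) := by
  ext P
  rw [mem_limits_comp hm e hp, mem_multiples_comp hm, h]

/-- With nonzero entries in `leadPair`, each difference lowers a positive degree by exactly one. -/
theorem LatticeData.natDegree_eq_one_of_dOp_dOp_eq_zero (L : LatticeData)
    (h : ∀ n, 1 ≤ n → (L.leadPair n).1 ≠ 0) {f : ℂ[X]} (hf : 1 ≤ f.natDegree)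
    (hD : L.dOp (L.dOp f) = 0) : f.natDegree = 1 := by
  by_contra hne
  obtain ⟨n, hn⟩ := Nat.exists_eq_add_of_le' (show 2 ≤ f.natDegree by omega)
  have h1 : (L.dOp f).natDegree ≤ n + 1 := L.natDegree_dOp_le hn.le
  have c1 : (L.dOp f).coeff (n + 1) = (L.leadPair (n + 2)).1 * f.coeff (n + 2) :=
    L.coeff_dOp hn.le
  have c2 := L.coeff_dOp h1
  rw [hD, coeff_zero, c1, ← hn, coeff_natDegree, zero_eq_mul, mul_eq_zero, leadingCoeff_eq_zero] at c2
  rcases c2 with c2 | c2 | c2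
  · exact h _ (by omega) c2
  · exact h _ (by omega) c2
  · rw [c2, natDegree_zero] at hf
    omega

theorem exists_coeff_eq (g₀ g₁ g₂ g₃ g₄ : ℂ) : ∃ F : ℂ[X], F.natDegree ≤ 4 ∧ F.coeff 0 = g₀ ∧
    F.coeff 1 = g₁ ∧ F.coeff 2 = g₂ ∧ F.coeff 3 = g₃ ∧ F.coeff 4 = g₄ := by
  refine ⟨∑ i : Fin 5, C (![g₀, g₁, g₂, g₃, g₄] i) * X ^ (i : ℕ),
    natDegree_sum_le_of_forall_le _ _ fun i _ => (natDegree_C_mul_X_pow_le _ _).trans (by omega),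
    ?_⟩
  simp [Fin.sum_univ_five]

theorem ext_of_natDegree_le_two {f g : ℂ[X]} (hf : f.natDegree ≤ 2) (hg : g.natDegree ≤ 2)
    (h0 : f.coeff 0 = g.coeff 0) (h1 : f.coeff 1 = g.coeff 1) (h2 : f.coeff 2 = g.coeff 2) :
    f = g := by
  ext k
  by_cases hk : k ≤ 2
  · interval_cases k
    · exact h0
    · exact h1
    · exact h2
  · rw [coeff_eq_zero_of_natDegree_lt (hf.trans_lt (by omega)),
      coeff_eq_zero_of_natDegree_lt (hg.trans_lt (by omega))]

theorem sphereForm_of_zero_infty {t : Fin 4 → OnePoint ℂ} {σ : Equiv.Perm (Fin 4)}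
    (h2 : t (σ 2) = ((0 : ℂ) : OnePoint ℂ)) (h3 : t (σ 3) = OnePoint.infty) :
    (sphereForm t).coeff 0 = 0 ∧
    (sphereForm t).coeff 1 = uCoord (t (σ 0)) * uCoord (t (σ 1)) ∧
    (sphereForm t).coeff 3 = vCoord (t (σ 0)) * vCoord (t (σ 1)) ∧
    (sphereForm t).coeff 4 = 0 := by
  obtain ⟨f0, f1, -, f3, f4⟩ := form_four (fun i => uCoord (t (σ i))) fun i => vCoord (t (σ i))
  rw [← sphereForm_comp_perm σ]
  change (form _ _).coeff 0 = _ ∧ (form _ _).coeff 1 = _ ∧ (form _ _).coeff 3 = _ ∧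
    (form _ _).coeff 4 = _
  rw [f0, f1, f3, f4, h2, h3]
  simp

theorem exists_coe_of_uCoord_ne_zero {t : Fin 4 → OnePoint ℂ} (h : ∀ i, uCoord (t i) ≠ 0) :
    ∃ τ : Fin 4 → ℂ, t = fun i => (τ i : OnePoint ℂ) := by
  choose τ hτ using fun i => eq_coe_of_uCoord_ne_zero (h i)
  exact ⟨τ, funext hτ⟩

theorem coe_vec_four (a b c d : ℂ) :
    (fun i => ((![a, b, c, d] i : ℂ) : OnePoint ℂ)) = ![(a : OnePoint ℂ), b, c, d] := by
  funext i
  fin_cases i <;> rfl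

/-! ### Completeness of the Askey–Wilson family -/

section

variable {p q : ℂ}

/-- An eigenvector of degree `n` forces the resonance factor to vanish. Only the degree `m` shares
the eigenvalue, so the upper and the lower part of the split sum span all solutions. -/
theorem eigenvectors_subset_of_resonance (hp : p ≠ 0) (hpq : p ^ 2 = q)
    (hr : ∀ k : ℕ, 1 ≤ k → q ^ k ≠ 1) {m n : ℕ} (hmn : m < n) {a b c d : ℂ} (ha : a ≠ 0)
    (h : q = a * b * c * d * q ^ (m + n)) :
    (awScheme p).eigenvectors ((awScheme p).Φ (form (fun _ => 1) ![a, b, c, d]))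
      ((awScheme p).Ψ (form (fun _ => 1) ![a, b, c, d])) n ⊆
      limits (askeyWilson q n) {τ | τ 0 ≠ 0} n ![(a : OnePoint ℂ), b, c, d] := by
  have hq : q ≠ 0 := by rw [← hpq]; exact pow_ne_zero 2 hp
  set F := form (fun _ => 1) ![a, b, c, d] with hF
  obtain ⟨f0, -, -, -, f4⟩ := form_four (fun _ => 1) ![a, b, c, d]
  have f0' : F.coeff 0 = 1 := by rw [hF, f0]; norm_num
  have f4' : F.coeff 4 = a * b * c * d := f4
  have hF4 : a * b * c * d ≠ 0 := fun h0 => hq (by rw [h, h0, zero_mul])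
  have hA : a * b * c * d * q ^ ((n : ℤ) - 1) * q ^ m = 1 := by
    rw [zpow_sub_one₀ hq, zpow_natCast]
    rw [pow_add] at h
    field_simp
    linear_combination -h
  intro Q hQ
  have hQ0 : Q ≠ 0 := by
    rintro rfl
    have := hQ.1
    rw [natDegree_zero] at this
    omega
  have hres := exists_awResonance_eq_zero hp hpq hr hmn (τ := ![a, b, c, d]) ha
    ((ev_awScheme_eq_iff hp hpq hr _ hmn.ne).2 (by rw [← hF, f0', f4', one_mul]; exact h)) hQ.1 hQ0 hQ.2
  obtain ⟨hU, hU0⟩ := natDegree_awLow hq hr hmn ha hA (a * b) (a * c) (a * d)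
  refine (awScheme p).eigenvectors_subset_of_plane (m := m) (by omega) (fun f hf hfn hop => ?_)
    hU0 hU hmn (fun hP hc => smul_mem_limits hP hc) ?_
    (awHigh_add_mem_limits hq hr hmn ha hA hres) hQ
  · have h1 := (awScheme p).eq_eig_of_slOp_eq ((awScheme p).natDegree_Φ _)
      ((awScheme p).natDegree_Ψ _) hf hop
    have h2 := (ev_awScheme_eq_iff hp hpq hr F hfn.ne).1 h1.symm
    rw [f0', one_mul, f4'] at h2
    have := pow_injective_of_not_root hq hr (mul_left_cancel₀ hF4 (h.symm.trans h2))
    omega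
  · have := (isFamily_askeyWilson hp hpq hr n).limits_subset ![(a : OnePoint ℂ), b, c, d]
    rw [← coe_vec_four] at this ⊢
    rwa [sphereForm_coe] at this

/-- All eigenvalues are zero, so eigenvectors form the kernel of a degree-lowering operator. A
kernel element of degree `k + 1` forces `u₀ u₁ = v₀ v₁ q ^ k` for the coordinates of the other two
parameters. -/
theorem eigenvectors_subset_of_degenerate (hp : p ≠ 0) (hpq : p ^ 2 = q)
    (hr : ∀ k : ℕ, 1 ≤ k → q ^ k ≠ 1) {t : Fin 4 → OnePoint ℂ} {σ : Equiv.Perm (Fin 4)}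
    (h2 : t (σ 2) = ((0 : ℂ) : OnePoint ℂ)) (h3 : t (σ 3) = OnePoint.infty) (m : ℕ) :
    (awScheme p).eigenvectors ((awScheme p).Φ (sphereForm t)) ((awScheme p).Ψ (sphereForm t))
      (m + 1) ⊆ limits (askeyWilson q (m + 1)) {τ | τ 0 ≠ 0} (m + 1) t := by
  have hq : q ≠ 0 := by rw [← hpq]; exact pow_ne_zero 2 hp
  have hpp := sub_inv_ne_zero hp hpq (by simpa using hr 1 le_rfl)
  obtain ⟨f0, f1, f3, f4⟩ := sphereForm_of_zero_infty h2 h3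
  have hev := ev_awScheme_eq_zero hp hpq hpp f0 f4
  have hone : ∀ {k : ℕ} {f : ℂ[X]}, f.natDegree = k + 1 →
      (awScheme p).op (sphereForm t) f = (awScheme p).ev (sphereForm t) (m + 1) • f →
      uCoord (t (σ 0)) * uCoord (t (σ 1)) = vCoord (t (σ 0)) * vCoord (t (σ 1)) * q ^ k := by
    intro k f hf hop
    rw [hev, zero_smul] at hop
    rw [← f1, ← f3]
    exact coeff_one_eq_of_eigenvector hp hpq hr f0 f4 hf hop
  intro Q hQ
  have huv := hone hQ.1 hQ.2
  by_cases hu : uCoord (t (σ 0)) * uCoord (t (σ 1)) = 0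
  -- The other two parameters are then again `0` and `∞`: the form is a multiple of `X²`, the
  -- operator a multiple of `𝔻²`, and only degree one is possible.
  · have hv : vCoord (t (σ 0)) * vCoord (t (σ 1)) = 0 := by
      rw [hu, zero_eq_mul, or_iff_left (pow_ne_zero m hq)] at huv
      exact huv
    have hΨ : (awScheme p).Ψ (sphereForm t) = 0 := by
      rw [awScheme_Ψ, f0, f1, f3, f4, hu, hv]
      simp
    have hΦ : (awScheme p).Φ (sphereForm t) = C ((sphereForm t).coeff 2) := by
      rw [awScheme_Φ, f0, f1, f3, f4, hu, hv]
      simp [smul_eq_C_mul]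
    have hF2 : (sphereForm t).coeff 2 ≠ 0 := fun h => by
      refine sphereForm_ne_zero t (Polynomial.ext fun k => ?_)
      rw [coeff_zero]
      by_cases hk : k ≤ 4
      · interval_cases k
        · exact f0
        · rw [f1, hu]
        · exact h
        · rw [f3, hv]
        · exact f4
      · exact coeff_eq_zero_of_natDegree_lt ((natDegree_form_le _ _).trans_lt (by omega))
    have hdd : (awScheme p).dOp ((awScheme p).dOp Q) = 0 := by
      have := hQ.2
      change (awScheme p).slOp _ _ Q = (awScheme p).ev (sphereForm t) (m + 1) • Q at this
      rw [hev, zero_smul, LatticeData.slOp_apply, hΨ, zero_mul, add_zero, hΦ, mul_eq_zero,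
        or_iff_right (C_ne_zero.2 hF2)] at this
      exact this
    have hm := (awScheme p).natDegree_eq_one_of_dOp_dOp_eq_zero
      (fun n hn => leadPair_awScheme_ne_zero hp hpq hr hn) (by rw [hQ.1]; omega) hdd
    obtain rfl : m = 0 := by
      have := hQ.1
      omega
    rcases mul_eq_zero.1 hu with hu0 | hu1
    · have hv1 : vCoord (t (σ 1)) = 0 := by
        rwa [eq_infty_of_uCoord_eq_zero hu0, vCoord_infty, one_mul] at hv
      refine mem_limits_awScheme_one hp hpq hr (σ := σ * Equiv.swap 0 1) (fun i => ?_) hm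
      fin_cases i
      · exact eq_zero_of_vCoord_eq_zero hv1
      · exact eq_infty_of_uCoord_eq_zero hu0
      · exact h2
      · exact h3
    · have hv0 : vCoord (t (σ 0)) = 0 := by
        rwa [eq_infty_of_uCoord_eq_zero hu1, vCoord_infty, mul_one] at hv
      refine mem_limits_awScheme_one hp hpq hr (σ := σ) (fun i => ?_) hm
      fin_cases i
      · exact eq_zero_of_vCoord_eq_zero hv0
      · exact eq_infty_of_uCoord_eq_zero hu1
      · exact h2
      · exact h3
  · obtain ⟨a, ha⟩ := eq_coe_of_uCoord_ne_zero (left_ne_zero_of_mul hu)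
    obtain ⟨b, hb⟩ := eq_coe_of_uCoord_ne_zero (right_ne_zero_of_mul hu)
    have hab : a * b * q ^ m = 1 := by
      simpa [ha, hb] using huv.symm
    have ht : ∀ i, t (σ i) = ![(a : OnePoint ℂ), b, (0 : ℂ), OnePoint.infty] i := by
      intro i
      fin_cases i
      · exact ha
      · exact hb
      · exact h2
      · exact h3
    obtain ⟨ρ, -, hmem⟩ := awBasis_add_mem_limits hp hpq hr hab ht
    refine (awScheme p).eigenvectors_subset_of_plane (m := 0) (by omega) (fun f hf hfn hop => ?_)
      one_ne_zero natDegree_one (by omega) (fun hP hc => smul_mem_limits hP hc)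
      ((isFamily_askeyWilson hp hpq hr _).limits_subset t) hmem hQ
    -- A kernel element of lower positive degree would satisfy the same relation with another power
    -- of `q`; so the lower solutions are constants.
    by_contra h0
    obtain ⟨k, hk⟩ := Nat.exists_eq_succ_of_ne_zero h0
    have h4 := hone hk hop
    rw [huv] at h4
    have hv0 : vCoord (t (σ 0)) * vCoord (t (σ 1)) ≠ 0 := fun h => hu (by rw [huv, h, zero_mul])
    have := pow_injective_of_not_root hq hr (mul_left_cancel₀ hv0 h4)
    omega

/-- The eigenvectors belong to the Askey–Wilson family. -/
theorem eigenvectors_subset_askeyWilson (hp : p ≠ 0) (hpq : p ^ 2 = q)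
    (hr : ∀ k : ℕ, 1 ≤ k → q ^ k ≠ 1) (t : Fin 4 → OnePoint ℂ) {n : ℕ} (hn : 1 ≤ n) :
    (awScheme p).eigenvectors ((awScheme p).Φ (sphereForm t)) ((awScheme p).Ψ (sphereForm t)) n ⊆
      limits (askeyWilson q n) {τ | τ 0 ≠ 0} n t := by
  by_cases hs : (awScheme p).Simple (sphereForm t) n
  · exact (isFamily_askeyWilson hp hpq hr n).eigenvectors_subset_of_simple hn hs
  have hq : q ≠ 0 := by rw [← hpq]; exact pow_ne_zero 2 hp
  rw [simple_awScheme_iff hp hpq hr] at hs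
  push Not at hs
  obtain ⟨m, hmn, h⟩ := hs
  obtain ⟨f0, -, -, -, f4⟩ := form_four (fun i => uCoord (t i)) fun i => vCoord (t i)
  change (sphereForm t).coeff 0 = _ at f0
  change (sphereForm t).coeff 4 = _ at f4
  -- At a coincidence the outer coefficients vanish together: either `0` and `∞` both occur, or all
  -- parameters are finite and nonzero.
  by_cases hF4 : (sphereForm t).coeff 4 = 0
  · rw [hF4, zero_mul, mul_eq_zero, or_iff_left hq] at h
    have hu : ∃ j, uCoord (t j) = 0 := by
      rw [f0] at h
      simp only [mul_eq_zero] at h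
      rcases h with ((h | h) | h) | h <;> exact ⟨_, h⟩
    have hv : ∃ i, vCoord (t i) = 0 := by
      rw [f4] at hF4
      simp only [mul_eq_zero] at hF4
      rcases hF4 with ((h | h) | h) | h <;> exact ⟨_, h⟩
    obtain ⟨j, hj⟩ := hu
    obtain ⟨i, hi⟩ := hv
    have hi := eq_zero_of_vCoord_eq_zero hi
    have hj := eq_infty_of_uCoord_eq_zero hj
    have hij : i ≠ j := by
      rintro rfl
      rw [hi] at hj
      exact OnePoint.coe_ne_infty _ hj
    obtain ⟨σ, rfl, rfl⟩ := exists_perm_two_three hij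
    obtain ⟨n, rfl⟩ := Nat.exists_eq_add_of_le' hn
    exact eigenvectors_subset_of_degenerate hp hpq hr hi hj n
  · have hF0 : (sphereForm t).coeff 0 ≠ 0 := fun h0 => by
      rw [h0, zero_mul, zero_eq_mul, or_iff_right hF4] at h
      exact pow_ne_zero _ hq h
    obtain ⟨τ, rfl⟩ := exists_coe_of_uCoord_ne_zero (t := t) fun i hi => hF0 (by
      rw [f0]
      fin_cases i <;> simp_all)
    have hτ0 : τ 0 ≠ 0 := fun h0 => hF4 (by rw [f4]; simp [h0])
    have hτ : τ = ![τ 0, τ 1, τ 2, τ 3] := by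
      funext i
      fin_cases i <;> rfl
    rw [f0, f4] at h
    simp only [uCoord_coe, vCoord_coe, mul_one, one_mul] at h
    have := eigenvectors_subset_of_resonance hp hpq hr hmn hτ0 h
    rw [← coe_vec_four, ← hτ] at this
    rwa [sphereForm_coe]

theorem awScheme_injective (hp : p - p⁻¹ ≠ 0) {F : ℂ[X]} (hF : F.natDegree ≤ 4)
    (hΦ : (awScheme p).Φ F = 0) (hΨ : (awScheme p).Ψ F = 0) : F = 0 := by
  obtain ⟨c2, c1, c0, d1, d0⟩ := coeff_awScheme p F
  rw [hΦ, coeff_zero] at c2 c1 c0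
  rw [hΨ, coeff_zero, zero_eq_mul, or_iff_right (div_ne_zero two_ne_zero hp)] at d1 d0
  ext k
  rw [coeff_zero]
  by_cases hk : k ≤ 4
  · interval_cases k
    · linear_combination -(1 / 4 : ℂ) * c2 - 1 / 4 * d1
    · linear_combination (1 / 2 : ℂ) * c1 + 1 / 2 * d0
    · linear_combination -c0 - (1 / 2 : ℂ) * c2
    · linear_combination (1 / 2 : ℂ) * c1 - 1 / 2 * d0
    · linear_combination -(1 / 4 : ℂ) * c2 + 1 / 4 * d1
  · exact coeff_eq_zero_of_natDegree_lt (hF.trans_lt (by omega))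

theorem awScheme_surjective (hp : p - p⁻¹ ≠ 0) {φ ψ : ℂ[X]} (hφ : φ.natDegree ≤ 2)
    (hψ : ψ.natDegree ≤ 1) :
    ∃ F : ℂ[X], F.natDegree ≤ 4 ∧ (awScheme p).Φ F = φ ∧ (awScheme p).Ψ F = ψ := by
  set r := p - p⁻¹ with hr
  obtain ⟨F, hF, h0, h1, h2, h3, h4⟩ := exists_coeff_eq ((φ.coeff 2 - r / 2 * ψ.coeff 1) / 4)
    ((r / 2 * ψ.coeff 0 - φ.coeff 1) / 2) (φ.coeff 0 + φ.coeff 2 / 2)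
    (-(r / 2 * ψ.coeff 0 + φ.coeff 1) / 2) ((φ.coeff 2 + r / 2 * ψ.coeff 1) / 4)
  refine ⟨F, hF, ?_⟩
  obtain ⟨c2, c1, c0, d1, d0⟩ := coeff_awScheme p F
  constructor
  · refine ext_of_natDegree_le_two ((awScheme p).natDegree_Φ F) hφ ?_ ?_ ?_
    · rw [c0, h0, h2, h4]; ring
    · rw [c1, h1, h3]; ring
    · rw [c2, h0, h4]; ring
  · refine ext_of_natDegree_le_two (((awScheme p).natDegree_Ψ F).trans one_le_two)
      (hψ.trans one_le_two) ?_ ?_ ?_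
    · rw [d0, ← hr, h1, h3]; field_simp; ring
    · rw [d1, ← hr, h0, h4]; field_simp; ring
    · rw [coeff_eq_zero_of_natDegree_lt (((awScheme p).natDegree_Ψ F).trans_lt one_lt_two),
        coeff_eq_zero_of_natDegree_lt (hψ.trans_lt one_lt_two)]

/-- Up to a nonzero constant the coefficient is the product of the `vCoord` minus the product of the
`uCoord`: `abcd - 1` for finite parameters, and the product of the `vCoord` alone if `∞` occurs. -/
theorem awRegular_iff (hp : p - p⁻¹ ≠ 0) (t : Fin 4 → OnePoint ℂ) :
    ((awScheme p).Ψ (sphereForm t)).coeff 1 ≠ 0 ↔ AWRegular t := by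
  have h1 : ((awScheme p).Ψ (sphereForm t)).coeff 1 ≠ 0 ↔
      ∏ i, uCoord (t i) ≠ ∏ i, vCoord (t i) := by
    obtain ⟨f0, -, -, -, f4⟩ := form_four (fun i => uCoord (t i)) fun i => vCoord (t i)
    change (sphereForm t).coeff 0 = _ at f0
    change (sphereForm t).coeff 4 = _ at f4
    rw [(coeff_awScheme p _).2.2.2.1, f0, f4, Fin.prod_univ_four, Fin.prod_univ_four,
      mul_ne_zero_iff, and_iff_right (div_ne_zero two_ne_zero hp), mul_ne_zero_iff,
      and_iff_right two_ne_zero, sub_ne_zero, ne_comm]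
  rw [h1, AWRegular]
  by_cases hinf : ∃ j, t j = OnePoint.infty
  · obtain ⟨j, hj⟩ := hinf
    have hu : ∏ i, uCoord (t i) = 0 := prod_eq_zero (mem_univ j) (by rw [hj, uCoord_infty])
    rw [hu, ne_comm, prod_ne_zero_iff]
    constructor
    · refine fun h => ⟨fun i k hi _ => h i (mem_univ i) (by rw [hi, vCoord_coe]),
        fun a b c d ht => ?_⟩
      rw [ht] at hj
      fin_cases j <;> exact absurd hj (OnePoint.coe_ne_infty _)
    · exact fun h i _ hi => h.1 i j (eq_zero_of_vCoord_eq_zero hi) hj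
  · obtain ⟨τ, rfl⟩ := exists_coe_of_uCoord_ne_zero (t := t) fun i hi =>
      hinf ⟨i, eq_infty_of_uCoord_eq_zero hi⟩
    simp only [uCoord_coe, vCoord_coe, prod_const_one]
    rw [ne_comm, Fin.prod_univ_four]
    constructor
    · refine fun h => ⟨fun i j _ => OnePoint.coe_ne_infty _, fun a b c d ht => ?_⟩
      have hc : ∀ i x, ![(a : OnePoint ℂ), b, c, d] i = ((x : ℂ) : OnePoint ℂ) → τ i = x :=
        fun i x hx => OnePoint.coe_injective ((congrFun ht i).trans hx)
      rwa [hc 0 a rfl, hc 1 b rfl, hc 2 c rfl, hc 3 d rfl] at h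
    · refine fun h => h.2 (τ 0) (τ 1) (τ 2) (τ 3) (funext fun i => ?_)
      fin_cases i <;> rfl

end

/-! ### The `q`-quadratic lattices -/

section

variable {q c₁ c₂ c₃ w : ℂ}

/-- In the variable `z = (c₂ / w) q ^ s` the lattice is a Joukowski map, and a half step in `s`
multiplies `z` by a square root of `q`. -/
theorem qQuadratic_eq (hc : c₁ * c₂ ≠ 0) (hw : w ^ 2 = c₁ * c₂) (s : ℂ) :
    qQuadratic q c₁ c₂ c₃ s = 2 * w * joukowski (c₂ / w * q ^ s) + c₃ := by
  have hw0 : w ≠ 0 := by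
    rintro rfl
    exact hc (by rw [← hw]; norm_num)
  have hc2 := right_ne_zero_of_mul hc
  rw [qQuadratic, joukowski, Complex.cpow_neg, mul_inv, inv_div]
  have e1 : w * (c₂ / w) = c₂ := mul_div_cancel₀ c₂ hw0
  have e2 : w * (w / c₂) = c₁ := by
    rw [mul_div_assoc', ← sq, hw, mul_div_cancel_right₀ _ hc2]
  linear_combination -(q ^ s) * e1 - (q ^ s)⁻¹ * e2

theorem cpow_add_half (hq : q ≠ 0) (s : ℂ) :
    q ^ (s + 1 / 2) = q ^ (1 / 2 : ℂ) * q ^ s ∧ q ^ (s - 1 / 2) = (q ^ (1 / 2 : ℂ))⁻¹ * q ^ s := by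
  rw [Complex.cpow_add _ _ hq, Complex.cpow_sub _ _ hq]
  exact ⟨mul_comm _ _, div_eq_inv_mul _ _⟩

theorem exists_cpow_eq (hq : q ≠ 0) (hq1 : q ≠ 1) {z : ℂ} (hz : z ≠ 0) : ∃ s : ℂ, q ^ s = z := by
  have hl : Complex.log q ≠ 0 := fun h => hq1 (by rw [← Complex.exp_log hq, h, Complex.exp_zero])
  refine ⟨Complex.log z / Complex.log q, ?_⟩
  rw [Complex.cpow_def_of_ne_zero hq, mul_div_cancel₀ _ hl, Complex.exp_log hz]

theorem askeyWilson_correspondence (hq : q ≠ 0) (hr : ∀ k : ℕ, 1 ≤ k → q ^ k ≠ 1)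
    (hc : c₁ * c₂ ≠ 0) (hw : w ^ 2 = c₁ * c₂) (c₃ : ℂ) :
    (∀ φ ψ : ℂ[X], Coefficients φ ψ →
      ∃ t : Fin 4 → OnePoint ℂ, (ψ.natDegree = 1 ↔ AWRegular t) ∧
        ∀ n : ℕ, 1 ≤ n → solutions (qQuadratic q c₁ c₂ c₃) φ ψ n = askeyWilsonFamily q c₃ w n t) ∧
    (∀ t : Fin 4 → OnePoint ℂ,
      ∃ φ ψ : ℂ[X], Coefficients φ ψ ∧ (ψ.natDegree = 1 ↔ AWRegular t) ∧
        ∀ n : ℕ, 1 ≤ n → solutions (qQuadratic q c₁ c₂ c₃) φ ψ n = askeyWilsonFamily q c₃ w n t) := by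
  set p := q ^ (1 / 2 : ℂ) with hpdef
  have hpq : p ^ 2 = q := by
    rw [hpdef, ← Complex.cpow_nat_mul]
    norm_num
  have hp : p ≠ 0 := by
    intro h
    rw [h] at hpq
    exact hq (by rw [← hpq]; norm_num)
  have hq1 : q ≠ 1 := by simpa using hr 1 le_rfl
  have hpp := sub_inv_ne_zero hp hpq hq1
  have hw0 : w ≠ 0 := by
    rintro rfl
    exact hc (by rw [← hw]; norm_num)
  have hg : c₂ / w ≠ 0 := div_ne_zero (right_ne_zero_of_mul hc) hw0
  have e1 : ∀ s : ℂ, c₂ / w * q ^ (s + 1 / 2) = p * (c₂ / w * q ^ s) := fun s => by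
    rw [(cpow_add_half hq s).1]; ring
  have e2 : ∀ s : ℂ, c₂ / w * q ^ (s - 1 / 2) = p⁻¹ * (c₂ / w * q ^ s) := fun s => by
    rw [(cpow_add_half hq s).2]; ring
  have hz : ∀ s : ℂ, c₂ / w * q ^ s ≠ 0 := fun s => mul_ne_zero hg (by
    rw [Complex.cpow_def_of_ne_zero hq]; exact Complex.exp_ne_zero _)
  refine (awScheme p).correspondence (x₀ := fun s => joukowski (c₂ / w * q ^ s))
    (mul_ne_zero two_ne_zero hw0) (qQuadratic_eq hc hw) (fun s => ?_) (fun s => ?_) ?_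
    (fun F hF => awScheme_injective hpp hF) (fun φ ψ hφ hψ => awScheme_surjective hpp hφ hψ)
    (fun n => (isFamily_askeyWilson hp hpq hr n).natDegree_le) (awRegular_iff hpp)
    (fun t n hn => eigenvectors_subset_askeyWilson hp hpq hr t hn)
    (isFamily_askeyWilson hp hpq hr)
  · simp only [e1, e2]
    exact joukowski_add p _
  · simp only [e1, e2]
    exact joukowski_sub_sq hp (hz s)
  -- The three conditions of `IsGeneric` on `z` beyond `z ≠ 0` are exactly the nonvanishing of the
  -- three denominators.
  · refine (infinite_joukowski_image q).mono ?_
    rintro _ ⟨z, ⟨hz0, hz1, hz2, hz3⟩, rfl⟩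
    obtain ⟨s, hs⟩ := exists_cpow_eq hq hq1 (div_ne_zero hz0 hg)
    have hsz : c₂ / w * q ^ s = z := by rw [hs, mul_div_cancel₀ _ hg]
    refine ⟨s, ⟨?_, ?_, ?_⟩, congrArg joukowski hsz⟩
    · have h1 : c₂ / w * q ^ (s + 1) = p * (p * z) := by
        rw [← hsz, ← e1, ← e1, add_assoc]; norm_num
      have h2 : c₂ / w * q ^ s = p⁻¹ * (p * z) := by
        rw [hsz, inv_mul_cancel_left₀ hp]
      simp only [h1, h2]
      rw [← sub_ne_zero, joukowski_sub]
      refine div_ne_zero (mul_ne_zero hpp fun h0 => hz2 ?_) two_ne_zero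
      rw [← hpq]; field_simp at h0; linear_combination h0
    · have h1 : c₂ / w * q ^ (s - 1) = p⁻¹ * (p⁻¹ * z) := by
        rw [← hsz, ← e2, ← e2, sub_sub]; norm_num
      have h2 : c₂ / w * q ^ s = p * (p⁻¹ * z) := by
        rw [hsz, mul_inv_cancel_left₀ hp]
      simp only [h1, h2]
      rw [← sub_ne_zero, joukowski_sub]
      refine div_ne_zero (mul_ne_zero hpp fun h0 => hz3 ?_) two_ne_zero
      rw [← hpq]; field_simp at h0; linear_combination h0
    · simp only [e1, e2, hsz]
      rw [← sub_ne_zero, joukowski_sub]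
      refine div_ne_zero (mul_ne_zero hpp fun h0 => hz1 ?_) two_ne_zero
      field_simp at h0; linear_combination h0

theorem askeyWilsonFamily_coe (hq : q ≠ 0) (hr : ∀ k : ℕ, 1 ≤ k → q ^ k ≠ 1) (hw : w ≠ 0) (c₃ : ℂ)
    {n : ℕ} {a b c d : ℂ} (hn : 1 ≤ n) (ha : a ≠ 0) (h : (askeyWilson q n a b c d).natDegree = n) :
    askeyWilsonFamily q c₃ w n ![(a : OnePoint ℂ), b, c, d] =
      multiples (askeyWilsonOn q c₃ w n a b c d) := by
  obtain ⟨p, hpq⟩ := IsAlgClosed.exists_pow_nat_eq q (n := 2) two_pos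
  have hp : p ≠ 0 := by
    rintro rfl
    exact hq (by rw [← hpq]; norm_num)
  have hfam := isFamily_askeyWilson hp hpq hr n
  refine limits_comp_eq_multiples_comp (mul_ne_zero two_ne_zero hw) c₃ hfam.natDegree_le ?_
  rw [← coe_vec_four]
  exact hfam.limits_coe_eq_multiples hn (τ := ![a, b, c, d]) ha h

end


/-! ### The scheme of quadratic lattices -/

/-- The quadratic lattice in standard form `y = -s²`. -/
def wilsonScheme : Scheme where
  α := 1
  β := -1 / 4
  U := -X
  natDegree_U := by rw [natDegree_neg]; exact natDegree_X_le.trans one_le_two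
  coeff_U := by simp [coeff_X]
  -- For `F` of degree at most four and `y = -s²`, `Φ F` is the even part of `s⁴ F(1/s)` and `-s Ψ
  -- F` its odd part; for finite parameters this quartic in `s` is the product of the `τᵢ + s`.
  Φ := (lcoeff ℂ 0).smulRight (X ^ 2) - (lcoeff ℂ 2).smulRight X + (lcoeff ℂ 4).smulRight 1
  Ψ := (lcoeff ℂ 1).smulRight X - (lcoeff ℂ 3).smulRight 1
  natDegree_Φ F := by
    refine natDegree_add_le_of_degree_le (natDegree_sub_le_of_le (m := 2) (n := 2) ?_ ?_) ?_
    · exact (natDegree_smul_le _ _).trans (natDegree_X_pow_le 2)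
    · exact (natDegree_smul_le _ _).trans (natDegree_X_le.trans (by norm_num))
    · exact (natDegree_smul_le _ _).trans (by simp)
  natDegree_Ψ F := by
    refine natDegree_sub_le_of_le (m := 1) (n := 1) ?_ ?_
    · exact (natDegree_smul_le _ _).trans natDegree_X_le
    · exact (natDegree_smul_le _ _).trans (by simp)

theorem wilsonScheme_Φ (F : ℂ[X]) : wilsonScheme.Φ F =
    F.coeff 0 • (X : ℂ[X]) ^ 2 - F.coeff 2 • X + F.coeff 4 • (1 : ℂ[X]) := rfl

theorem wilsonScheme_Ψ (F : ℂ[X]) :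
    wilsonScheme.Ψ F = F.coeff 1 • X - F.coeff 3 • (1 : ℂ[X]) := rfl

theorem coeff_wilsonScheme (F : ℂ[X]) :
    (wilsonScheme.Φ F).coeff 2 = F.coeff 0 ∧ (wilsonScheme.Φ F).coeff 1 = -F.coeff 2 ∧
    (wilsonScheme.Φ F).coeff 0 = F.coeff 4 ∧ (wilsonScheme.Ψ F).coeff 1 = F.coeff 1 ∧
    (wilsonScheme.Ψ F).coeff 0 = -F.coeff 3 := by
  rw [wilsonScheme_Φ, wilsonScheme_Ψ]
  simp only [coeff_add, coeff_sub, coeff_smul, coeff_X_pow, coeff_X, coeff_one, smul_eq_mul]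
  refine ⟨?_, ?_, ?_, ?_, ?_⟩ <;> norm_num

theorem leadPair_wilsonScheme (n : ℕ) : wilsonScheme.leadPair n = ((n : ℂ), (1 : ℂ)) := by
  have hα : wilsonScheme.α = 1 := rfl
  induction n with
  | zero => simp [LatticeData.leadPair]
  | succ n ih =>
    rw [LatticeData.leadPair, ih, hα]
    ext <;> push_cast <;> ring

theorem ev_wilsonScheme (F : ℂ[X]) (n : ℕ) :
    wilsonScheme.ev F n = n * (F.coeff 0 * (n - 1) + F.coeff 1) := by
  obtain ⟨c2, -, -, d1, -⟩ := coeff_wilsonScheme F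
  rw [Scheme.ev, LatticeData.eig, leadPair_wilsonScheme, leadPair_wilsonScheme, c2, d1]
  rcases n with _ | n
  · simp
  · simp

/-- The difference of the eigenvalues factors as `k - n` times the expression on the right. -/
theorem ev_wilsonScheme_eq_iff (F : ℂ[X]) {k n : ℕ} (hkn : k ≠ n) :
    wilsonScheme.ev F k = wilsonScheme.ev F n ↔ F.coeff 0 * ((k + n : ℂ) - 1) + F.coeff 1 = 0 := by
  have hd : (k : ℂ) - n ≠ 0 := sub_ne_zero.2 (Nat.cast_injective.ne hkn)
  rw [ev_wilsonScheme, ev_wilsonScheme, ← sub_eq_zero, show (k : ℂ) * (F.coeff 0 * (k - 1) + F.coeff 1) - n * (F.coeff 0 * (n - 1) + F.coeff 1) =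
    (k - n) * (F.coeff 0 * ((k + n : ℂ) - 1) + F.coeff 1) by ring,
    mul_eq_zero, or_iff_right hd]

theorem simple_wilsonScheme_iff (F : ℂ[X]) (n : ℕ) :
    wilsonScheme.Simple F n ↔ ∀ k < n, F.coeff 0 * ((k + n : ℂ) - 1) + F.coeff 1 ≠ 0 :=
  forall₂_congr fun _ hk => (ev_wilsonScheme_eq_iff F hk.ne).not

/-- The points at which the equation is not singular. -/
def IsRegularPoint (s : ℂ) : Prop := s ≠ 0 ∧ 2 * s + 1 ≠ 0 ∧ 2 * s - 1 ≠ 0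

theorem infinite_neg_sq_image : ((fun s : ℂ => -s ^ 2) '' {s | IsRegularPoint s}).Infinite := by
  have hbad : (({0, -1 / 2, 1 / 2} : Set ℂ).image fun s => -s ^ 2).Finite :=
    (Set.toFinite _).image _
  refine hbad.infinite_compl.mono fun y hy => ?_
  obtain ⟨s, hs⟩ := IsAlgClosed.exists_pow_nat_eq (-y) (n := 2) two_pos
  have hsy : -s ^ 2 = y := by rw [hs, neg_neg]
  refine ⟨s, ⟨fun h => hy ⟨s, ?_, hsy⟩, fun h => hy ⟨s, ?_, hsy⟩, fun h => hy ⟨s, ?_, hsy⟩⟩, hsy⟩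
  · exact Or.inl h
  · exact Or.inr (Or.inl (by linear_combination h / 2))
  · exact Or.inr (Or.inr (by rw [Set.mem_singleton_iff]; linear_combination h / 2))

theorem eq_of_eval_neg_sq {f g : ℂ[X]}
    (h : ∀ s, IsRegularPoint s → f.eval (-s ^ 2) = g.eval (-s ^ 2)) : f = g := by
  refine eq_of_infinite_eval_eq _ _ (infinite_neg_sq_image.mono ?_)
  rintro _ ⟨s, hs, rfl⟩
  exact h s hs

theorem neg_sq_add (s : ℂ) : -(s + 1 / 2) ^ 2 + -(s - 1 / 2) ^ 2 =
    2 * (wilsonScheme.α * -s ^ 2 + wilsonScheme.β) := by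
  have hα : wilsonScheme.α = 1 := rfl
  have hβ : wilsonScheme.β = -1 / 4 := rfl
  rw [hα, hβ]
  ring

theorem neg_sq_sub_sq (s : ℂ) : (-(s + 1 / 2) ^ 2 - -(s - 1 / 2) ^ 2) ^ 2 =
    4 * wilsonScheme.U.eval (-s ^ 2) := by
  have hU : wilsonScheme.U = -X := rfl
  rw [hU, eval_neg, eval_X]
  ring

/-- The operator of finite parameters as a second-order difference operator. -/
theorem eval_op_wilsonScheme {s : ℂ} (hs : IsRegularPoint s) (τ : Fin 4 → ℂ) (f : ℂ[X]) :
    (wilsonScheme.op (form (fun _ => 1) τ) f).eval (-s ^ 2) =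
      (∏ i, (τ i + s)) * (f.eval (-(s + 1) ^ 2) - f.eval (-s ^ 2)) / (2 * s * (2 * s + 1)) +
      (∏ i, (τ i - s)) * (f.eval (-(s - 1) ^ 2) - f.eval (-s ^ 2)) / (2 * s * (2 * s - 1)) := by
  obtain ⟨h0, h1, h2⟩ := hs
  have a1 := neg_sq_add (s + 1 / 2)
  have a2 := neg_sq_sub_sq (s + 1 / 2)
  have a3 := neg_sq_add (s - 1 / 2)
  have a4 := neg_sq_sub_sq (s - 1 / 2)
  rw [add_sub_cancel_right, show s + 1 / 2 + 1 / 2 = s + 1 by ring] at a1 a2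
  rw [sub_add_cancel, show s - 1 / 2 - 1 / 2 = s - 1 by ring] at a3 a4
  have s0 : -(s + 1 / 2) ^ 2 - -(s - 1 / 2) ^ 2 = -(2 * s) := by ring
  have s1 : -(s + 1) ^ 2 - -s ^ 2 = -(2 * s + 1) := by ring
  have s2 : -s ^ 2 - -(s - 1) ^ 2 = -(2 * s - 1) := by ring
  have n0 : -(2 * s) ≠ 0 := neg_ne_zero.2 (mul_ne_zero two_ne_zero h0)
  rw [Scheme.op, wilsonScheme.eval_slOp (neg_sq_add s) (neg_sq_sub_sq s) a1 a2 a3 a4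
    (sub_ne_zero.1 (s0 ▸ n0)) (sub_ne_zero.1 (s1 ▸ neg_ne_zero.2 h1))
    (sub_ne_zero.1 (s2 ▸ neg_ne_zero.2 h2)), s0, s1, s2, wilsonScheme_Φ, wilsonScheme_Ψ]
  simp only [eval_add, eval_sub, eval_smul, eval_pow, eval_X, eval_one, smul_eq_mul, mul_one]
  obtain ⟨f0, f1, f2, f3, f4⟩ := form_four (fun _ => 1) τ
  rw [f0, f1, f2, f3, f4, Fin.prod_univ_four, Fin.prod_univ_four]
  generalize eval (-(s + 1) ^ 2) f - eval (-s ^ 2) f = A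
  rw [← neg_sub (eval (-s ^ 2) f)]
  generalize eval (-s ^ 2) f - eval (-(s - 1) ^ 2) f = B
  have k1 : ∀ φ ψ : ℂ, φ * ((A / -(2 * s + 1) - B / -(2 * s - 1)) / -(2 * s)) +
      ψ * ((A / -(2 * s + 1) + B / -(2 * s - 1)) / 2) =
      (φ - s * ψ) * A / (2 * s * (2 * s + 1)) + (φ + s * ψ) * -B / (2 * s * (2 * s - 1)) := by
    intro φ ψ
    generalize 2 * s + 1 = d1 at *
    generalize 2 * s - 1 = d2 at *
    field_simp
    ring
  rw [k1]
  congr 3 <;> ring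

/-! ### Shifted factorials -/

theorem poch_eq_prod (x : ℂ) (k : ℕ) : poch x k = ∏ j ∈ range k, (x + j) := by
  induction k with
  | zero => simp [poch]
  | succ k ih => rw [prod_range_succ, ← ih, poch, ascPochhammer_succ_eval, poch]

theorem poch_zero (x : ℂ) : poch x 0 = 1 := by simp [poch]

theorem poch_succ (x : ℂ) (k : ℕ) : poch x (k + 1) = poch x k * (x + k) := by
  rw [poch_eq_prod, poch_eq_prod, prod_range_succ]

theorem poch_add (x : ℂ) (i j : ℕ) : poch x (i + j) = poch x i * poch (x + i) j := by
  rw [poch_eq_prod, prod_range_add, poch_eq_prod, poch_eq_prod]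
  congr 1
  exact prod_congr rfl fun k _ => by push_cast; ring

theorem poch_succ' (x : ℂ) (k : ℕ) : poch x (k + 1) = x * poch (x + 1) k := by
  rw [add_comm, poch_add, poch_succ, poch_zero, Nat.cast_zero, Nat.cast_one, one_mul, add_zero]

theorem poch_ne_zero_iff {x : ℂ} {k : ℕ} : poch x k ≠ 0 ↔ ∀ j < k, x + j ≠ 0 := by
  rw [poch_eq_prod, prod_ne_zero_iff]
  exact forall_congr' fun j => by rw [mem_range]

theorem poch_neg_ne_zero {k n : ℕ} (hk : k ≤ n) : poch (-(n : ℂ)) k ≠ 0 :=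
  poch_ne_zero_iff.2 fun j hj h => by
    rw [neg_add_eq_zero, Nat.cast_inj] at h
    omega

theorem tendsto_poch {x : ℕ → ℂ} {ξ : ℂ} (hx : Tendsto x atTop (𝓝 ξ)) (k : ℕ) :
    Tendsto (fun j => poch (x j) k) atTop (𝓝 (poch ξ k)) := by
  simp only [poch_eq_prod]
  exact tendsto_finsetProd _ fun _ _ => hx.add_const _

/-- As in the `q`-case, each factor takes one `y`; here the constants `i` become negligible. -/
theorem tendsto_poch_scaled {x y : ℕ → ℂ} {ξ : ℂ} (hxy : Tendsto (fun j => x j * y j) atTop (𝓝 ξ))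
    (hy : Tendsto y atTop (𝓝 0)) (k : ℕ) :
    Tendsto (fun j => poch (x j) k * y j ^ k) atTop (𝓝 (ξ ^ k)) := by
  have h : ∀ j, poch (x j) k * y j ^ k = ∏ i ∈ range k, (x j * y j + i * y j) := fun j => by
    rw [poch_eq_prod, ← card_range k, ← prod_const, card_range, ← prod_mul_distrib]
    exact prod_congr rfl fun i _ => add_mul _ _ _
  simp only [h]
  rw [show ξ ^ k = ∏ i ∈ range k, (ξ + i * 0) by simp]
  exact tendsto_finsetProd _ fun i _ => hxy.add (hy.const_mul _)

/-! ### The Wilson polynomials -/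

/-- The product `(a - s)_k (a + s)_k` as a polynomial in `-s²`. -/
def wilsonBasis (a : ℂ) (k : ℕ) : ℂ[X] := ∏ j ∈ range k, (C ((a + j) ^ 2) + X)

/-- The coefficients of the Wilson polynomials in the basis `wilsonBasis`. -/
def wilsonCoeff (n : ℕ) (a b c d : ℂ) (k : ℕ) : ℂ :=
  poch (-n) k * poch (n + a + b + c + d - 1) k / (k.factorial : ℂ) *
    (poch (a + b + k) (n - k) * poch (a + c + k) (n - k) * poch (a + d + k) (n - k))

theorem wilson_eq (n : ℕ) (a b c d : ℂ) :
    wilson n a b c d = ∑ k ∈ range (n + 1), wilsonCoeff n a b c d k • wilsonBasis a k := by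
  rw [wilson]
  exact sum_congr rfl fun k _ => (smul_eq_C_mul _).symm

theorem natDegree_wilsonBasis (a : ℂ) (k : ℕ) :
    (wilsonBasis a k).natDegree = k ∧ (wilsonBasis a k).coeff k = 1 := by
  have h : (wilsonBasis a k).Monic :=
    monic_prod_of_monic _ _ fun j _ => by rw [add_comm]; exact monic_X_add_C _
  have hd : (wilsonBasis a k).natDegree = k := by
    rw [wilsonBasis, natDegree_prod_of_monic _ _ fun j _ => by rw [add_comm]; exact monic_X_add_C _]
    simp only [add_comm (C _) X, natDegree_X_add_C, sum_const, card_range, smul_eq_mul, mul_one]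
  refine ⟨hd, ?_⟩
  conv_lhs => rw [← hd, hd]
  rw [← h.coeff_natDegree, hd]

theorem wilsonBasis_ne_zero (a : ℂ) (k : ℕ) : wilsonBasis a k ≠ 0 := fun h => by
  have := (natDegree_wilsonBasis a k).2
  rw [h, coeff_zero] at this
  exact zero_ne_one this

theorem eval_wilsonBasis (a : ℂ) (k : ℕ) (s : ℂ) :
    (wilsonBasis a k).eval (-s ^ 2) = poch (a - s) k * poch (a + s) k := by
  rw [wilsonBasis, eval_prod, poch_eq_prod, poch_eq_prod, ← prod_mul_distrib]
  refine prod_congr rfl fun j _ => ?_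
  simp only [eval_add, eval_C, eval_X]
  ring

theorem coeffTendsto_wilsonBasis {a : ℕ → ℂ} {α : ℂ} (ha : Tendsto a atTop (𝓝 α)) (k : ℕ) :
    CoeffTendsto (fun j => wilsonBasis (a j) k) (wilsonBasis α k) :=
  CoeffTendsto.prod _ fun _ _ => (CoeffTendsto.C ((ha.add_const _).pow 2)).add
    (CoeffTendsto.const X)

/-- The operator of finite parameters is bidiagonal in `wilsonBasis (τ 0)`. -/
def wilsonOffDiagonal (τ : Fin 4 → ℂ) (k : ℕ) : ℂ :=
  -((k + 1) * ((τ 0 + τ 1 + k) * (τ 0 + τ 2 + k) * (τ 0 + τ 3 + k)))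

theorem op_wilsonBasis_zero (τ : Fin 4 → ℂ) :
    wilsonScheme.op (form (fun _ => 1) τ) (wilsonBasis (τ 0) 0) =
      wilsonScheme.ev (form (fun _ => 1) τ) 0 • wilsonBasis (τ 0) 0 := by
  rw [Scheme.op, LatticeData.slOp_of_natDegree_eq_zero _ (natDegree_wilsonBasis _ 0).1.le,
    ev_wilsonScheme]
  simp

/-- A unit shift of `s` changes only the end factors of the two shifted factorials; the common part
factors out and a polynomial identity in `s` remains. -/
theorem op_wilsonBasis_succ (τ : Fin 4 → ℂ) (k : ℕ) :
    wilsonScheme.op (form (fun _ => 1) τ) (wilsonBasis (τ 0) (k + 1)) =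
      wilsonScheme.ev (form (fun _ => 1) τ) (k + 1) • wilsonBasis (τ 0) (k + 1) +
        wilsonOffDiagonal τ k • wilsonBasis (τ 0) k := by
  refine eq_of_eval_neg_sq fun s hs => ?_
  rw [eval_op_wilsonScheme hs, eval_add, eval_smul, eval_smul, eval_wilsonBasis, eval_wilsonBasis,
    eval_wilsonBasis, eval_wilsonBasis, ev_wilsonScheme]
  obtain ⟨f0, f1, -⟩ := form_four (fun _ => 1) τ
  rw [f0, f1, wilsonOffDiagonal, Fin.prod_univ_four, Fin.prod_univ_four]
  obtain ⟨h0, h1, h2⟩ := hs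
  generalize τ 0 = a
  generalize τ 1 = b
  generalize τ 2 = c
  generalize τ 3 = d
  have s1 : (a + s) * poch (a + (s + 1)) k = poch (a + s) k * (a + s + k) := by
    rw [← add_assoc, ← poch_succ', poch_succ]
  have s2 : (a - s) * poch (a - (s - 1)) k = poch (a - s) k * (a - s + k) := by
    rw [show a - (s - 1) = a - s + 1 by ring, ← poch_succ', poch_succ]
  have s3 : poch (a - (s + 1)) (k + 1) = (a - (s + 1)) * poch (a - s) k := by
    rw [poch_succ', show a - (s + 1) + 1 = a - s by ring]
  have s4 : poch (a + (s - 1)) (k + 1) = (a + (s - 1)) * poch (a + s) k := by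
    rw [poch_succ', show a + (s - 1) + 1 = a + s by ring]
  rw [s3, s4, poch_succ (a + (s + 1)), poch_succ (a - (s - 1)), poch_succ (a - s),
    poch_succ (a + s)]
  -- The difference of the basis products supplies the factor `2 s + 1` that cancels one
  -- denominator.
  have t1 : (a + s) * (b + s) * (c + s) * (d + s) *
      ((a - (s + 1)) * poch (a - s) k * (poch (a + (s + 1)) k * (a + (s + 1) + k)) -
        poch (a - s) k * (a - s + k) * (poch (a + s) k * (a + s + k))) =
      -(k + 1) * (a + s + k) * (b + s) * (c + s) * (d + s) * (poch (a - s) k * poch (a + s) k) *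
        (2 * s + 1) := by
    linear_combination (b + s) * (c + s) * (d + s) * (a - (s + 1)) * poch (a - s) k *
      (a + (s + 1) + k) * s1
  have t2 : (a - s) * (b - s) * (c - s) * (d - s) *
      (poch (a - (s - 1)) k * (a - (s - 1) + k) * ((a + (s - 1)) * poch (a + s) k) -
        poch (a - s) k * (a - s + k) * (poch (a + s) k * (a + s + k))) =
      (k + 1) * (a - s + k) * (b - s) * (c - s) * (d - s) * (poch (a - s) k * poch (a + s) k) *
        (2 * s - 1) := by
    linear_combination (b - s) * (c - s) * (d - s) * (a + (s - 1)) * poch (a + s) k *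
      (a - (s - 1) + k) * s2
  rw [t1, t2, mul_div_mul_right _ _ h1, mul_div_mul_right _ _ h2, smul_eq_mul, smul_eq_mul]
  generalize poch (a - s) k = A
  generalize poch (a + s) k = B
  push_cast
  field_simp
  ring

theorem wilsonCoeff_recurrence (τ : Fin 4 → ℂ) {k n : ℕ} (hk : k < n) :
    wilsonCoeff n (τ 0) (τ 1) (τ 2) (τ 3) k * (wilsonScheme.ev (form (fun _ => 1) τ) k -
      wilsonScheme.ev (form (fun _ => 1) τ) n) +
      wilsonCoeff n (τ 0) (τ 1) (τ 2) (τ 3) (k + 1) * wilsonOffDiagonal τ k = 0 := by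
  obtain ⟨f0, f1, -⟩ := form_four (fun _ => 1) τ
  have hx : ∀ x : ℂ, poch (x + k) (n - k) = (x + k) * poch (x + (k + 1 : ℕ)) (n - (k + 1)) :=
    fun x => by
      rw [show n - k = n - (k + 1) + 1 by omega, poch_succ', add_assoc]
      push_cast
      rfl
  have hf : (k.factorial : ℂ) ≠ 0 := Nat.cast_ne_zero.2 k.factorial_ne_zero
  have hk1 : (k : ℂ) + 1 ≠ 0 := Nat.cast_add_one_ne_zero k
  rw [ev_wilsonScheme, ev_wilsonScheme, f0, f1, wilsonOffDiagonal, wilsonCoeff, wilsonCoeff, hx, hx,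
    hx, poch_succ, poch_succ, Nat.factorial_succ]
  push_cast
  field_simp
  ring

theorem op_wilson (τ : Fin 4 → ℂ) (n : ℕ) :
    wilsonScheme.op (form (fun _ => 1) τ) (wilson n (τ 0) (τ 1) (τ 2) (τ 3)) =
      wilsonScheme.ev (form (fun _ => 1) τ) n • wilson n (τ 0) (τ 1) (τ 2) (τ 3) := by
  rw [wilson_eq, ← sub_eq_zero, bidiagonal_sum (op_wilsonBasis_zero τ) (op_wilsonBasis_succ τ)]
  refine sum_eq_zero fun k hk => ?_
  rw [wilsonCoeff_recurrence τ (mem_range.1 hk), zero_smul]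

theorem wilsonCoeff_self_ne_zero_iff (a b c d : ℂ) (n : ℕ) :
    wilsonCoeff n a b c d n ≠ 0 ↔ ∀ k < n, ((k + n : ℂ) - 1) + (a + b + c + d) ≠ 0 := by
  have hf : (n.factorial : ℂ) ≠ 0 := Nat.cast_ne_zero.2 n.factorial_ne_zero
  rw [wilsonCoeff, Nat.sub_self, poch_zero, poch_zero, poch_zero, one_mul, one_mul, mul_one,
    div_ne_zero_iff, and_iff_left hf, mul_ne_zero_iff, and_iff_right (poch_neg_ne_zero le_rfl),
    poch_ne_zero_iff]
  refine forall₂_congr fun k _ => not_congr ?_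
  rw [show (n : ℂ) + a + b + c + d - 1 + k = (k + n : ℂ) - 1 + (a + b + c + d) by ring]

theorem isFamily_wilson (n : ℕ) : Scheme.IsFamily wilsonScheme (wilson n) Set.univ n where
  mem_of_ne_zero _ _ := Set.mem_univ _
  natDegree_le a b c d := by
    rw [wilson_eq]
    exact natDegree_sum_smul_le (fun k => (natDegree_wilsonBasis a k).1.le) _ n
  op_eq τ _ := op_wilson τ n
  coeff_ne_zero_iff τ _ := by
    obtain ⟨f0, f1, -⟩ := form_four (fun _ => 1) τ
    rw [wilson_eq, sum_range_succ, coeff_add,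
      coeff_sum_smul (fun k => (natDegree_wilsonBasis (τ 0) k).1.le) _ fun k hk => mem_range.1 hk,
      zero_add, coeff_smul, smul_eq_mul, (natDegree_wilsonBasis _ n).2, mul_one,
      wilsonCoeff_self_ne_zero_iff, simple_wilsonScheme_iff, f0, f1]
    simp only [one_mul, mul_one]


/-! ### Parameters with a coincidence of two eigenvalues -/

/-- The product of the factors that vanish at a coincidence with a solution. -/
def wilsonResonance (m n : ℕ) (x₁ x₂ x₃ : ℂ) : ℂ :=
  poch (x₁ + m) (n - m) * poch (x₂ + m) (n - m) * poch (x₃ + m) (n - m)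

/-- The part of the Wilson polynomial of degree at most `m`, without the resonant factor. -/
def wilsonLow (m n : ℕ) (a A x₁ x₂ x₃ : ℂ) : ℂ[X] :=
  ∑ k ∈ range (m + 1), (poch (-n) k * poch A k / (k.factorial : ℂ) *
    (poch (x₁ + k) (m - k) * poch (x₂ + k) (m - k) * poch (x₃ + k) (m - k))) • wilsonBasis a k

/-- The part of the Wilson polynomial of degree above `m`, without the factor `A + m`. -/
def wilsonHigh (m n : ℕ) (a A x₁ x₂ x₃ : ℂ) : ℂ[X] :=
  ∑ k ∈ Ico (m + 1) (n + 1), (poch (-n) k *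
    (poch A m * poch (A + (m + 1)) (k - (m + 1))) / (k.factorial : ℂ) *
    (poch (x₁ + k) (n - k) * poch (x₂ + k) (n - k) * poch (x₃ + k) (n - k))) • wilsonBasis a k

/-- For `k ≤ m` every `(x + k)_(n-k)` contains `(x + m)_(n-m)`; for `k > m` the factor `(A)_k`
contains `A + m`, which is zero at a coincidence with degree `m`. -/
theorem wilson_split {m n : ℕ} (hmn : m < n) (a b c d : ℂ) :
    wilson n a b c d = wilsonResonance m n (a + b) (a + c) (a + d) •
        wilsonLow m n a (n + a + b + c + d - 1) (a + b) (a + c) (a + d) +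
      (n + a + b + c + d - 1 + m) •
        wilsonHigh m n a (n + a + b + c + d - 1) (a + b) (a + c) (a + d) := by
  rw [wilson_eq, ← sum_range_add_sum_Ico _ (show m + 1 ≤ n + 1 by omega), wilsonLow, wilsonHigh,
    smul_sum, smul_sum]
  congr 1
  · refine sum_congr rfl fun k hk => ?_
    have hk := mem_range.1 hk
    have hx : ∀ x : ℂ, poch (x + k) (n - k) = poch (x + k) (m - k) * poch (x + m) (n - m) :=
      fun x => by
        rw [show n - k = (m - k) + (n - m) by omega, poch_add, add_assoc x, ← Nat.cast_add,
          show k + (m - k) = m by omega]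
    rw [smul_smul, wilsonCoeff, hx, hx, hx, wilsonResonance]
    congr 1
    ring
  · refine sum_congr rfl fun k hk => ?_
    have hk := mem_Ico.1 hk
    have hA : ∀ A : ℂ, poch A k = poch A m * (A + m) * poch (A + (m + 1)) (k - (m + 1)) :=
      fun A => by
        rw [← poch_succ, ← Nat.cast_add_one, ← poch_add, show m + 1 + (k - (m + 1)) = k by omega]
    rw [smul_smul, wilsonCoeff, hA (n + a + b + c + d - 1)]
    congr 1
    ring

section tendsto

variable {a A x₁ x₂ x₃ : ℕ → ℂ} {a' A' x₁' x₂' x₃' : ℂ}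

theorem coeffTendsto_wilsonLow (ha : Tendsto a atTop (𝓝 a')) (hA : Tendsto A atTop (𝓝 A'))
    (h₁ : Tendsto x₁ atTop (𝓝 x₁')) (h₂ : Tendsto x₂ atTop (𝓝 x₂'))
    (h₃ : Tendsto x₃ atTop (𝓝 x₃')) (m n : ℕ) :
    CoeffTendsto (fun j => wilsonLow m n (a j) (A j) (x₁ j) (x₂ j) (x₃ j))
      (wilsonLow m n a' A' x₁' x₂' x₃') :=
  CoeffTendsto.sum _ fun k _ => CoeffTendsto.smul
    ((((tendsto_poch hA k).const_mul _).div_const _).mul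
      (((tendsto_poch (h₁.add_const _) _).mul (tendsto_poch (h₂.add_const _) _)).mul
        (tendsto_poch (h₃.add_const _) _))) (coeffTendsto_wilsonBasis ha k)

theorem coeffTendsto_wilsonHigh (ha : Tendsto a atTop (𝓝 a')) (hA : Tendsto A atTop (𝓝 A'))
    (h₁ : Tendsto x₁ atTop (𝓝 x₁')) (h₂ : Tendsto x₂ atTop (𝓝 x₂'))
    (h₃ : Tendsto x₃ atTop (𝓝 x₃')) (m n : ℕ) :
    CoeffTendsto (fun j => wilsonHigh m n (a j) (A j) (x₁ j) (x₂ j) (x₃ j))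
      (wilsonHigh m n a' A' x₁' x₂' x₃') :=
  CoeffTendsto.sum _ fun k _ => CoeffTendsto.smul
    (((((tendsto_poch hA _).mul (tendsto_poch (hA.add_const _) _)).const_mul _).div_const _).mul
      (((tendsto_poch (h₁.add_const _) _).mul (tendsto_poch (h₂.add_const _) _)).mul
        (tendsto_poch (h₃.add_const _) _))) (coeffTendsto_wilsonBasis ha k)

end tendsto

theorem natDegree_wilsonLow {m n : ℕ} (hmn : m < n) {A : ℂ} (hA : A + m = 0) (a x₁ x₂ x₃ : ℂ) :
    (wilsonLow m n a A x₁ x₂ x₃).natDegree = m ∧ wilsonLow m n a A x₁ x₂ x₃ ≠ 0 := by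
  have hc : (wilsonLow m n a A x₁ x₂ x₃).coeff m ≠ 0 := by
    rw [wilsonLow, sum_range_succ, coeff_add,
      coeff_sum_smul (fun k => (natDegree_wilsonBasis a k).1.le) _ fun k hk => mem_range.1 hk,
      zero_add, coeff_smul, smul_eq_mul, Nat.sub_self, (natDegree_wilsonBasis a m).2,
      eq_neg_of_add_eq_zero_left hA]
    simp only [poch_zero, mul_one]
    exact div_ne_zero (mul_ne_zero (poch_neg_ne_zero hmn.le) (poch_neg_ne_zero le_rfl))
      (Nat.cast_ne_zero.2 m.factorial_ne_zero)
  exact ⟨natDegree_eq_of_le_of_coeff_ne_zero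
    (natDegree_sum_smul_le (fun k => (natDegree_wilsonBasis a k).1.le) _ m) hc,
    fun h => hc (by rw [h, coeff_zero])⟩

/-- With `A = -m`, the part of `(A)_n` beyond the removed zero is `(1)_(n-m-1)`, a factorial. -/
theorem coeff_wilsonHigh {m n : ℕ} (hmn : m < n) {A : ℂ} (hA : A + m = 0) (a x₁ x₂ x₃ : ℂ) :
    (wilsonHigh m n a A x₁ x₂ x₃).natDegree ≤ n ∧ (wilsonHigh m n a A x₁ x₂ x₃).coeff n ≠ 0 := by
  constructor
  · exact natDegree_sum_le_of_forall_le _ _ fun k hk => (natDegree_smul_le _ _).trans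
      ((natDegree_wilsonBasis a k).1.le.trans (Nat.lt_succ_iff.1 (mem_Ico.1 hk).2))
  · rw [wilsonHigh, sum_Ico_succ_top (by omega), coeff_add,
      coeff_sum_smul (fun k => (natDegree_wilsonBasis a k).1.le) _ fun k hk => (mem_Ico.1 hk).2,
      zero_add, coeff_smul, smul_eq_mul, Nat.sub_self, (natDegree_wilsonBasis a n).2,
      ← add_assoc, hA, eq_neg_of_add_eq_zero_left hA]
    simp only [poch_zero, mul_one, zero_add]
    refine div_ne_zero (mul_ne_zero (poch_neg_ne_zero le_rfl) (mul_ne_zero (poch_neg_ne_zero le_rfl)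
      (poch_ne_zero_iff.2 fun j _ => ?_))) (Nat.cast_ne_zero.2 n.factorial_ne_zero)
    rw [add_comm]
    exact Nat.cast_add_one_ne_zero j

theorem continuous_wilsonResonance (m n : ℕ) (x₁ x₂ x₃ : ℂ) :
    Continuous fun ε => wilsonResonance m n (x₁ + ε) (x₂ + ε) (x₃ + ε) := by
  simp only [wilsonResonance, poch_eq_prod]
  fun_prop

theorem eventually_poch_ne_zero (x : ℂ) (k : ℕ) :
    ∀ᶠ j : ℕ in atTop, poch (x + 1 / ((j : ℂ) + 1)) k ≠ 0 := by
  simp only [poch_ne_zero_iff]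
  have h1 : Tendsto (fun j : ℕ => 1 / ((j : ℂ) + 1)) atTop (𝓝 0) :=
    tendsto_one_div_add_atTop_nhds_zero_nat
  have : ∀ l ∈ range k, ∀ᶠ j : ℕ in atTop, x + 1 / ((j : ℂ) + 1) + l ≠ 0 := by
    intro l _
    by_cases h : x + l = 0
    · refine Eventually.of_forall fun j => ?_
      rw [add_right_comm, h, zero_add]
      exact one_div_ne_zero (Nat.cast_add_one_ne_zero j)
    · have h2 := (h1.const_add x).add_const (l : ℂ)
      rw [add_zero] at h2
      exact h2.eventually_ne h
  filter_upwards [(Finset.eventually_all (range k)).2 this] with j hj l hl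
  exact hj l (mem_range.2 hl)

/-- The two scalars of `wilson_split` vanish together and are perturbed with a quotient that tends
to `γ`. -/
theorem wilsonHigh_add_mem_limits {m n : ℕ} (hmn : m < n) {a b c d : ℂ}
    (hA : n + a + b + c + d - 1 + m = 0)
    (hres : wilsonResonance m n (a + b) (a + c) (a + d) = 0) (γ : ℂ) :
    wilsonHigh m n a (n + a + b + c + d - 1) (a + b) (a + c) (a + d) +
      γ • wilsonLow m n a (n + a + b + c + d - 1) (a + b) (a + c) (a + d) ∈
      limits (wilson n) Set.univ n ![(a : OnePoint ℂ), b, c, d] := by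
  obtain ⟨ε, s, hε, hs, hs0, hlim⟩ := exists_rates
    (B := fun ε => wilsonResonance m n (a + b + ε) (a + c + ε) (a + d + ε))
    (by simpa using hres) (continuous_wilsonResonance m n _ _ _).continuousAt (by
      filter_upwards [eventually_poch_ne_zero (a + b + m) (n - m),
        eventually_poch_ne_zero (a + c + m) (n - m),
        eventually_poch_ne_zero (a + d + m) (n - m)] with j h1 h2 h3
      refine mul_ne_zero (mul_ne_zero ?_ ?_) ?_
      · rwa [add_right_comm]
      · rwa [add_right_comm]
      · rwa [add_right_comm]) γ
  -- Adding `r` to `a` and `ε - r` to the others moves `a + b`, `a + c`, `a + d` by `ε` and the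
  -- total sum by `3 ε - 2 r = s`.
  set r : ℕ → ℂ := fun j => (3 * ε j - s j) / 2 with hr
  have hr0 : Tendsto r atTop (𝓝 0) := by
    simpa using ((hε.const_mul 3).sub hs).div_const 2
  have hfina : Tendsto (fun j => a + r j) atTop (𝓝 a) := by simpa using hr0.const_add a
  have hfin : ∀ x : ℂ, Tendsto (fun j => x + ε j - r j) atTop (𝓝 x) := fun x => by
    simpa using (hε.const_add x).sub hr0
  have hfin' : ∀ x : ℂ, Tendsto (fun j => x + ε j) atTop (𝓝 x) := fun x => by
    simpa using hε.const_add x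
  set A := n + a + b + c + d - 1 with hAdef
  have hA' : Tendsto (fun j => A + s j) atTop (𝓝 A) := by simpa using hs.const_add A
  refine mem_limits_of_eventually_mem ?_
    (fun j => ![a + r j, b + ε j - r j, c + ε j - r j, d + ε j - r j])
    (Eventually.of_forall fun _ => Set.mem_univ _) ?_ (fun j => (s j)⁻¹) ?_
  · obtain ⟨h1, h2⟩ := coeff_wilsonHigh hmn hA a (a + b) (a + c) (a + d)
    obtain ⟨h3, -⟩ := natDegree_wilsonLow hmn hA a (a + b) (a + c) (a + d)
    refine natDegree_eq_of_le_of_coeff_ne_zero (natDegree_add_le_of_degree_le h1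
      ((natDegree_smul_le _ _).trans (h3.le.trans hmn.le))) ?_
    rwa [coeff_add, coeff_smul, coeff_eq_zero_of_natDegree_lt (h3.trans_lt hmn), smul_zero,
      add_zero]
  · intro i
    fin_cases i
    · exact tendsto_coe_coe_iff.2 hfina
    · exact tendsto_coe_coe_iff.2 (hfin b)
    · exact tendsto_coe_coe_iff.2 (hfin c)
    · exact tendsto_coe_coe_iff.2 (hfin d)
  · have key := (coeffTendsto_wilsonHigh hfina hA' (hfin' (a + b)) (hfin' (a + c)) (hfin' (a + d))
      m n).add (CoeffTendsto.smul hlim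
      (coeffTendsto_wilsonLow hfina hA' (hfin' (a + b)) (hfin' (a + c)) (hfin' (a + d)) m n))
    refine key.congr' ?_
    filter_upwards [hs0] with j hsj
    have e1 : ∀ x : ℂ, a + r j + (x + ε j - r j) = a + x + ε j := fun x => by ring
    have e2 : n + (a + r j) + (b + ε j - r j) + (c + ε j - r j) + (d + ε j - r j) - 1 = A + s j := by
      rw [hr, hAdef]; ring
    have e3 : A + s j + m = s j := by linear_combination hA
    change _ = (s j)⁻¹ • wilson n (a + r j) (b + ε j - r j) (c + ε j - r j) (d + ε j - r j)
    rw [wilson_split hmn, e2, e1, e1, e1, e3, smul_add, smul_smul, smul_smul, inv_mul_cancel₀ hsj,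
      one_smul, add_comm, div_eq_inv_mul]

theorem exists_wilsonResonance_eq_zero {m n : ℕ} (hmn : m < n) {τ : Fin 4 → ℂ}
    (hev : wilsonScheme.ev (form (fun _ => 1) τ) m = wilsonScheme.ev (form (fun _ => 1) τ) n)
    {f : ℂ[X]} (hf : f.natDegree = n) (hf0 : f ≠ 0)
    (h : wilsonScheme.op (form (fun _ => 1) τ) f = wilsonScheme.ev (form (fun _ => 1) τ) n • f) :
    wilsonResonance m n (τ 0 + τ 1) (τ 0 + τ 2) (τ 0 + τ 3) = 0 := by
  have hfl : f.coeff n ≠ 0 := by rw [← hf]; exact leadingCoeff_ne_zero.2 hf0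
  obtain ⟨k, hk1, hk2, hk3⟩ := exists_offDiagonal_eq_zero (op_wilsonBasis_zero τ)
    (op_wilsonBasis_succ τ) (fun k => (natDegree_wilsonBasis (τ 0) k).1) (wilsonBasis_ne_zero (τ 0))
    hmn hev hf.le hfl h
  rw [wilsonOffDiagonal, neg_eq_zero, mul_eq_zero, or_iff_right (Nat.cast_add_one_ne_zero k),
    mul_eq_zero, mul_eq_zero] at hk3
  have hz : ∀ x : ℂ, x + k = 0 → poch (x + m) (n - m) = 0 := fun x hx => by
    by_contra h0
    refine poch_ne_zero_iff.1 h0 (k - m) (by omega) ?_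
    rw [add_assoc, ← Nat.cast_add, show m + (k - m) = k by omega]
    exact hx
  rw [wilsonResonance]
  rcases hk3 with (h1 | h1) | h1 <;> simp [hz _ h1]

/-! ### Two infinite parameters -/

/-- The hypotheses describe two infinite parameters: `Φ` has degree at most one, `Ψ` is constant,
and the operator lowers degrees. -/
theorem coeff_op_wilsonScheme {F f : ℂ[X]} {m : ℕ} (h0 : F.coeff 0 = 0) (h1 : F.coeff 1 = 0)
    (hf : f.natDegree ≤ m + 1) :
    (wilsonScheme.op F f).coeff m = -((m + 1) * (F.coeff 2 * m + F.coeff 3)) * f.coeff (m + 1) := by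
  obtain ⟨c2, c1, -, d1, d0⟩ := coeff_wilsonScheme F
  have hΦ : (wilsonScheme.Φ F).natDegree ≤ 0 + 1 := by
    refine natDegree_le_iff_coeff_eq_zero.2 fun k hk => ?_
    rcases (Nat.succ_le_of_lt hk).eq_or_lt with rfl | hk
    · exact c2.trans h0
    · exact coeff_eq_zero_of_natDegree_lt ((wilsonScheme.natDegree_Φ F).trans_lt hk)
  have hΨ : (wilsonScheme.Ψ F).natDegree ≤ 0 := by
    refine natDegree_le_iff_coeff_eq_zero.2 fun k hk => ?_
    rcases (Nat.succ_le_of_lt hk).eq_or_lt with rfl | hk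
    · exact d1.trans h1
    · exact coeff_eq_zero_of_natDegree_lt ((wilsonScheme.natDegree_Ψ F).trans_lt hk)
  have := (wilsonScheme.slOp_degree hΦ hΨ hf).2
  rw [zero_add, zero_add, c1, d0, leadPair_wilsonScheme, leadPair_wilsonScheme] at this
  rw [Scheme.op, this]
  push_cast
  ring

theorem coeff_two_three_of_eigenvector {F f : ℂ[X]} {m : ℕ} (h0 : F.coeff 0 = 0)
    (h1 : F.coeff 1 = 0) (hf : f.natDegree = m + 1) (hop : wilsonScheme.op F f = 0) :
    F.coeff 2 * m + F.coeff 3 = 0 := by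
  have hc := coeff_op_wilsonScheme h0 h1 hf.le
  have hl : f.coeff (m + 1) ≠ 0 := by
    rw [← hf, coeff_natDegree, leadingCoeff_ne_zero]
    rintro rfl
    simp at hf
  rwa [hop, coeff_zero, eq_comm, mul_eq_zero, or_iff_left hl, neg_eq_zero, mul_eq_zero,
    or_iff_right (Nat.cast_add_one_ne_zero m)] at hc

/-- The solutions combine the top basis element with a constant. The free constant is the trace left
by a perturbation of `a + b` of order `w ^ n`. -/
theorem wilsonBasis_add_mem_limits {m : ℕ} {a b : ℂ} (hab : a + b + m = 0)
    {t : Fin 4 → OnePoint ℂ} {σ : Equiv.Perm (Fin 4)}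
    (ht : ∀ i, t (σ i) = ![(a : OnePoint ℂ), b, OnePoint.infty, OnePoint.infty] i) :
    ∃ ρ : ℂ, ρ ≠ 0 ∧ ∀ γ : ℂ, ρ • wilsonBasis a (m + 1) + γ • (1 : ℂ[X]) ∈
      limits (wilson (m + 1)) Set.univ (m + 1) t := by
  set n := m + 1 with hn
  set Θ : ℂ := poch (a + b) m with hΘ
  have hΘ0 : Θ ≠ 0 := by
    rw [hΘ, eq_neg_of_add_eq_zero_left hab]
    exact poch_neg_ne_zero le_rfl
  set ρ : ℂ := poch (-n) n / (n.factorial : ℂ) with hρ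
  have hρ0 : ρ ≠ 0 := div_ne_zero (poch_neg_ne_zero le_rfl)
    (Nat.cast_ne_zero.2 n.factorial_ne_zero)
  refine ⟨ρ, hρ0, fun γ => ?_⟩
  set g := γ / Θ with hg
  set N : ℕ → ℂ := fun j => (j : ℂ) + 1 with hN
  set w : ℕ → ℂ := fun j => 1 / ((j : ℂ) + 1) with hw
  have hN0 : ∀ j, N j ≠ 0 := fun j => Nat.cast_add_one_ne_zero j
  have hNw : ∀ j, N j * w j = 1 := fun j => mul_one_div_cancel (hN0 j)
  have hw0 : ∀ j, w j ≠ 0 := fun j => right_ne_zero_of_mul_eq_one (hNw j)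
  have hwt : Tendsto w atTop (𝓝 0) := tendsto_one_div_add_atTop_nhds_zero_nat
  have hcont : ∀ {h : ℂ → ℂ}, Continuous h → Tendsto (fun j => h (w j)) atTop (𝓝 (h 0)) :=
    fun hh => (hh.tendsto 0).comp hwt
  have hpow : ∀ {l : ℕ}, l ≠ 0 → Tendsto (fun j => N j ^ l) atTop (Bornology.cobounded ℂ) := by
    intro l hl
    have h2 : Tendsto (fun j => w j ^ l) atTop (𝓝[≠] 0) :=
      tendsto_nhdsWithin_iff.2 ⟨by simpa [hl] using hwt.pow l,
        Eventually.of_forall fun j => pow_ne_zero l (hw0 j)⟩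
    refine (tendsto_inv₀_nhdsNE_zero.comp h2).congr fun j => ?_
    change (w j ^ l)⁻¹ = N j ^ l
    rw [inv_eq_iff_eq_inv, ← inv_pow, eq_inv_of_mul_eq_one_right (hNw j)]
  have hbt : Tendsto (fun j => b + g * w j ^ n) atTop (𝓝 b) := by
    have := hcont (h := fun x => b + g * x ^ n) (by fun_prop)
    simpa [hn] using this
  set A : ℕ → ℂ := fun j => n + a + (b + g * w j ^ n) + N j + N j ^ 2 - 1 with hA
  have hAt : Tendsto (fun j => A j * w j ^ 2) atTop (𝓝 1) := by
    have h := hcont (h := fun x => (n + a + (b + g * x ^ n) - 1) * x ^ 2 + x + 1) (by fun_prop)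
    simp only [ne_eq, OfNat.ofNat_ne_zero, not_false_eq_true, zero_pow, mul_zero, zero_add] at h
    refine h.congr fun j => ?_
    rw [hA]
    linear_combination (-(w j) - (N j * w j + 1)) * hNw j
  -- The total sum and `d` have order `N²`, `c` has order `N`, and `a + b + n - 1` equals `g * w ^
  -- n`. After multiplication by `w ^ (2n)` the coefficient `k < n` has order `w ^ k`, so only `k =
  -- 0` and `k = n` survive.
  set τ : ℕ → Fin 4 → ℂ := fun j => ![a, b + g * w j ^ n, N j, N j ^ 2] with hτ
  have hf0 : ∀ j, (form (fun _ => 1) (τ j)).coeff 0 = 1 := fun j => by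
    rw [(form_four _ _).1]; norm_num
  have hf1 : ∀ j, (form (fun _ => 1) (τ j)).coeff 1 = A j - n + 1 := fun j => by
    rw [(form_four _ _).2.1]
    change a * 1 * 1 * 1 + 1 * (b + g * w j ^ n) * 1 * 1 + 1 * 1 * N j * 1 + 1 * 1 * 1 * N j ^ 2 = _
    rw [hA]
    ring
  refine (isFamily_wilson n).mem_limits_perm σ (τ := τ)
    (f := fun j => (w j ^ 2) ^ n • wilson n (τ j 0) (τ j 1) (τ j 2) (τ j 3))
    (Eventually.of_forall fun _ => Set.mem_univ _) ?_ ?_ ?_ ?_ ?_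
  · intro i
    rw [ht]
    fin_cases i
    · exact tendsto_const_nhds
    · exact tendsto_coe_coe_iff.2 hbt
    · exact tendsto_coe_infty_iff.2 ((hpow one_ne_zero).congr fun j => pow_one _)
    · exact tendsto_coe_infty_iff.2 (hpow two_ne_zero)
  · have hs : ∀ k ∈ range n, ∀ᶠ j in atTop, 1 * ((k + n : ℂ) - 1) + (A j - n + 1) ≠ 0 := by
      intro k _
      have h1 := (hAt.add (((hwt.pow 2).const_mul (k : ℂ)))).eventually_ne
        (show (1 : ℂ) + k * 0 ^ 2 ≠ 0 by norm_num)
      filter_upwards [h1] with j hj h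
      apply hj
      linear_combination w j ^ 2 * h
    filter_upwards [(Finset.eventually_all (range n)).2 hs] with j hj
    refine (simple_wilsonScheme_iff _ n).2 fun k hk => ?_
    rw [hf0, hf1]
    exact hj k (mem_range.2 hk)
  · have h1 : (γ • (1 : ℂ[X])).natDegree ≤ 0 := (natDegree_smul_le _ _).trans (by simp)
    obtain ⟨h2, h3⟩ := natDegree_wilsonBasis a n
    refine natDegree_eq_of_le_of_coeff_ne_zero (natDegree_add_le_of_degree_le
      ((natDegree_smul_le _ _).trans h2.le) (h1.trans (by omega))) ?_
    rw [coeff_add, coeff_smul, coeff_eq_zero_of_natDegree_lt (h1.trans_lt (by omega)), add_zero, h3,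
      smul_eq_mul, mul_one]
    exact hρ0
  · have hlimit : ρ • wilsonBasis a n + γ • (1 : ℂ[X]) = ∑ k ∈ range (n + 1),
        (if k = n then ρ else if k = 0 then γ else 0) • wilsonBasis a k := by
      rw [sum_range_succ, if_pos rfl, add_comm, sum_eq_single_of_mem 0 (mem_range.2 (by omega))]
      · rw [if_neg (by omega), if_pos rfl, show wilsonBasis a 0 = 1 by simp [wilsonBasis]]
      · intro k hk hk0
        rw [if_neg (mem_range.1 hk).ne, if_neg hk0, zero_smul]
    rw [hlimit]
    simp only [wilson_eq, smul_sum, smul_smul]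
    refine CoeffTendsto.sum _ fun k hk => CoeffTendsto.smul ?_ (CoeffTendsto.const _)
    have hk := mem_range.1 hk
    have hw2 : Tendsto (fun j => w j ^ 2) atTop (𝓝 0) := by simpa using hwt.pow 2
    have hcoeff : ∀ j, wilsonCoeff n (τ j 0) (τ j 1) (τ j 2) (τ j 3) k =
        poch (-n) k * poch (A j) k / (k.factorial : ℂ) * (poch (a + (b + g * w j ^ n) + k) (n - k) *
          poch (a + N j + k) (n - k) * poch (a + N j ^ 2 + k) (n - k)) := fun j => rfl
    by_cases hkn : k = n
    · rw [hkn] at hcoeff ⊢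
      rw [if_pos rfl]
      have h1 := ((tendsto_poch_scaled hAt hw2 n).const_mul (poch (-n) n)).div_const
        (n.factorial : ℂ)
      rw [one_pow, mul_one] at h1
      refine h1.congr fun j => ?_
      rw [hcoeff, Nat.sub_self, poch_zero, poch_zero, poch_zero]
      ring
    · rw [if_neg hkn]
      have hkm : k ≤ m := by omega
      have hwc : Tendsto (fun j => (a + N j + k) * w j) atTop (𝓝 1) := by
        have h := hcont (h := fun x => (a + k) * x + 1) (by fun_prop)
        simp only [mul_zero, zero_add] at h
        exact h.congr fun j => by linear_combination -hNw j
      have hwd : Tendsto (fun j => (a + N j ^ 2 + k) * w j ^ 2) atTop (𝓝 1) := by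
        have h := hcont (h := fun x => (a + k) * x ^ 2 + 1) (by fun_prop)
        simp only [ne_eq, OfNat.ofNat_ne_zero, not_false_eq_true, zero_pow, mul_zero,
          zero_add] at h
        exact h.congr fun j => by linear_combination -(N j * w j + 1) * hNw j
      have key := ((((((tendsto_poch_scaled hAt hw2 k).const_mul
        (poch (-n) k / (k.factorial : ℂ))).mul
        (tendsto_poch ((hbt.const_add a).add_const (k : ℂ)) (m - k))).mul_const g).mul
        (tendsto_poch_scaled hwc hwt (n - k))).mul
        (tendsto_poch_scaled hwd hw2 (n - k))).mul (hwt.pow k)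
      have hlim : poch (-n) k / (k.factorial : ℂ) * 1 ^ k * poch (a + b + k) (m - k) * g *
          1 ^ (n - k) * 1 ^ (n - k) * 0 ^ k = if k = 0 then γ else 0 := by
        split_ifs with h0
        · subst h0
          simp only [poch_zero, one_pow, pow_zero, mul_one, Nat.factorial_zero, Nat.cast_one,
            Nat.cast_zero, add_zero, Nat.sub_zero, div_one, one_mul]
          rw [← hΘ, hg, mul_div_cancel₀ _ hΘ0]
        · rw [zero_pow h0, mul_zero]
      rw [hlim] at key
      refine key.congr fun j => ?_
      have e1 : poch (a + (b + g * w j ^ n) + k) (n - k) =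
          poch (a + (b + g * w j ^ n) + k) (m - k) * (g * w j ^ n) := by
        rw [show n - k = m - k + 1 by omega, poch_succ]
        congr 1
        push_cast [hkm]
        linear_combination hab
      have e2 : (w j ^ 2) ^ n * w j ^ n = (w j ^ 2) ^ k * w j ^ (n - k) * (w j ^ 2) ^ (n - k) *
          w j ^ k := by
        rw [← pow_mul, ← pow_mul, ← pow_mul, ← pow_add, ← pow_add, ← pow_add, ← pow_add]
        congr 1
        omega
      rw [hcoeff, e1]
      linear_combination (-(poch (-n) k / (k.factorial : ℂ) * poch (A j) k *
        poch (a + (b + g * w j ^ n) + k) (m - k) * g * poch (a + N j + k) (n - k) *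
        poch (a + N j ^ 2 + k) (n - k))) * e2
  · refine Eventually.of_forall fun j => ⟨(natDegree_smul_le _ _).trans
      ((isFamily_wilson n).natDegree_le _ _ _ _), ?_⟩
    rw [map_smul, op_wilson, smul_comm]

/-- Four infinite parameters in degree one. -/
theorem mem_limits_wilsonScheme_one {t : Fin 4 → OnePoint ℂ} (ht : ∀ i, t i = OnePoint.infty)
    {Q : ℂ[X]} (hQ : Q.natDegree = 1) : Q ∈ limits (wilson 1) Set.univ 1 t := by
  have hQ1 : Q.coeff 1 ≠ 0 := by
    rw [← hQ, coeff_natDegree, leadingCoeff_ne_zero]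
    rintro rfl
    simp at hQ
  have hI : (1 : ℂ) + Complex.I ≠ 0 := fun h => by
    have := congrArg Complex.re h
    norm_num at this
  -- Chosen so that `(1 + I) g / 2`, the limit of the quotient of the third and first symmetric
  -- functions, is `-Q.coeff 0 / Q.coeff 1`.
  set g : ℂ := -2 * (Q.coeff 0 / Q.coeff 1) / (1 + Complex.I) with hg
  set N : ℕ → ℂ := fun j => (j : ℂ) + 1 with hN
  set w : ℕ → ℂ := fun j => 1 / ((j : ℂ) + 1) with hw
  have hN0 : ∀ j, N j ≠ 0 := fun j => Nat.cast_add_one_ne_zero j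
  have hNw : ∀ j, N j * w j = 1 := fun j => mul_one_div_cancel (hN0 j)
  have hw0 : ∀ j, w j ≠ 0 := fun j => right_ne_zero_of_mul_eq_one (hNw j)
  have hwt : Tendsto w atTop (𝓝 0) := tendsto_one_div_add_atTop_nhds_zero_nat
  -- The extra `w j` keeps `u` nonzero even when `g = 0`.
  set u : ℕ → ℂ := fun j => w j * (g + w j) with hu
  have hut : Tendsto u atTop (𝓝 0) := by
    have h := hwt.mul (hwt.const_add g)
    rwa [zero_mul] at h
  have hu0 : ∀ᶠ j in atTop, u j ≠ 0 := by
    have : ∀ᶠ j in atTop, g + w j ≠ 0 := by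
      by_cases h : g = 0
      · exact Eventually.of_forall fun j => by rw [h, zero_add]; exact hw0 j
      · have h2 := hwt.const_add g
        rw [add_zero] at h2
        exact h2.eventually_ne h
    exact this.mono fun j hj => mul_ne_zero (hw0 j) hj
  -- The sequence is the inverse of `w (c + w v)⁻¹`, which tends to zero and is eventually nonzero.
  have hlarge : ∀ c : ℂ, c ≠ 0 → ∀ v : ℕ → ℂ, Tendsto v atTop (𝓝 0) →
      Tendsto (fun j => c * N j + v j) atTop (Bornology.cobounded ℂ) := by
    intro c hc v hv
    have h3 : Tendsto (fun j => w j * (c + w j * v j)⁻¹) atTop (𝓝 0) := by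
      have h := hwt.mul (((hwt.mul hv).const_add c).inv₀ (by simpa using hc))
      rwa [zero_mul] at h
    have h4 : ∀ᶠ j in atTop, c + w j * v j ≠ 0 :=
      ((hwt.mul hv).const_add c).eventually_ne (by simpa using hc)
    have h5 : Tendsto (fun j => w j * (c + w j * v j)⁻¹) atTop (𝓝[≠] 0) :=
      tendsto_nhdsWithin_iff.2 ⟨h3, h4.mono fun j hj => mul_ne_zero (hw0 j) (inv_ne_zero hj)⟩
    refine (tendsto_inv₀_nhdsNE_zero.comp h5).congr fun j => ?_
    change (w j * (c + w j * v j)⁻¹)⁻¹ = _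
    rw [mul_inv, inv_inv, ← eq_inv_of_mul_eq_one_left (hNw j)]
    linear_combination v j * hNw j
  -- The pairs have sum `u` and products `N u - N²` and `I N u + N²`; the factor `I` makes the
  -- squares cancel in the third symmetric function, which becomes comparable to the first. The
  -- eigenvector used is again `Ψ`.
  set τ : ℕ → Fin 4 → ℂ := fun j =>
    ![N j, -N j + u j, Complex.I * N j, -(Complex.I * N j) + u j] with hτ
  have c0 : ∀ j, (form (fun _ => 1) (τ j)).coeff 0 = 1 := fun j => by
    rw [(form_four _ _).1]; norm_num
  have c1 : ∀ j, (form (fun _ => 1) (τ j)).coeff 1 = 2 * u j := fun j => by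
    rw [(form_four _ _).2.1]
    change N j * 1 * 1 * 1 + 1 * (-N j + u j) * 1 * 1 + 1 * 1 * (Complex.I * N j) * 1 +
      1 * 1 * 1 * (-(Complex.I * N j) + u j) = _
    ring
  have c3 : ∀ j, (form (fun _ => 1) (τ j)).coeff 3 = 2 * u j * ((1 + Complex.I) * (g + w j) / 2) :=
    fun j => by
      rw [(form_four _ _).2.2.2.1]
      change 1 * (-N j + u j) * (Complex.I * N j) * (-(Complex.I * N j) + u j) +
        N j * 1 * (Complex.I * N j) * (-(Complex.I * N j) + u j) +
        N j * (-N j + u j) * 1 * (-(Complex.I * N j) + u j) +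
        N j * (-N j + u j) * (Complex.I * N j) * 1 = _
      have e : N j * u j = g + w j := by
        rw [hu]
        linear_combination (g + w j) * hNw j
      linear_combination (1 + Complex.I) * u j * e - N j ^ 2 * u j * Complex.I_sq
  refine (isFamily_wilson 1).mem_limits_perm (Equiv.refl _) (τ := τ)
    (f := fun j => (Q.coeff 1 / (2 * u j)) • wilsonScheme.Ψ (form (fun _ => 1) (τ j)))
    (Eventually.of_forall fun _ => Set.mem_univ _) ?_ ?_ hQ ?_ ?_
  · intro i
    rw [ht, tendsto_coe_infty_iff]
    fin_cases i
    · exact (hlarge 1 one_ne_zero _ tendsto_const_nhds).congr fun j => by simp [hτ]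
    · exact (hlarge (-1) (neg_ne_zero.2 one_ne_zero) _ hut).congr fun j => by simp [hτ]
    · exact (hlarge _ Complex.I_ne_zero _ tendsto_const_nhds).congr fun j => by simp [hτ]
    · exact (hlarge _ (neg_ne_zero.2 Complex.I_ne_zero) _ hut).congr fun j => by simp [hτ]
  · filter_upwards [hu0] with j hj
    refine (simple_wilsonScheme_iff _ 1).2 fun k hk => ?_
    have hk0 : k = 0 := by omega
    rw [hk0, c0, c1]
    simpa using hj
  · have key : CoeffTendsto (fun j => Q.coeff 1 • (X : ℂ[X]) -
        (Q.coeff 1 * ((1 + Complex.I) * (g + w j) / 2)) • (1 : ℂ[X])) Q := by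
      have h := (CoeffTendsto.const (Q.coeff 1 • (X : ℂ[X]))).sub (CoeffTendsto.smul
        ((((hwt.const_add g).const_mul (1 + Complex.I)).div_const 2).const_mul (Q.coeff 1))
        (CoeffTendsto.const (1 : ℂ[X])))
      have e : Q.coeff 1 • (X : ℂ[X]) -
          (Q.coeff 1 * ((1 + Complex.I) * (g + 0) / 2)) • (1 : ℂ[X]) = Q := by
        conv_rhs => rw [eq_X_add_C_of_natDegree_le_one hQ.le]
        rw [show Q.coeff 1 * ((1 + Complex.I) * (g + 0) / 2) = -Q.coeff 0 by
          rw [hg]; field_simp; ring, neg_smul, sub_neg_eq_add, smul_eq_C_mul, smul_eq_C_mul,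
          mul_one]
      rwa [e] at h
    refine key.congr' ?_
    filter_upwards [hu0] with j hj
    rw [wilsonScheme_Ψ, c1, c3, smul_sub, smul_smul, smul_smul]
    congr 2
    · field_simp
    · field_simp
  · refine Eventually.of_forall fun j => ⟨(natDegree_smul_le _ _).trans
      (wilsonScheme.natDegree_Ψ _), ?_⟩
    rw [map_smul, Scheme.op, LatticeData.slOp_self _ (wilsonScheme.natDegree_Ψ _), smul_comm]
    rfl


/-! ### Completeness of the Wilson family -/

theorem eigenvectors_subset_of_wilsonResonance {m n : ℕ} (hmn : m < n) {a b c d : ℂ}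
    (h : (m + n : ℂ) - 1 + (a + b + c + d) = 0) :
    wilsonScheme.eigenvectors (wilsonScheme.Φ (form (fun _ => 1) ![a, b, c, d]))
      (wilsonScheme.Ψ (form (fun _ => 1) ![a, b, c, d])) n ⊆
      limits (wilson n) Set.univ n ![(a : OnePoint ℂ), b, c, d] := by
  set F := form (fun _ => 1) ![a, b, c, d] with hF
  obtain ⟨f0, f1, -⟩ := form_four (fun _ => 1) ![a, b, c, d]
  have f0' : F.coeff 0 = 1 := by rw [hF, f0]; norm_num
  have f1' : F.coeff 1 = a + b + c + d := by rw [hF, f1]; simp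
  have hA : n + a + b + c + d - 1 + m = 0 := by linear_combination h
  intro Q hQ
  have hQ0 : Q ≠ 0 := by
    rintro rfl
    have := hQ.1
    rw [natDegree_zero] at this
    omega
  have hres := exists_wilsonResonance_eq_zero hmn (τ := ![a, b, c, d])
    ((ev_wilsonScheme_eq_iff _ hmn.ne).2 (by rw [← hF, f0', f1', one_mul]; exact h)) hQ.1 hQ0 hQ.2
  obtain ⟨hU, hU0⟩ := natDegree_wilsonLow hmn hA a (a + b) (a + c) (a + d)
  refine wilsonScheme.eigenvectors_subset_of_plane (m := m) (by omega) (fun f hf hfn hop => ?_)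
    hU0 hU hmn (fun hP hc => smul_mem_limits hP hc) ?_
    (wilsonHigh_add_mem_limits hmn hA hres) hQ
  · have h1 := wilsonScheme.eq_eig_of_slOp_eq (wilsonScheme.natDegree_Φ _)
      (wilsonScheme.natDegree_Ψ _) hf hop
    have h2 := (ev_wilsonScheme_eq_iff F hfn.ne).1 h1.symm
    rw [f0', one_mul, f1', ← h] at h2
    have h3 : (f.natDegree : ℂ) = m := by linear_combination h2
    exact Nat.cast_injective h3
  · have := (isFamily_wilson n).limits_subset ![(a : OnePoint ℂ), b, c, d]
    rw [← coe_vec_four] at this ⊢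
    rwa [sphereForm_coe] at this

theorem sphereForm_of_infty_infty {t : Fin 4 → OnePoint ℂ} {σ : Equiv.Perm (Fin 4)}
    (h2 : t (σ 2) = OnePoint.infty) (h3 : t (σ 3) = OnePoint.infty) :
    (sphereForm t).coeff 0 = 0 ∧ (sphereForm t).coeff 1 = 0 ∧
    (sphereForm t).coeff 2 = uCoord (t (σ 0)) * uCoord (t (σ 1)) ∧
    (sphereForm t).coeff 3 =
      uCoord (t (σ 0)) * vCoord (t (σ 1)) + vCoord (t (σ 0)) * uCoord (t (σ 1)) := by
  obtain ⟨f0, f1, f2, f3, -⟩ := form_four (fun i => uCoord (t (σ i))) fun i => vCoord (t (σ i))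
  rw [← sphereForm_comp_perm σ]
  change (form _ _).coeff 0 = _ ∧ (form _ _).coeff 1 = _ ∧ (form _ _).coeff 2 = _ ∧
    (form _ _).coeff 3 = _
  rw [f0, f1, f2, f3, h2, h3]
  simp

/-- All eigenvalues are zero. A kernel element of degree `k + 1` forces `a + b + k = 0` if the other
parameters are finite; if one of them is infinite, both are, and the operator is `𝔻²`. -/
theorem eigenvectors_subset_of_infty_infty {t : Fin 4 → OnePoint ℂ} {σ : Equiv.Perm (Fin 4)}
    (h2 : t (σ 2) = OnePoint.infty) (h3 : t (σ 3) = OnePoint.infty) (m : ℕ) :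
    wilsonScheme.eigenvectors (wilsonScheme.Φ (sphereForm t)) (wilsonScheme.Ψ (sphereForm t))
      (m + 1) ⊆ limits (wilson (m + 1)) Set.univ (m + 1) t := by
  obtain ⟨f0, f1, f2, f3⟩ := sphereForm_of_infty_infty h2 h3
  have hev : wilsonScheme.ev (sphereForm t) (m + 1) = 0 := by
    rw [ev_wilsonScheme, f0, f1]
    ring
  have hone : ∀ {k : ℕ} {f : ℂ[X]}, f.natDegree = k + 1 →
      wilsonScheme.op (sphereForm t) f = wilsonScheme.ev (sphereForm t) (m + 1) • f →
      uCoord (t (σ 0)) * uCoord (t (σ 1)) * k +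
        (uCoord (t (σ 0)) * vCoord (t (σ 1)) + vCoord (t (σ 0)) * uCoord (t (σ 1))) = 0 := by
    intro k f hf hop
    rw [hev, zero_smul] at hop
    rw [← f2, ← f3]
    exact coeff_two_three_of_eigenvector f0 f1 hf hop
  intro Q hQ
  have huv := hone hQ.1 hQ.2
  by_cases hu : uCoord (t (σ 0)) * uCoord (t (σ 1)) = 0
  · have hinf : t (σ 0) = OnePoint.infty ∧ t (σ 1) = OnePoint.infty := by
      rcases mul_eq_zero.1 hu with h | h
      · have h0 := eq_infty_of_uCoord_eq_zero h
        rw [h0, uCoord_infty, vCoord_infty, zero_mul, zero_mul, zero_mul, zero_add, zero_add,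
          one_mul] at huv
        exact ⟨h0, eq_infty_of_uCoord_eq_zero huv⟩
      · have h0 := eq_infty_of_uCoord_eq_zero h
        rw [h0, uCoord_infty, vCoord_infty, mul_zero, mul_zero, zero_mul, zero_add, add_zero,
          mul_one] at huv
        exact ⟨eq_infty_of_uCoord_eq_zero huv, h0⟩
    have ht : ∀ i, t i = OnePoint.infty := by
      intro i
      rw [← σ.apply_symm_apply i]
      generalize σ.symm i = j
      fin_cases j
      · exact hinf.1
      · exact hinf.2
      · exact h2
      · exact h3
    have hF : sphereForm t = X ^ 4 := by
      simp only [sphereForm, form, ht]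
      simp
    have hdd : wilsonScheme.dOp (wilsonScheme.dOp Q) = 0 := by
      have := hQ.2
      change wilsonScheme.slOp _ _ Q = wilsonScheme.ev (sphereForm t) (m + 1) • Q at this
      rw [hev, zero_smul, LatticeData.slOp_apply, hF, wilsonScheme_Φ, wilsonScheme_Ψ] at this
      simpa [coeff_X_pow] using this
    have hm := wilsonScheme.natDegree_eq_one_of_dOp_dOp_eq_zero
      (fun n hn => by
        rw [leadPair_wilsonScheme]
        exact Nat.cast_ne_zero.2 (by omega)) (by rw [hQ.1]; omega) hdd
    obtain rfl : m = 0 := by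
      have := hQ.1
      omega
    exact mem_limits_wilsonScheme_one ht hm
  · obtain ⟨a, ha⟩ := eq_coe_of_uCoord_ne_zero (left_ne_zero_of_mul hu)
    obtain ⟨b, hb⟩ := eq_coe_of_uCoord_ne_zero (right_ne_zero_of_mul hu)
    have hcoe : ∀ k : ℕ, uCoord (t (σ 0)) * uCoord (t (σ 1)) * k +
        (uCoord (t (σ 0)) * vCoord (t (σ 1)) + vCoord (t (σ 0)) * uCoord (t (σ 1))) =
        a + b + k := fun k => by
      rw [ha, hb, uCoord_coe, uCoord_coe, vCoord_coe, vCoord_coe]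
      ring
    have hab : a + b + m = 0 := (hcoe m).symm.trans huv
    have ht : ∀ i, t (σ i) = ![(a : OnePoint ℂ), b, OnePoint.infty, OnePoint.infty] i := by
      intro i
      fin_cases i
      · exact ha
      · exact hb
      · exact h2
      · exact h3
    obtain ⟨ρ, -, hmem⟩ := wilsonBasis_add_mem_limits hab ht
    refine wilsonScheme.eigenvectors_subset_of_plane (m := 0) (by omega) (fun f hf hfn hop => ?_)
      one_ne_zero natDegree_one (by omega) (fun hP hc => smul_mem_limits hP hc)
      ((isFamily_wilson _).limits_subset t) hmem hQ
    by_contra h0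
    obtain ⟨k, hk⟩ := Nat.exists_eq_succ_of_ne_zero h0
    have h4 : a + b + k = 0 := (hcoe k).symm.trans (hone hk hop)
    have h5 : (k : ℂ) = m := by linear_combination h4 - hab
    have := Nat.cast_injective h5
    omega

/-- The eigenvectors belong to the Wilson family. -/
theorem eigenvectors_subset_wilson (t : Fin 4 → OnePoint ℂ) {n : ℕ} (hn : 1 ≤ n) :
    wilsonScheme.eigenvectors (wilsonScheme.Φ (sphereForm t)) (wilsonScheme.Ψ (sphereForm t)) n ⊆
      limits (wilson n) Set.univ n t := by
  by_cases hs : wilsonScheme.Simple (sphereForm t) n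
  · exact (isFamily_wilson n).eigenvectors_subset_of_simple hn hs
  rw [simple_wilsonScheme_iff] at hs
  push Not at hs
  obtain ⟨m, hmn, h⟩ := hs
  by_cases hinf : ∃ i, t i = OnePoint.infty
  · obtain ⟨i, hi⟩ := hinf
    have hF0 : (sphereForm t).coeff 0 = 0 := by
      rw [sphereForm, coeff_zero_form]
      exact prod_eq_zero (mem_univ i) (by rw [hi, uCoord_infty])
    rw [hF0, zero_mul, zero_add] at h
    -- With one infinite parameter, the coefficient of `X` is the product of the other three
    -- `uCoord`; its vanishing produces a second infinite parameter.
    obtain ⟨j, hij, hj⟩ : ∃ j, j ≠ i ∧ uCoord (t j) = 0 := by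
      obtain ⟨f0, f1, -⟩ := form_four (fun k => uCoord (t k)) fun k => vCoord (t k)
      change (sphereForm t).coeff 1 = _ at f1
      rw [f1] at h
      by_contra! hne
      fin_cases i
      all_goals
        simp only [Fin.zero_eta, Fin.mk_one, Fin.reduceFinMk] at hi
        simp only [hi, uCoord_infty, vCoord_infty, zero_mul, mul_zero, zero_add, add_zero, one_mul,
          mul_one, mul_eq_zero] at h
        rcases h with (h | h) | h <;> exact hne _ (by decide) h
    have hj := eq_infty_of_uCoord_eq_zero hj
    obtain ⟨σ, rfl, rfl⟩ := exists_perm_two_three hij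
    obtain ⟨n, rfl⟩ := Nat.exists_eq_add_of_le' hn
    exact eigenvectors_subset_of_infty_infty hj hi n
  · obtain ⟨τ, rfl⟩ := exists_coe_of_uCoord_ne_zero (t := t) fun i hi =>
      hinf ⟨i, eq_infty_of_uCoord_eq_zero hi⟩
    obtain ⟨f0, f1, -⟩ := form_four (fun _ => 1) τ
    rw [sphereForm_coe, f0, f1] at h
    simp only [one_mul, mul_one] at h
    have hτ : τ = ![τ 0, τ 1, τ 2, τ 3] := by
      funext i
      fin_cases i <;> rfl
    have := eigenvectors_subset_of_wilsonResonance hmn h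
    rw [← coe_vec_four, ← hτ] at this
    rwa [sphereForm_coe]

theorem wilsonScheme_injective {F : ℂ[X]} (hF : F.natDegree ≤ 4)
    (hΦ : wilsonScheme.Φ F = 0) (hΨ : wilsonScheme.Ψ F = 0) : F = 0 := by
  obtain ⟨c2, c1, c0, d1, d0⟩ := coeff_wilsonScheme F
  rw [hΦ, coeff_zero] at c2 c1 c0
  rw [hΨ, coeff_zero] at d1 d0
  ext k
  rw [coeff_zero]
  by_cases hk : k ≤ 4
  · interval_cases k
    · exact c2.symm
    · exact d1.symm
    · linear_combination c1
    · linear_combination d0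
    · exact c0.symm
  · exact coeff_eq_zero_of_natDegree_lt (hF.trans_lt (by omega))

theorem wilsonScheme_surjective {φ ψ : ℂ[X]} (hφ : φ.natDegree ≤ 2) (hψ : ψ.natDegree ≤ 1) :
    ∃ F : ℂ[X], F.natDegree ≤ 4 ∧ wilsonScheme.Φ F = φ ∧ wilsonScheme.Ψ F = ψ := by
  obtain ⟨F, hF, h0, h1, h2, h3, h4⟩ := exists_coeff_eq (φ.coeff 2) (ψ.coeff 1) (-φ.coeff 1)
    (-ψ.coeff 0) (φ.coeff 0)
  refine ⟨F, hF, ?_⟩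
  obtain ⟨c2, c1, c0, d1, d0⟩ := coeff_wilsonScheme F
  constructor
  · refine ext_of_natDegree_le_two (wilsonScheme.natDegree_Φ F) hφ ?_ ?_ ?_
    · rw [c0, h4]
    · rw [c1, h2, neg_neg]
    · rw [c2, h0]
  · refine ext_of_natDegree_le_two ((wilsonScheme.natDegree_Ψ F).trans one_le_two)
      (hψ.trans one_le_two) ?_ ?_ ?_
    · rw [d0, h3, neg_neg]
    · rw [d1, h1]
    · rw [coeff_eq_zero_of_natDegree_lt ((wilsonScheme.natDegree_Ψ F).trans_lt one_lt_two),
        coeff_eq_zero_of_natDegree_lt (hψ.trans_lt one_lt_two)]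

/-- The coefficient is the homogenized sum of the parameters: it vanishes if two are infinite, is
nonzero if exactly one is, and equals `a + b + c + d` if none is. -/
theorem wilsonRegular_iff (t : Fin 4 → OnePoint ℂ) :
    (wilsonScheme.Ψ (sphereForm t)).coeff 1 ≠ 0 ↔ WilsonRegular t := by
  rw [(coeff_wilsonScheme _).2.2.2.1, WilsonRegular]
  by_cases hinf : ∃ i, t i = OnePoint.infty
  · obtain ⟨i, hi⟩ := hinf
    have hfin : ∀ a b c d : ℂ, t ≠ ![(a : OnePoint ℂ), b, c, d] := fun a b c d ht => by
      rw [ht] at hi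
      fin_cases i <;> exact absurd hi (OnePoint.coe_ne_infty _)
    by_cases hj : ∃ j, j ≠ i ∧ t j = OnePoint.infty
    · obtain ⟨j, hij, hj⟩ := hj
      obtain ⟨σ, rfl, rfl⟩ := exists_perm_two_three hij
      exact iff_of_false (fun h => h (sphereForm_of_infty_infty hj hi).2.1)
        fun h => hij (h.1 _ _ hj hi)
    · push Not at hj
      refine iff_of_true ?_ ⟨fun k l hk hl => ?_, fun a b c d ht => absurd ht (hfin a b c d)⟩
      · have hu : ∀ j, j ≠ i → uCoord (t j) ≠ 0 := fun j hji h0 =>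
          hj j hji (eq_infty_of_uCoord_eq_zero h0)
        obtain ⟨f0, f1, -⟩ := form_four (fun k => uCoord (t k)) fun k => vCoord (t k)
        change (sphereForm t).coeff 1 = _ at f1
        rw [f1]
        fin_cases i
        all_goals
          simp only [Fin.zero_eta, Fin.mk_one, Fin.reduceFinMk] at hi hu
          simp only [hi, uCoord_infty, vCoord_infty, zero_mul, mul_zero, zero_add, add_zero,
            one_mul, mul_one]
          exact mul_ne_zero (mul_ne_zero (hu _ (by decide)) (hu _ (by decide))) (hu _ (by decide))
      · by_contra hkl
        by_cases hki : k = i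
        · exact hj l (fun h => hkl (hki.trans h.symm)) hl
        · exact hj k hki hk
  · obtain ⟨τ, rfl⟩ := exists_coe_of_uCoord_ne_zero (t := t) fun i hi =>
      hinf ⟨i, eq_infty_of_uCoord_eq_zero hi⟩
    obtain ⟨f0, f1, -⟩ := form_four (fun _ => 1) τ
    rw [sphereForm_coe, f1]
    simp only [one_mul, mul_one]
    constructor
    · refine fun h => ⟨fun i j hi => absurd hi (OnePoint.coe_ne_infty _), fun a b c d ht => ?_⟩
      have hc : ∀ i x, ![(a : OnePoint ℂ), b, c, d] i = ((x : ℂ) : OnePoint ℂ) → τ i = x :=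
        fun i x hx => OnePoint.coe_injective ((congrFun ht i).trans hx)
      rwa [hc 0 a rfl, hc 1 b rfl, hc 2 c rfl, hc 3 d rfl] at h
    · refine fun h => h.2 (τ 0) (τ 1) (τ 2) (τ 3) (funext fun i => ?_)
      fin_cases i <;> rfl

/-! ### The continuous dual Hahn polynomials -/

/-- As `d → ∞`, the two shifted factorials that contain `d` grow like `d ^ k` and `d ^ (n - k)`, so
division by `d ^ n` leaves the coefficients of the `₃F₂`. -/
theorem continuousDualHahn_mem_limits (n : ℕ) (a b c : ℂ) :
    continuousDualHahn n a b c ∈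
      limits (wilson n) Set.univ n ![(a : OnePoint ℂ), b, c, OnePoint.infty] := by
  set N : ℕ → ℂ := fun j => (j : ℂ) + 1 with hN
  set w : ℕ → ℂ := fun j => 1 / ((j : ℂ) + 1) with hw
  have hN0 : ∀ j, N j ≠ 0 := fun j => Nat.cast_add_one_ne_zero j
  have hNw : ∀ j, N j * w j = 1 := fun j => mul_one_div_cancel (hN0 j)
  have hwt : Tendsto w atTop (𝓝 0) := tendsto_one_div_add_atTop_nhds_zero_nat
  have hNt : Tendsto N atTop (Bornology.cobounded ℂ) := by
    have h2 : Tendsto w atTop (𝓝[≠] 0) := tendsto_nhdsWithin_iff.2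
      ⟨hwt, Eventually.of_forall fun j => right_ne_zero_of_mul_eq_one (hNw j)⟩
    refine (tendsto_inv₀_nhdsNE_zero.comp h2).congr fun j => ?_
    exact (eq_inv_of_mul_eq_one_left (hNw j)).symm
  have hshift : ∀ x : ℂ, Tendsto (fun j => (x + N j) * w j) atTop (𝓝 1) := fun x => by
    have h := (hwt.const_mul x).add_const 1
    rw [mul_zero, zero_add] at h
    exact h.congr fun j => by linear_combination -hNw j
  have hS : continuousDualHahn n a b c = ∑ k ∈ range (n + 1), (poch (-n) k / (k.factorial : ℂ) *
      (poch (a + b + k) (n - k) * poch (a + c + k) (n - k))) • wilsonBasis a k :=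
    sum_congr rfl fun k _ => (smul_eq_C_mul _).symm
  have hdeg : ∀ k, (wilsonBasis a k).natDegree ≤ k := fun k => (natDegree_wilsonBasis a k).1.le
  refine mem_limits_of_coeffTendsto ?_ (fun j => ![a, b, c, N j]) (fun _ => Set.mem_univ _) ?_
    (f := fun j => w j ^ n • wilson n a b c (N j)) ?_ ?_
  · refine natDegree_eq_of_le_of_coeff_ne_zero ?_ ?_
    · rw [hS]
      exact natDegree_sum_smul_le hdeg _ n
    · rw [hS, sum_range_succ, coeff_add, coeff_sum_smul hdeg _ fun k hk => mem_range.1 hk, zero_add,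
        coeff_smul, smul_eq_mul, (natDegree_wilsonBasis a n).2, Nat.sub_self]
      simp only [poch_zero, mul_one]
      exact div_ne_zero (poch_neg_ne_zero le_rfl) (Nat.cast_ne_zero.2 n.factorial_ne_zero)
  · intro i
    fin_cases i
    · exact tendsto_const_nhds
    · exact tendsto_const_nhds
    · exact tendsto_const_nhds
    · exact tendsto_coe_infty_iff.2 hNt
  · rw [hS]
    simp only [wilson_eq, smul_sum, smul_smul]
    refine CoeffTendsto.sum _ fun k hk => CoeffTendsto.smul ?_ (CoeffTendsto.const _)
    have key := (((tendsto_poch_scaled (hshift (n + a + b + c - 1)) hwt k).const_mul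
      (poch (-n) k / (k.factorial : ℂ) *
        (poch (a + b + k) (n - k) * poch (a + c + k) (n - k)))).mul
      (tendsto_poch_scaled (hshift (a + k)) hwt (n - k)))
    rw [one_pow, one_pow, mul_one, mul_one] at key
    refine key.congr fun j => ?_
    rw [wilsonCoeff, show n + a + b + c - 1 + N j = n + a + b + c + N j - 1 by ring,
      add_right_comm a (N j)]
    have e : w j ^ n = w j ^ k * w j ^ (n - k) := by
      rw [← pow_add, show k + (n - k) = n by have := mem_range.1 hk; omega]
    rw [e]
    ring
  · exact Eventually.of_forall fun j => ⟨w j ^ n, smul_eq_C_mul _⟩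

/-- With exactly one infinite parameter the form has lowest coefficients `0` and `1`, so the
eigenvalue in degree `n` is `n` itself. -/
theorem simple_of_continuousDualHahn (n : ℕ) (a b c : ℂ) :
    wilsonScheme.Simple (sphereForm ![(a : OnePoint ℂ), b, c, OnePoint.infty]) n := by
  obtain ⟨f0, f1, -⟩ := form_four (fun i => uCoord (![(a : OnePoint ℂ), b, c, OnePoint.infty] i))
    fun i => vCoord (![(a : OnePoint ℂ), b, c, OnePoint.infty] i)
  refine (simple_wilsonScheme_iff _ n).2 fun k _ => ?_
  rw [sphereForm, f0, f1]
  simp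

/-! ### The quadratic lattices -/

section

variable {c₄ : ℂ}

theorem quadratic_eq (h : c₄ ≠ 0) (c₅ c₆ s : ℂ) :
    quadratic c₄ c₅ c₆ s = -c₄ * -(s + c₅ / (2 * c₄)) ^ 2 + (c₆ - c₅ ^ 2 / (4 * c₄)) := by
  rw [quadratic]
  field_simp
  ring

theorem wilsonArg_eq (c₄ c₅ c₆ : ℂ) :
    wilsonArg c₄ c₅ c₆ = C (1 / -c₄) * (X - C (c₆ - c₅ ^ 2 / (4 * c₄))) := by
  rw [wilsonArg, div_neg, neg_div]

theorem wilsonFamily_eq (c₄ c₅ c₆ : ℂ) (n : ℕ) (t : Fin 4 → OnePoint ℂ) :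
    wilsonFamily c₄ c₅ c₆ n t = limits (fun a b c d => (wilson n a b c d).comp
      (C (1 / -c₄) * (X - C (c₆ - c₅ ^ 2 / (4 * c₄))))) Set.univ n t := by
  rw [← wilsonArg_eq]
  rfl

theorem wilson_correspondence (h : c₄ ≠ 0) (c₅ c₆ : ℂ) :
    (∀ φ ψ : ℂ[X], Coefficients φ ψ →
      ∃ t : Fin 4 → OnePoint ℂ, (ψ.natDegree = 1 ↔ WilsonRegular t) ∧
        ∀ n : ℕ, 1 ≤ n → solutions (quadratic c₄ c₅ c₆) φ ψ n = wilsonFamily c₄ c₅ c₆ n t) ∧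
    (∀ t : Fin 4 → OnePoint ℂ,
      ∃ φ ψ : ℂ[X], Coefficients φ ψ ∧ (ψ.natDegree = 1 ↔ WilsonRegular t) ∧
        ∀ n : ℕ, 1 ≤ n → solutions (quadratic c₄ c₅ c₆) φ ψ n = wilsonFamily c₄ c₅ c₆ n t) := by
  simp only [wilsonFamily_eq]
  set u := c₅ / (2 * c₄) with hu
  have e1 : ∀ s r : ℂ, s + r + u = s + u + r := fun s r => by ring
  have e2 : ∀ s r : ℂ, s - r + u = s + u - r := fun s r => by ring
  refine wilsonScheme.correspondence (x₀ := fun s => -(s + u) ^ 2) (neg_ne_zero.2 h)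
    (quadratic_eq h c₅ c₆) (fun s => ?_) (fun s => ?_) ?_
    (fun F hF => wilsonScheme_injective hF) (fun φ ψ hφ hψ => wilsonScheme_surjective hφ hψ)
    (fun n => (isFamily_wilson n).natDegree_le) wilsonRegular_iff
    (fun t n hn => eigenvectors_subset_wilson t hn) isFamily_wilson
  · simp only [e1, e2]
    exact neg_sq_add _
  · simp only [e1, e2]
    exact neg_sq_sub_sq _
  · refine infinite_neg_sq_image.mono ?_
    rintro _ ⟨z, ⟨hz0, hz1, hz2⟩, rfl⟩
    refine ⟨z - u, ⟨?_, ?_, ?_⟩, by simp⟩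
    · simp only [e1, sub_add_cancel]
      exact fun h0 => hz1 (by linear_combination -h0)
    · simp only [e2]
      exact fun h0 => hz2 (by linear_combination -h0)
    · simp only [e1, e2]
      exact fun h0 => hz0 (by linear_combination -h0 / 2)

theorem wilsonFamily_coe (h : c₄ ≠ 0) (c₅ c₆ : ℂ) {n : ℕ} {a b c d : ℂ} (hn : 1 ≤ n)
    (hdeg : (wilson n a b c d).natDegree = n) :
    wilsonFamily c₄ c₅ c₆ n ![(a : OnePoint ℂ), b, c, d] =
      multiples (wilsonOn c₄ c₅ c₆ n a b c d) := by
  have hfam := isFamily_wilson n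
  rw [wilsonFamily_eq, wilsonOn, wilsonArg_eq]
  refine limits_comp_eq_multiples_comp (neg_ne_zero.2 h) _ hfam.natDegree_le ?_
  rw [← coe_vec_four]
  exact hfam.limits_coe_eq_multiples hn (τ := ![a, b, c, d]) (Set.mem_univ _) hdeg

theorem wilsonFamily_infty (h : c₄ ≠ 0) (c₅ c₆ : ℂ) {n : ℕ} (a b c : ℂ) (hn : 1 ≤ n) :
    wilsonFamily c₄ c₅ c₆ n ![(a : OnePoint ℂ), b, c, OnePoint.infty] =
      multiples (continuousDualHahnOn c₄ c₅ c₆ n a b c) := by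
  have hfam := isFamily_wilson n
  rw [wilsonFamily_eq, continuousDualHahnOn, wilsonArg_eq]
  exact limits_comp_eq_multiples_comp (neg_ne_zero.2 h) _ hfam.natDegree_le
    (hfam.limits_eq_multiples hn (simple_of_continuousDualHahn n a b c)
      (continuousDualHahn_mem_limits n a b c))

end

end QuadraticLattice

end

theorem corollary3p9 :
    -- `q`-quadratic lattices; `w` is a square root of `c₁ c₂`
    (∀ q c₁ c₂ c₃ w : ℂ, q ≠ 0 → (∀ k : ℕ, 1 ≤ k → q ^ k ≠ 1) → c₁ * c₂ ≠ 0 → w ^ 2 = c₁ * c₂ →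
      (∀ φ ψ : ℂ[X], QuadraticLattice.Coefficients φ ψ →
        ∃ t : Fin 4 → OnePoint ℂ, (ψ.natDegree = 1 ↔ QuadraticLattice.AWRegular t) ∧
          ∀ n : ℕ, 1 ≤ n →
            QuadraticLattice.solutions (QuadraticLattice.qQuadratic q c₁ c₂ c₃) φ ψ n
              = QuadraticLattice.askeyWilsonFamily q c₃ w n t) ∧
      (∀ t : Fin 4 → OnePoint ℂ,
        ∃ φ ψ : ℂ[X], QuadraticLattice.Coefficients φ ψ ∧
          (ψ.natDegree = 1 ↔ QuadraticLattice.AWRegular t) ∧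
          ∀ n : ℕ, 1 ≤ n →
            QuadraticLattice.solutions (QuadraticLattice.qQuadratic q c₁ c₂ c₃) φ ψ n
              = QuadraticLattice.askeyWilsonFamily q c₃ w n t) ∧
      (∀ (n : ℕ) (a b c d : ℂ), 1 ≤ n → a ≠ 0 →
        (QuadraticLattice.askeyWilson q n a b c d).natDegree = n →
          QuadraticLattice.askeyWilsonFamily q c₃ w n ![(a : OnePoint ℂ), b, c, d]
            = QuadraticLattice.multiples (QuadraticLattice.askeyWilsonOn q c₃ w n a b c d))) ∧
    -- quadratic lattices
    (∀ c₄ c₅ c₆ : ℂ, c₄ ≠ 0 →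
      (∀ φ ψ : ℂ[X], QuadraticLattice.Coefficients φ ψ →
        ∃ t : Fin 4 → OnePoint ℂ, (ψ.natDegree = 1 ↔ QuadraticLattice.WilsonRegular t) ∧
          ∀ n : ℕ, 1 ≤ n →
            QuadraticLattice.solutions (QuadraticLattice.quadratic c₄ c₅ c₆) φ ψ n
              = QuadraticLattice.wilsonFamily c₄ c₅ c₆ n t) ∧
      (∀ t : Fin 4 → OnePoint ℂ,
        ∃ φ ψ : ℂ[X], QuadraticLattice.Coefficients φ ψ ∧
          (ψ.natDegree = 1 ↔ QuadraticLattice.WilsonRegular t) ∧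
          ∀ n : ℕ, 1 ≤ n →
            QuadraticLattice.solutions (QuadraticLattice.quadratic c₄ c₅ c₆) φ ψ n
              = QuadraticLattice.wilsonFamily c₄ c₅ c₆ n t) ∧
      (∀ (n : ℕ) (a b c d : ℂ), 1 ≤ n →
        (QuadraticLattice.wilson n a b c d).natDegree = n →
          QuadraticLattice.wilsonFamily c₄ c₅ c₆ n ![(a : OnePoint ℂ), b, c, d]
            = QuadraticLattice.multiples (QuadraticLattice.wilsonOn c₄ c₅ c₆ n a b c d)) ∧
      (∀ (n : ℕ) (a b c : ℂ), 1 ≤ n →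
        QuadraticLattice.wilsonFamily c₄ c₅ c₆ n ![(a : OnePoint ℂ), b, c, OnePoint.infty]
          = QuadraticLattice.multiples
              (QuadraticLattice.continuousDualHahnOn c₄ c₅ c₆ n a b c))) := by
  refine ⟨fun q c₁ c₂ c₃ w hq hr hc hw => ?_, fun c₄ c₅ c₆ h => ?_⟩
  · have hw0 : w ≠ 0 := by
      rintro rfl
      exact hc (by rw [← hw]; norm_num)
    have hmain := QuadraticLattice.askeyWilson_correspondence hq hr hc hw c₃
    exact ⟨hmain.1, hmain.2, fun n a b c d hn ha hdeg =>
      QuadraticLattice.askeyWilsonFamily_coe hq hr hw0 c₃ hn ha hdeg⟩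
  · have hmain := QuadraticLattice.wilson_correspondence h c₅ c₆
    exact ⟨hmain.1, hmain.2,
      fun n a b c d hn hdeg => QuadraticLattice.wilsonFamily_coe h c₅ c₆ hn hdeg,
      fun n a b c hn => QuadraticLattice.wilsonFamily_infty h c₅ c₆ a b c hn⟩
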